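/- **Setting.** Let $n\ge 2$, $d\ge 1$, and let $\|\cdot\|_\ell$ be a symmetric norm on $\mathbb{R}^n$, i.e. a norm invariant under permutations of the coordinates and under sign flips. For $k\le n$ let $\|(x_1,\dots,x_k)\|_{\ell^{(k)}}=\|(x_1,\dots,x_k,0,\dots,0)\|_\ell$. For a norm $\|\cdot\|$ on $\mathbb{R}^k$ let $M$ be its median with respect to the uniform distribution on the Euclidean unit sphere $\mathbb{S}^{k-1}$, and put $\mathrm{mc}=\max_{x\in\mathbb{S}^{k-1}}\|x\|/M$; let $\mathrm{mmc}(\ell)=\max_{1\le k\le n}\mathrm{mc}(\ell^{(k)})$. Let $K\ge K_0$ be positive integers and let $t,m_1,m_2\ge 0$ be integers with $2^t\le n\le K2^t$, $K_0d^2\le m_1\le Kd^2$ and $K_0d\le m_2\le Kd$. A *SymSketch* with these parameters is the random matrix $S=\Pi\widetilde D\in\mathbb{R}^{m_2\times n}$, where * $\widetilde D\in\mathbb{R}^{n(t+1)\times n}$ is obtained by stacking $w_0D_0,\dots,w_tD_t$; here $D_i=\mathrm{diag}(z_{i,1},\dots,z_{i,n})$ with $z_{i,j}\sim\mathrm{Ber}(2^{-i})$,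 and $w_i=\|(1,\dots,1,0,\dots,0)\|_\ell$ with $2^i$ ones; * $\Pi=\frac1{\sqrt{m_2}}G\,\Phi D$; here $D$ is diagonal with uniform $\pm1$ entries, $\Phi\in\{0,1\}^{m_1\times n(t+1)}$ has exactly one $1$ in each column, at a uniformly random row, and $G\in\mathbb{R}^{m_2\times m_1}$ has standard Gaussian entries; and all random choices are independent. **Theorem.** There are $K_0$, an exponent $p$ and one program (for a random access machine with unit-cost real arithmetic) such that for every $K\ge K_0$ there are constants $c,C>0$ for which the following holds for all $n,d,t,m_1,m_2$ and $\ell$ as above and every fixed matrix $A\in\mathbb{R}^{n\times d}$. 1. With probability at least $0.9$, for all $x\in\mathbb{R}^d$, $$\frac{c}{\sqrt d\,\log^3 n}\,\|Ax\|_\ell\ \le\ \|SAx\|_2\ \le\ C\,\mathrm{mmc}(\ell)\,d^2\log^{5/2}n\,\|Ax\|_\ell .$$ 2. Given $A$ and the factors $\widetilde D$, $\Phi D$ of $S$ in compressed sparse column format and the factor $\frac1{\sqrt{m_2}}G$ as a full table, the program computes $SA$. Its number of steps is at most $C(\mathrm{nnz}(A)\log n+d^{p})$ for every outcome of the random choices,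 and at most $C(\mathrm{nnz}(A)+d^{p})$ in expectation, where $\mathrm{nnz}(A)$ is the number of non-zero entries of $A$. In this sense $SA$ is computed in $\widetilde O(\mathrm{nnz}(A)+\mathrm{poly}(d))$ time. -/

import Mathlib

open MeasureTheory ProbabilityTheory

noncomputable section

namespace SymSketch

/-! ### Symmetric norms -/

/-- A norm on `ℝⁿ` (a definite seminorm) that is invariant under permutations of the coordinates
and under sign flips. -/
structure IsSymmetricNorm {n : ℕ} (ℓ : Seminorm ℝ (Fin n → ℝ)) : Prop where
  definite : ∀ x, ℓ x = 0 → x = 0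
  perm : ∀ (π : Equiv.Perm (Fin n)) (x : Fin n → ℝ), ℓ (fun i => x (π i)) = ℓ x
  sign : ∀ (s : Fin n → ℝ), (∀ i, s i = 1 ∨ s i = -1) → ∀ x, ℓ (fun i => s i * x i) = ℓ x

/-- The linear map `(x₁, …, x_k) ↦ (x₁, …, x_k, 0, …, 0)` from `ℝᵏ` to `ℝⁿ` (for `k ≤ n`). -/
def pad (k n : ℕ) : (Fin k → ℝ) →ₗ[ℝ] (Fin n → ℝ) where
  toFun x i := if h : (i : ℕ) < k then x ⟨i, h⟩ else 0
  map_add' x y := by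
    funext i
    by_cases h : (i : ℕ) < k <;> simp [h]
  map_smul' a x := by
    funext i
    by_cases h : (i : ℕ) < k <;> simp [h]

/-- The induced norm `ℓ^{(k)}` on `ℝᵏ`. -/
def restrictNorm {n : ℕ} (ℓ : Seminorm ℝ (Fin n → ℝ)) (k : ℕ) : Seminorm ℝ (Fin k → ℝ) :=
  ℓ.comp (pad k n)

/-- The unit Euclidean sphere of `ℝᵏ`. -/
abbrev UnitSphere (k : ℕ) : Type := Metric.sphere (0 : EuclideanSpace ℝ (Fin k)) 1

/-- The uniform probability distribution on the unit Euclidean sphere of `ℝᵏ`. -/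
def uniformSphere (k : ℕ) : Measure (UnitSphere k) :=
  ((volume : Measure (EuclideanSpace ℝ (Fin k))).toSphere Set.univ)⁻¹ •
    (volume : Measure (EuclideanSpace ℝ (Fin k))).toSphere

/-- The value of `ℓ` at a point of the unit sphere. -/
def onSphere {k : ℕ} (ℓ : Seminorm ℝ (Fin k → ℝ)) (x : UnitSphere k) : ℝ :=
  ℓ (fun i => (x : EuclideanSpace ℝ (Fin k)) i)

/-- `M` is a median of `ℓ` under the uniform distribution on the sphere. -/
def IsMedian {k : ℕ} (ℓ : Seminorm ℝ (Fin k → ℝ)) (M : ℝ) : Prop :=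
  1 / 2 ≤ (uniformSphere k).real {x | M ≤ onSphere ℓ x} ∧
    1 / 2 ≤ (uniformSphere k).real {x | onSphere ℓ x ≤ M}

/-- The median `M_ℓ`. For a norm on `ℝᵏ` with `k ≥ 1` there is exactly one median, so the infimum
only picks that value. -/
def median {k : ℕ} (ℓ : Seminorm ℝ (Fin k → ℝ)) : ℝ := sInf {M | IsMedian ℓ M}

/-- The modulus of concentration `mc(ℓ) = max_{x ∈ S^{k-1}} ℓ(x) / M_ℓ`. -/
def mc {k : ℕ} (ℓ : Seminorm ℝ (Fin k → ℝ)) : ℝ := ⨆ x : UnitSphere k, onSphere ℓ x / median ℓ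

/-- The maximum modulus of concentration `mmc(ℓ) = max_{1 ≤ k ≤ n} mc(ℓ^{(k)})`. -/
def mmc {n : ℕ} (ℓ : Seminorm ℝ (Fin n → ℝ)) : ℝ :=
  ⨆ k : Fin n, mc (restrictNorm ℓ ((k : ℕ) + 1))

/-- The Euclidean norm of a vector. -/
def norm2 {m : ℕ} (x : Fin m → ℝ) : ℝ := ‖(WithLp.toLp 2 x : EuclideanSpace ℝ (Fin m))‖

/-! ### The random sketching matrix -/

/-- The weight `w_i = ℓ(1, …, 1, 0, …, 0)` with `2 ^ i` ones. -/
def weight {n : ℕ} (ℓ : Seminorm ℝ (Fin n → ℝ)) (i : ℕ) : ℝ :=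
  ℓ (fun j => if (j : ℕ) < 2 ^ i then 1 else 0)

/-- The probability `2⁻ⁱ`. -/
def halfPow (i : ℕ) : unitInterval :=
  ⟨(1 / 2 : ℝ) ^ i, by positivity, pow_le_one₀ (by norm_num) (by norm_num)⟩

/-- The random bits behind the sketch: the sampling bits `z_{i,j}`, the signs and the hash values
of CountSketch, and the (unnormalized) entries of the Gaussian embedding. -/
structure Seed (n t m₁ m₂ : ℕ) where
  /-- the sampling bits `z_{i,j}` -/
  z : Fin (t + 1) × Fin n → Bool
  /-- the signs of CountSketch -/
  sgn : Fin ((t + 1) * n) → Bool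
  /-- the hash function of CountSketch -/
  h : Fin ((t + 1) * n) → Fin m₁
  /-- the standard Gaussian entries -/
  g : Fin m₂ × Fin m₁ → ℝ

/-- A seed as a point of a product space. -/
def Seed.toProd {n t m₁ m₂ : ℕ} (ω : Seed n t m₁ m₂) :
    (Fin (t + 1) × Fin n → Bool) × (Fin ((t + 1) * n) → Bool) ×
      (Fin ((t + 1) * n) → Fin m₁) × (Fin m₂ × Fin m₁ → ℝ) :=
  (ω.z, ω.sgn, ω.h, ω.g)

/-- The product σ-algebra on seeds. -/
instance (n t m₁ m₂ : ℕ) : MeasurableSpace (Seed n t m₁ m₂) :=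
  MeasurableSpace.comap Seed.toProd inferInstance

/-- The law of the seed: all coordinates are independent, `z_{i,j} ∼ Ber(2⁻ⁱ)`, signs and hash
values are uniform, and the entries of the Gaussian matrix are standard Gaussian. -/
def seedLaw (n t m₁ m₂ : ℕ) : Measure (Seed n t m₁ m₂) :=
  ((Measure.pi fun ij : Fin (t + 1) × Fin n => bernoulliMeasure true false (halfPow ij.1)).prod
    ((Measure.pi fun _ : Fin ((t + 1) * n) => (uniformOn Set.univ : Measure Bool)).prod
      ((Measure.pi fun _ : Fin ((t + 1) * n) => (uniformOn Set.univ : Measure (Fin m₁))).prod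
        (Measure.pi fun _ : Fin m₂ × Fin m₁ => gaussianReal 0 1)))).map
    fun p => ⟨p.1, p.2.1, p.2.2.1, p.2.2.2⟩

/-- The matrix `D̃` obtained by stacking `w_0 D_0, w_1 D_1, …, w_t D_t`, where
`D_i = diag(z_{i,1}, …, z_{i,n})`; the row `i * n + j` is the `j`-th row of the `i`-th block. -/
def samplingMatrix {n t m₁ m₂ : ℕ} (ℓ : Seminorm ℝ (Fin n → ℝ)) (ω : Seed n t m₁ m₂) :
    Matrix (Fin ((t + 1) * n)) (Fin n) ℝ :=
  Matrix.of fun k c =>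
    weight ℓ (finProdFinEquiv.symm k).1 *
      Matrix.diagonal (fun j => if ω.z ((finProdFinEquiv.symm k).1, j) then (1 : ℝ) else 0)
        (finProdFinEquiv.symm k).2 c

/-- The CountSketch embedding `Φ D`: the column `k` has the single non-zero entry `±1`,
in row `h k`. -/
def countSketch {n t m₁ m₂ : ℕ} (ω : Seed n t m₁ m₂) :
    Matrix (Fin m₁) (Fin ((t + 1) * n)) ℝ :=
  (Matrix.of fun b k => if ω.h k = b then (1 : ℝ) else 0) *
    Matrix.diagonal (fun k => if ω.sgn k then (1 : ℝ) else -1)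

/-- The Gaussian embedding `(1 / √m₂) G`. -/
def gaussianEmbedding {n t m₁ m₂ : ℕ} (ω : Seed n t m₁ m₂) : Matrix (Fin m₂) (Fin m₁) ℝ :=
  (1 / √(m₂ : ℝ)) • Matrix.of fun a b => ω.g (a, b)

/-- The sketch `S = Π D̃`, where `Π` is the composition of a Gaussian embedding and a CountSketch
embedding. -/
def sketch {n t m₁ m₂ : ℕ} (ℓ : Seminorm ℝ (Fin n → ℝ)) (ω : Seed n t m₁ m₂) :
    Matrix (Fin m₂) (Fin n) ℝ :=
  (gaussianEmbedding ω * countSketch ω) * samplingMatrix ℓ ω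

/-- The number of non-zero entries of a matrix. -/
def nnz {n d : ℕ} (A : Matrix (Fin n) (Fin d) ℝ) : ℕ :=
  Set.ncard {p : Fin n × Fin d | A p.1 p.2 ≠ 0}

/-! ### A random access machine with real arithmetic and unit costs -/

/-- The memory of the machine: registers and arrays for natural numbers (used as indices),
and registers and arrays for real numbers. A program mentions only finitely many registers and
arrays. -/
structure Memory where
  /-- index registers -/
  w : ℕ → ℕ
  /-- real registers -/
  r : ℕ → ℝ
  /-- index arrays: `W a i` is the `i`-th cell of the `a`-th array -/
  W : ℕ → ℕ → ℕ
  /-- real arrays: `R a i` is the `i`-th cell of the `a`-th array -/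
  R : ℕ → ℕ → ℝ

/-- Elementary instructions. Numbers in the code are names of registers or arrays, or the constant
to be written. -/
inductive Instr where
  /-- `w x := k` -/
  | constW (x k : ℕ)
  /-- `w x := w y + w z` -/
  | addW (x y z : ℕ)
  /-- `w x := w y - w z` (truncated at `0`) -/
  | subW (x y z : ℕ)
  /-- `w x := W a (w i)` -/
  | loadW (x a i : ℕ)
  /-- `W a (w i) := w x` -/
  | storeW (a i x : ℕ)
  /-- `r x := q` -/
  | constR (x : ℕ) (q : ℤ)
  /-- `r x := r y + r z` -/
  | addR (x y z : ℕ)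
  /-- `r x := r y - r z` -/
  | subR (x y z : ℕ)
  /-- `r x := r y * r z` -/
  | mulR (x y z : ℕ)
  /-- `r x := R a (w i)` -/
  | loadR (x a i : ℕ)
  /-- `R a (w i) := r x` -/
  | storeR (a i x : ℕ)

/-- The effect of an elementary instruction. -/
def Instr.run : Instr → Memory → Memory
  | .constW x k, s => { s with w := Function.update s.w x k }
  | .addW x y z, s => { s with w := Function.update s.w x (s.w y + s.w z) }
  | .subW x y z, s => { s with w := Function.update s.w x (s.w y - s.w z) }
  | .loadW x a i, s => { s with w := Function.update s.w x (s.W a (s.w i)) }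
  | .storeW a i x, s =>
      { s with W := Function.update s.W a (Function.update (s.W a) (s.w i) (s.w x)) }
  | .constR x q, s => { s with r := Function.update s.r x (q : ℝ) }
  | .addR x y z, s => { s with r := Function.update s.r x (s.r y + s.r z) }
  | .subR x y z, s => { s with r := Function.update s.r x (s.r y - s.r z) }
  | .mulR x y z, s => { s with r := Function.update s.r x (s.r y * s.r z) }
  | .loadR x a i, s => { s with r := Function.update s.r x (s.R a (s.w i)) }
  | .storeR a i x, s =>
      { s with R := Function.update s.R a (Function.update (s.R a) (s.w i) (s.r x)) }

/-- Programs: finite texts built from elementary instructions, sequencing, branching and loops. -/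
inductive Program where
  | instr (i : Instr)
  | seq (P Q : Program)
  /-- if `w x < w y` then `P` else `Q` -/
  | ifLt (x y : ℕ) (P Q : Program)
  /-- while `w x < w y` do `P` -/
  | whileLt (x y : ℕ) (P : Program)

/-- `Exec P s k s'`: started in memory `s`, the program `P` halts after `k` steps in memory `s'`.
An elementary instruction and a comparison cost one step each. -/
inductive Exec : Program → Memory → ℕ → Memory → Prop
  | instr (i : Instr) (s : Memory) : Exec (.instr i) s 1 (i.run s)
  | seq {P Q : Program} {s s' s'' : Memory} {k k' : ℕ} :
      Exec P s k s' → Exec Q s' k' s'' → Exec (.seq P Q) s (k + k') s''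
  | ifTrue {x y : ℕ} {P Q : Program} {s s' : Memory} {k : ℕ} :
      s.w x < s.w y → Exec P s k s' → Exec (.ifLt x y P Q) s (k + 1) s'
  | ifFalse {x y : ℕ} {P Q : Program} {s s' : Memory} {k : ℕ} :
      ¬ s.w x < s.w y → Exec Q s k s' → Exec (.ifLt x y P Q) s (k + 1) s'
  | whileTrue {x y : ℕ} {P : Program} {s s' s'' : Memory} {k k' : ℕ} :
      s.w x < s.w y → Exec P s k s' → Exec (.whileLt x y P) s' k' s'' →
        Exec (.whileLt x y P) s (k + k' + 1) s''
  | whileFalse {x y : ℕ} {P : Program} {s : Memory} :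
      ¬ s.w x < s.w y → Exec (.whileLt x y P) s 1 s

/-- The arrays `ptr`, `idx`, `val` hold the matrix `M` in compressed sparse column format: the
positions `ptr j, …, ptr (j + 1) - 1` list the non-zero entries of the column `j`, each of them
once and in any order, with its row in `idx` and its value in `val`. -/
structure IsSparse {N c : ℕ} (M : Matrix (Fin N) (Fin c) ℝ) (ptr idx : ℕ → ℕ) (val : ℕ → ℝ) :
    Prop where
  start : ptr 0 = 0
  mono : ∀ j : Fin c, ptr j ≤ ptr (j + 1)
  rows : ∀ j : Fin c, Set.BijOn idx (Set.Ico (ptr j) (ptr (j + 1)))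
    (Fin.val '' {i : Fin N | M i j ≠ 0})
  vals : ∀ (j : Fin c) (q : ℕ) (i : Fin N), q ∈ Set.Ico (ptr j) (ptr (j + 1)) →
    idx q = i → val q = M i j

/-- The memory `s` holds the dimensions, the matrix `A`, and the three factors of the sketch
`S = G · C · D`: the sparse matrices in compressed sparse column format and the Gaussian matrix `G`
as a full table, row by row. The contents of all other cells are arbitrary. -/
structure IsInput {n d N m₁ m₂ : ℕ} (A : Matrix (Fin n) (Fin d) ℝ)
    (D : Matrix (Fin N) (Fin n) ℝ) (C : Matrix (Fin m₁) (Fin N) ℝ)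
    (G : Matrix (Fin m₂) (Fin m₁) ℝ) (s : Memory) : Prop where
  dim_n : s.w 0 = n
  dim_d : s.w 1 = d
  dim_N : s.w 2 = N
  dim_m₁ : s.w 3 = m₁
  dim_m₂ : s.w 4 = m₂
  mat_A : IsSparse A (s.W 0) (s.W 1) (s.R 0)
  mat_D : IsSparse D (s.W 2) (s.W 3) (s.R 1)
  mat_C : IsSparse C (s.W 4) (s.W 5) (s.R 2)
  mat_G : ∀ (a : Fin m₂) (b : Fin m₁), s.R 3 (a * m₁ + b) = G a b

/-- The memory `s` holds the matrix `B` in the real array `4`, row by row. -/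
def IsOutput {m d : ℕ} (B : Matrix (Fin m) (Fin d) ℝ) (s : Memory) : Prop :=
  ∀ (a : Fin m) (c : Fin d), s.R 4 (a * d + c) = B a c

end SymSketch

end

/-!
The sketch is a composition of three random linear maps, and each of them is controlled on the
range `V` of `A`, of dimension at most `d`, or on the image of `V` under the previous maps.

*Sampling.* For `y ∈ ℝⁿ` the Euclidean norm of `D̃ y` is compared with `ℓ y`. For the upper bound,
the first moment of the largest `2 ^ i` coordinates of `y` and the second moment of the others are
estimated on each level `i`. What makes the second part work is that the flat Euclidean unit
vectors have almost increasing norms: `ℓ^{(j)}` of the flat vector with `k ≤ j` ones is at most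
`mc` times the median, and the median is at most `O(√log j)` times the norm of the flat unit
vector with `j` ones, since the coordinates of a random point of the sphere are `O(√(log j / j))`
(`IsSymmetricNorm.flatNorm_div_sqrt_le`). This gives `𝔼 ‖D̃ y‖ ≤ O(mmc · log² n) ℓ y`
(`IsSymmetricNorm.integral_norm_sampleMap_le`). For an Auerbach basis of `V`, Markov's inequality
for the sum of the norms of the images of the basis vectors then bounds all of `V` at the price of
a factor `O(d)`. For the lower bound, some dyadic level set of `y`, with `2 ^ s` coordinates,
carries a `1 / log n` fraction of the norm. On level `s - q` about `2 ^ q` of these coordinates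
survive, up to a probability exponentially small in `2 ^ q`, and they retain a `2 ^ (-q / 2)`
fraction of the norm (`IsSymmetricNorm.prob_norm_sampleMap_lt`). With `2 ^ q` of order `d log n` a
union bound over a grid in Auerbach coordinates covers all of `V`
(`IsSymmetricNorm.prob_exists_norm_sampleMap_lt`).

*CountSketch.* The error on an inner product is a Rademacher chaos supported on the collisions of
the hash function; its second moment shows that `O(d²)` buckets preserve an orthonormal basis,
hence the subspace (`prob_countSketchMap_distort`).

*Gaussian embedding.* Tail bounds for the chi-square distribution and a net of the unit sphere
(`prob_gaussMap_distort`).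

The program sends every non-zero entry `A j c` through the non-zero entries of the column `j` of
`D̃`; each of these meets a single non-zero entry of `Φ D`. There are at most `t + 1 = O(log n)`
of them, and `∑ᵢ 2⁻ⁱ ≤ 2` in expectation. The remaining work is a product with a dense matrix,
whose cost is polynomial in `d` (`IsInput.runs_sketchProgram`, `integral_timeBound_le`).
-/

namespace SymSketch

/-! ### Symmetric norms and flat vectors -/

section SymmetricNorm

variable {n : ℕ} {ℓ : Seminorm ℝ (Fin n → ℝ)}

/-- The norm `ℓ(1, …, 1, 0, …, 0)` of the flat vector with `b` ones, so that
`weight ℓ i = flatNorm ℓ (2 ^ i)`. -/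
noncomputable def flatNorm (ℓ : Seminorm ℝ (Fin n → ℝ)) (b : ℕ) : ℝ :=
  ℓ (fun j => if (j : ℕ) < b then 1 else 0)

lemma weight_eq_flatNorm (ℓ : Seminorm ℝ (Fin n → ℝ)) (i : ℕ) :
    weight ℓ i = flatNorm ℓ (2 ^ i) := rfl

lemma IsSymmetricNorm.update_le (hℓ : IsSymmetricNorm ℓ) (z : Fin n → ℝ) (a : Fin n) (c : ℝ)
    (hc : |c| ≤ |z a|) : ℓ (Function.update z a c) ≤ ℓ z := by
  by_cases hz : z a = 0
  · have : c = 0 := by simpa [hz] using hc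
    rw [this, ← hz, Function.update_eq_self]
  -- the updated vector is a convex combination of `z` and of `z` with the `a`-th sign flipped
  have hq : |c / z a| ≤ 1 := by
    rw [abs_div]
    exact div_le_one_of_le₀ hc (abs_nonneg _)
  obtain ⟨hq1, hq2⟩ := abs_le.1 hq
  set q := c / z a with hqd
  have hcq : c = q * z a := by rw [hqd]; field_simp
  let s : Fin n → ℝ := fun i => if i = a then -1 else 1
  have hs : ∀ i, s i = 1 ∨ s i = -1 := by
    intro i
    by_cases h : i = a <;> simp [s, h]
  have key : Function.update z a c
      = ((1 + q) / 2) • z + ((1 - q) / 2) • (fun i => s i * z i) := by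
    funext i
    by_cases h : i = a
    · subst h
      simp [s, hcq]
      ring
    · simp [s, h]
      ring
  calc ℓ (Function.update z a c)
      ≤ ℓ (((1 + q) / 2) • z) + ℓ (((1 - q) / 2) • (fun i => s i * z i)) := by
        rw [key]; exact map_add_le_add ℓ _ _
    _ = (1 + q) / 2 * ℓ z + (1 - q) / 2 * ℓ z := by
        rw [map_smul_eq_mul, map_smul_eq_mul, hℓ.sign s hs z, Real.norm_of_nonneg (by linarith),
          Real.norm_of_nonneg (by linarith)]
    _ = ℓ z := by ring

/-- A symmetric norm is monotone in the absolute values of the coordinates. -/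
lemma IsSymmetricNorm.mono (hℓ : IsSymmetricNorm ℓ) {x y : Fin n → ℝ}
    (hxy : ∀ i, |x i| ≤ |y i|) : ℓ x ≤ ℓ y := by
  classical
  have key : ∀ S : Finset (Fin n), ℓ (fun i => if i ∈ S then x i else y i) ≤ ℓ y := by
    intro S
    induction S using Finset.induction_on with
    | empty => simp
    | insert a S ha ih =>
      refine le_trans ?_ ih
      have : (fun i => if i ∈ insert a S then x i else y i)
          = Function.update (fun i => if i ∈ S then x i else y i) a (x a) := by
        funext i
        by_cases h : i = a
        · subst h; simp
        · simp [h]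
      rw [this]
      exact hℓ.update_le _ _ _ (by simpa [ha] using hxy a)
  simpa using key Finset.univ

lemma IsSymmetricNorm.indicator_eq (hℓ : IsSymmetricNorm ℓ) (S : Finset (Fin n)) :
    ℓ (fun j => if j ∈ S then 1 else 0) = flatNorm ℓ S.card := by
  classical
  have hS : S.card ≤ n := by simpa using S.card_le_univ
  have hc : Fintype.card {i : Fin n // i ∈ S} = Fintype.card {i : Fin n // (i : ℕ) < S.card} := by
    rw [Fintype.card_coe, Fintype.card_subtype]
    have := Fin.card_filter_val_lt (n := n) (m := S.card)
    omega
  let e := Fintype.equivOfCardEq hc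
  rw [flatNorm, ← hℓ.perm e.extendSubtype (fun j => if (j : ℕ) < S.card then 1 else 0)]
  congr 1
  funext i
  by_cases hi : i ∈ S
  · rw [if_pos hi, if_pos (e.extendSubtype_mem i hi)]
  · rw [if_neg hi, if_neg (e.extendSubtype_not_mem i hi)]

lemma flatNorm_nonneg (ℓ : Seminorm ℝ (Fin n → ℝ)) (b : ℕ) : 0 ≤ flatNorm ℓ b := apply_nonneg ℓ _

lemma IsSymmetricNorm.flatNorm_mono (hℓ : IsSymmetricNorm ℓ) : Monotone (flatNorm ℓ) := by
  intro a b hab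
  refine hℓ.mono fun i => ?_
  by_cases h : (i : ℕ) < a
  · simp [h, h.trans_le hab]
  · simp [h]

lemma IsSymmetricNorm.flatNorm_pos (hℓ : IsSymmetricNorm ℓ) (hn : 0 < n) {b : ℕ} (hb : 0 < b) :
    0 < flatNorm ℓ b := by
  refine lt_of_le_of_ne (flatNorm_nonneg ℓ b) fun h => ?_
  have := congrFun (hℓ.definite _ h.symm) ⟨0, hn⟩
  simp [hb] at this

lemma flatNorm_le_flatNorm_n (ℓ : Seminorm ℝ (Fin n → ℝ)) {b : ℕ} (hb : n ≤ b) :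
    flatNorm ℓ b = flatNorm ℓ n := by
  unfold flatNorm
  congr 1
  funext j
  simp [j.2, j.2.trans_le hb]

lemma IsSymmetricNorm.flatNorm_add_le (hℓ : IsSymmetricNorm ℓ) (a b : ℕ) :
    flatNorm ℓ (a + b) ≤ flatNorm ℓ a + flatNorm ℓ b := by
  classical
  let S : Finset (Fin n) := Finset.univ.filter fun j => a ≤ (j : ℕ) ∧ (j : ℕ) < a + b
  have hS : S.card ≤ b := by
    have : (S.map Fin.valEmbedding) ⊆ Finset.Ico a (a + b) := by
      intro j hj
      simp only [Finset.mem_map, S, Finset.mem_filter] at hj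
      obtain ⟨i, hi, rfl⟩ := hj
      simpa using hi.2
    simpa using Finset.card_le_card this
  have key : (fun j : Fin n => if (j : ℕ) < a + b then (1 : ℝ) else 0)
      = (fun j : Fin n => if (j : ℕ) < a then (1 : ℝ) else 0) +
        (fun j : Fin n => if j ∈ S then (1 : ℝ) else 0) := by
    funext j
    by_cases h1 : (j : ℕ) < a
    · have : (j : ℕ) < a + b := by omega
      simp [S, h1, this]
    · simp [S, h1, not_lt.1 h1]
  calc flatNorm ℓ (a + b) ≤ ℓ (fun j : Fin n => if (j : ℕ) < a then (1 : ℝ) else 0) +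
          ℓ (fun j : Fin n => if j ∈ S then (1 : ℝ) else 0) := by
        rw [flatNorm, key]; exact map_add_le_add ℓ _ _
    _ = flatNorm ℓ a + flatNorm ℓ S.card := by rw [← hℓ.indicator_eq S]; rfl
    _ ≤ _ := by gcongr; exact hℓ.flatNorm_mono hS

lemma IsSymmetricNorm.flatNorm_mul_le (hℓ : IsSymmetricNorm ℓ) (m b : ℕ) :
    flatNorm ℓ (m * b) ≤ m * flatNorm ℓ b := by
  induction m with
  | zero =>
    have : (fun _ : Fin n => (0 : ℝ)) = 0 := rfl
    simp [flatNorm, this]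
  | succ m ih =>
    rw [Nat.succ_mul]
    refine (hℓ.flatNorm_add_le _ _).trans ?_
    push_cast
    linarith

/-- Up to the factor two, `b ↦ flatNorm ℓ b / b` is decreasing. -/
lemma IsSymmetricNorm.flatNorm_le_two_mul_div (hℓ : IsSymmetricNorm ℓ) {j k : ℕ} (hj : 0 < j)
    (hjk : j ≤ k) : flatNorm ℓ k ≤ 2 * ((k : ℝ) / j) * flatNorm ℓ j := by
  have h1 : k ≤ (k / j + 1) * j := by
    have := Nat.div_add_mod k j
    have := Nat.mod_lt k hj
    nlinarith
  have h2 : ((k / j + 1 : ℕ) : ℝ) ≤ 2 * ((k : ℝ) / j) := by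
    have a1 : ((k / j : ℕ) : ℝ) ≤ (k : ℝ) / j := Nat.cast_div_le
    have a2 : (1 : ℝ) ≤ (k : ℝ) / j := by
      rw [le_div_iff₀ (by positivity)]
      simpa using hjk
    push_cast
    linarith
  calc flatNorm ℓ k ≤ flatNorm ℓ ((k / j + 1) * j) := hℓ.flatNorm_mono h1
    _ ≤ ((k / j + 1 : ℕ) : ℝ) * flatNorm ℓ j := hℓ.flatNorm_mul_le _ _
    _ ≤ _ := mul_le_mul_of_nonneg_right h2 (flatNorm_nonneg _ _)

lemma exists_perm_antitone_abs (y : Fin n → ℝ) :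
    ∃ σ : Equiv.Perm (Fin n), Antitone fun i => |y (σ i)| := by
  refine ⟨Tuple.sort (fun i => -|y i|), fun i j hij => ?_⟩
  have := Tuple.monotone_sort (fun i => -|y i|) hij
  simpa using this

lemma IsSymmetricNorm.sorted_mul_flatNorm_le (hℓ : IsSymmetricNorm ℓ) {y : Fin n → ℝ}
    {σ : Equiv.Perm (Fin n)} (hσ : Antitone fun i => |y (σ i)|) (j : Fin n) :
    |y (σ j)| * flatNorm ℓ (j + 1) ≤ ℓ y := by
  rw [← hℓ.perm σ y, ← abs_abs, ← Real.norm_eq_abs, flatNorm, ← map_smul_eq_mul]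
  refine hℓ.mono fun i => ?_
  by_cases h : (i : ℕ) < j + 1
  · have : i ≤ j := by rw [Fin.le_def]; omega
    simpa [this] using hσ this
  · have : ¬ i ≤ j := by rw [Fin.le_def]; omega
    simp [this]

lemma IsSymmetricNorm.abs_mul_flatNorm_one_le (hℓ : IsSymmetricNorm ℓ) (y : Fin n → ℝ)
    (j : Fin n) : |y j| * flatNorm ℓ 1 ≤ ℓ y := by
  classical
  have h := hℓ.indicator_eq {j}
  rw [Finset.card_singleton] at h
  rw [← h, ← abs_abs, ← Real.norm_eq_abs, ← map_smul_eq_mul]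
  refine hℓ.mono fun i => ?_
  by_cases h : i = j
  · subst h; simp
  · simp [h]

lemma IsSymmetricNorm.le_mul_flatNorm (hℓ : IsSymmetricNorm ℓ) {y : Fin n → ℝ} {c : ℝ}
    (hy : ∀ i, |y i| ≤ c) (hc : 0 ≤ c) : ℓ y ≤ c * flatNorm ℓ n := by
  rw [flatNorm]
  conv_rhs => rw [← abs_of_nonneg hc, ← Real.norm_eq_abs, ← map_smul_eq_mul]
  refine hℓ.mono fun i => ?_
  simpa [abs_of_nonneg hc] using hy i

/-- Some dyadic level carries a `1 / log n` fraction of the norm: decompose `y` according to the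
ranks `2 ^ s, …, 2 ^ (s + 1) - 1` of the absolute values of its coordinates. -/
lemma IsSymmetricNorm.exists_level (hℓ : IsSymmetricNorm ℓ) (hn : 0 < n) (y : Fin n → ℝ) :
    ∃ (s : ℕ) (S : Finset (Fin n)) (a : ℝ), 2 ^ s ≤ n ∧ S.card = 2 ^ s ∧ 0 ≤ a ∧
      (∀ j ∈ S, a ≤ |y j|) ∧ ℓ y ≤ (Nat.log 2 n + 1 : ℕ) * (a * flatNorm ℓ (2 ^ s)) := by
  classical
  obtain ⟨σ, hσ⟩ := exists_perm_antitone_abs y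
  let r : ℕ → Fin n := fun s => if h : 2 ^ s - 1 < n then ⟨2 ^ s - 1, h⟩ else ⟨0, hn⟩
  let α : ℕ → ℝ := fun s => |y (σ (r s))|
  let b : ℕ → Finset (Fin n) := fun s => Finset.univ.filter fun i => Nat.log 2 ((i : ℕ) + 1) = s
  have hb : ∀ s, (b s).card ≤ 2 ^ s := by
    intro s
    have : ((b s).map Fin.valEmbedding) ⊆ Finset.Ico (2 ^ s - 1) (2 ^ s - 1 + 2 ^ s) := by
      intro j hj
      simp only [Finset.mem_map, b, Finset.mem_filter] at hj
      obtain ⟨i, ⟨-, hi⟩, rfl⟩ := hj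
      have h1 := Nat.pow_log_le_self 2 (x := (i : ℕ) + 1) (by omega)
      have h2 := Nat.lt_pow_succ_log_self (b := 2) (by norm_num) ((i : ℕ) + 1)
      rw [hi] at h1 h2
      rw [pow_succ] at h2
      simp only [Fin.valEmbedding_apply, Finset.mem_Ico]
      omega
    simpa using Finset.card_le_card this
  have hlt : ∀ s ∈ Finset.range (Nat.log 2 n + 1), 2 ^ s ≤ n := by
    intro s hs
    rw [Finset.mem_range] at hs
    calc 2 ^ s ≤ 2 ^ (Nat.log 2 n) := Nat.pow_le_pow_right (by norm_num) (by omega)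
      _ ≤ n := Nat.pow_log_le_self 2 (by omega)
  have hsum : ℓ y ≤ ∑ s ∈ Finset.range (Nat.log 2 n + 1), α s * flatNorm ℓ (2 ^ s) := by
    calc ℓ y = ℓ (fun i => y (σ i)) := (hℓ.perm σ y).symm
      _ ≤ ℓ (∑ s ∈ Finset.range (Nat.log 2 n + 1),
            α s • (fun j => if j ∈ b s then (1 : ℝ) else 0)) := by
          refine hℓ.mono fun i => ?_
          have hi : Nat.log 2 ((i : ℕ) + 1) ∈ Finset.range (Nat.log 2 n + 1) := by
            rw [Finset.mem_range, Nat.lt_succ_iff]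
            exact Nat.log_mono_right (by omega)
          have h1 := Nat.pow_log_le_self 2 (x := (i : ℕ) + 1) (by omega)
          rw [Finset.sum_apply, Finset.sum_eq_single_of_mem _ hi]
          · have hr : r (Nat.log 2 ((i : ℕ) + 1)) ≤ i := by
              simp only [r]
              split_ifs with h
              · rw [Fin.le_def]; simp only; omega
              · rw [Fin.le_def]; simp
            simpa [b, α] using hσ hr
          · intro s _ hs
            simp [b, hs.symm]
      _ ≤ ∑ s ∈ Finset.range (Nat.log 2 n + 1),
            ℓ (α s • (fun j => if j ∈ b s then (1 : ℝ) else 0)) :=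
          Finset.le_sum_of_subadditive ℓ (map_zero ℓ).le (map_add_le_add ℓ) _ _
      _ ≤ _ := by
          refine Finset.sum_le_sum fun s _ => ?_
          rw [map_smul_eq_mul, Real.norm_of_nonneg (abs_nonneg _), hℓ.indicator_eq]
          exact mul_le_mul_of_nonneg_left (hℓ.flatNorm_mono (hb s)) (abs_nonneg _)
  obtain ⟨s, hs, hle⟩ : ∃ s ∈ Finset.range (Nat.log 2 n + 1),
      ℓ y / (Nat.log 2 n + 1 : ℕ) ≤ α s * flatNorm ℓ (2 ^ s) := by
    refine Finset.exists_le_of_sum_le (by simp) (le_trans (le_of_eq ?_) hsum)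
    rw [Finset.sum_const, Finset.card_range, nsmul_eq_mul]
    field_simp
  have hs2 := hlt s hs
  refine ⟨s, (Finset.univ.filter fun i : Fin n => (i : ℕ) < 2 ^ s).map σ.toEmbedding, α s, hs2, ?_,
    abs_nonneg _, ?_, ?_⟩
  · rw [Finset.card_map]
    have := Fin.card_filter_val_lt (n := n) (m := 2 ^ s)
    omega
  · intro j hj
    simp only [Finset.mem_map, Finset.mem_filter] at hj
    obtain ⟨i, ⟨-, hi⟩, rfl⟩ := hj
    have h0 : 2 ^ s - 1 < n := by have := Nat.one_le_two_pow (n := s); omega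
    have : i ≤ r s := by simp only [r, h0, dif_pos]; rw [Fin.le_def]; simp only; omega
    exact hσ this
  · rwa [div_le_iff₀' (by positivity)] at hle

end SymmetricNorm

/-! ### Medians on the sphere and the flat vectors -/

section Median

open scoped Pointwise RealInnerProductSpace

/-- The smallest point at which the distribution function reaches `1 / 2` is a median. -/
lemma exists_median {Ω : Type*} [MeasurableSpace Ω] (μ : Measure Ω) [IsProbabilityMeasure μ]
    {f : Ω → ℝ} (hf : Measurable f) :
    ∃ M, 1 / 2 ≤ μ.real {x | M ≤ f x} ∧ 1 / 2 ≤ μ.real {x | f x ≤ M} := by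
  have : IsProbabilityMeasure (μ.map f) := Measure.isProbabilityMeasure_map hf.aemeasurable
  set F := cdf (μ.map f) with hF
  have hFr : ∀ x, F x = μ.real {y | f y ≤ x} := fun x => by
    rw [hF, cdf_eq_real, map_measureReal_apply hf measurableSet_Iic]; rfl
  let S : Set ℝ := {x | 1 / 2 ≤ F x}
  have hne : S.Nonempty :=
    ((tendsto_cdf_atTop (μ.map f)).eventually (eventually_ge_nhds (by norm_num))).exists
  obtain ⟨b, hb⟩ := ((tendsto_cdf_atBot (μ.map f)).eventually
    (eventually_lt_nhds (b := (1 / 2 : ℝ)) (by norm_num))).exists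
  have hbdd : BddBelow S := ⟨b, fun x hx => by
    by_contra! h
    exact absurd ((hx : 1 / 2 ≤ F x).trans (F.mono h.le)) (not_le.2 hb)⟩
  have h1 : 1 / 2 ≤ F (sInf S) := by
    have ht : Filter.Tendsto F (nhdsWithin (sInf S) (Set.Ioi (sInf S))) (nhds (F (sInf S))) :=
      (F.right_continuous (sInf S)).mono_left (nhdsWithin_mono _ Set.Ioi_subset_Ici_self)
    refine ge_of_tendsto ht ?_
    filter_upwards [self_mem_nhdsWithin] with x hx
    obtain ⟨s, hs, hsx⟩ := exists_lt_of_csInf_lt hne hx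
    exact (hs : 1 / 2 ≤ F s).trans (F.mono hsx.le)
  have h2 : Function.leftLim F (sInf S) ≤ 1 / 2 := by
    refine le_of_tendsto (F.mono.tendsto_leftLim (sInf S)) ?_
    filter_upwards [self_mem_nhdsWithin] with x hx
    by_contra! h
    exact absurd (csInf_le hbdd (show x ∈ S from h.le)) (not_le.2 hx)
  refine ⟨sInf S, ?_, by rw [← hFr]; exact h1⟩
  have h3 : μ {y | f y < sInf S} = ENNReal.ofReal (Function.leftLim F (sInf S)) := by
    have := F.measure_Iio (tendsto_cdf_atBot (μ.map f)) (sInf S)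
    rw [hF, measure_cdf, Measure.map_apply hf measurableSet_Iio, sub_zero] at this
    exact this
  have h4 : μ.real {y | f y < sInf S} ≤ 1 / 2 := by
    rw [measureReal_def, h3]
    exact ENNReal.toReal_le_of_le_ofReal (by norm_num) (ENNReal.ofReal_le_ofReal h2)
  have h5 : {x | sInf S ≤ f x} = {y | f y < sInf S}ᶜ := by ext; simp
  rw [h5, probReal_compl_eq_one_sub (measurableSet_lt hf measurable_const)]
  linarith

variable {k : ℕ}

lemma isProbabilityMeasure_uniformSphere (hk : 0 < k) :
    IsProbabilityMeasure (uniformSphere k) := by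
  have : Nonempty (Fin k) := ⟨⟨0, hk⟩⟩
  refine ⟨?_⟩
  rw [uniformSphere, Measure.smul_apply, smul_eq_mul]
  exact ENNReal.inv_mul_cancel
    (Measure.measure_univ_ne_zero.2 (Measure.toSphere_ne_zero _)) (measure_ne_top _ _)

/-- The measure of a spherical cap: the cone over a cap of height `τ` is contained in the ball of
radius `√(1 - τ²)` around `τ e`. -/
lemma uniformSphere_cap_le (hk : 0 < k) {e : EuclideanSpace ℝ (Fin k)} (he : ‖e‖ = 1) {τ : ℝ}
    (hτ0 : 0 ≤ τ) (hτ : 2 * τ ^ 2 ≤ 1) :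
    uniformSphere k {x | τ < ⟪e, (x : EuclideanSpace ℝ (Fin k))⟫} ≤
      ENNReal.ofReal (√(1 - τ ^ 2) ^ k) := by
  have : Nonempty (Fin k) := ⟨⟨0, hk⟩⟩
  have hms : MeasurableSet {x : UnitSphere k | τ < ⟪e, (x : EuclideanSpace ℝ (Fin k))⟫} :=
    measurableSet_lt measurable_const (by fun_prop)
  have hsub : Set.Ioo (0 : ℝ) 1 •
      (((↑) : UnitSphere k → EuclideanSpace ℝ (Fin k)) ''
        {x : UnitSphere k | τ < ⟪e, (x : EuclideanSpace ℝ (Fin k))⟫}) ⊆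
      Metric.closedBall (τ • e) (√(1 - τ ^ 2)) := by
    rintro _ ⟨ρ, ⟨hρ0, hρ1⟩, _, ⟨x, hx, rfl⟩, rfl⟩
    have hx1 : ‖(x : EuclideanSpace ℝ (Fin k))‖ = 1 := by simp
    rw [Metric.mem_closedBall, dist_eq_norm]
    apply Real.le_sqrt_of_sq_le
    simp only [Set.mem_ofPred_eq] at hx
    rw [norm_sub_sq_real, norm_smul, norm_smul, inner_smul_left, inner_smul_right, hx1, he,
      real_inner_comm, Real.norm_of_nonneg hρ0.le, Real.norm_of_nonneg hτ0]
    simp only [conj_trivial, mul_one]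
    have h1 : τ ^ 2 * ρ ≤ ρ * (τ * ⟪e, (x : EuclideanSpace ℝ (Fin k))⟫) := by
      have := mul_le_mul_of_nonneg_left hx.le (mul_nonneg hρ0.le hτ0)
      nlinarith
    nlinarith [mul_nonneg hρ0.le (sub_nonneg.2 hρ1.le), mul_nonneg hρ0.le (sub_nonneg.2 hτ),
      mul_nonneg (sub_nonneg.2 hρ1.le) (sub_nonneg.2 hτ)]
  set v := (volume : Measure (EuclideanSpace ℝ (Fin k)))
  have hv0 : v (Metric.ball 0 1) ≠ 0 := (Metric.measure_ball_pos _ _ one_pos).ne'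
  have hvt : v (Metric.ball 0 1) ≠ ⊤ := measure_ball_lt_top.ne
  have hk0 : (k : ENNReal) ≠ 0 := by simpa using hk.ne'
  rw [uniformSphere, Measure.smul_apply, smul_eq_mul, v.toSphere_apply' hms,
    v.toSphere_apply_univ, finrank_euclideanSpace_fin]
  calc ((k : ENNReal) * v (Metric.ball 0 1))⁻¹ * (k * v _)
      ≤ (k * v (Metric.ball 0 1))⁻¹ *
          (k * (ENNReal.ofReal (√(1 - τ ^ 2) ^ k) * v (Metric.ball 0 1))) := by
        gcongr
        refine (measure_mono hsub).trans (le_of_eq ?_)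
        rw [Measure.addHaar_closedBall _ _ (Real.sqrt_nonneg _), finrank_euclideanSpace_fin]
    _ = (k * v (Metric.ball 0 1))⁻¹ * (k * v (Metric.ball 0 1)) *
          ENNReal.ofReal (√(1 - τ ^ 2) ^ k) := by ring
    _ = _ := by
        rw [ENNReal.inv_mul_cancel (mul_ne_zero hk0 hv0)
          (ENNReal.mul_ne_top (ENNReal.natCast_ne_top k) hvt), one_mul]

/-- A random point of the sphere has a coordinate of absolute value above
`√(2 log (5 k) / k)` with probability less than one half. -/
lemma uniformSphere_exists_coord_lt (hk : 0 < k) {τ : ℝ} (hτ0 : 0 ≤ τ)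
    (hτ : τ ^ 2 = 2 * Real.log (5 * k) / k) (hτ1 : 2 * τ ^ 2 ≤ 1) :
    uniformSphere k {x | ∃ j, τ < |(x : EuclideanSpace ℝ (Fin k)) j|} < ENNReal.ofReal (1 / 2) := by
  have hk' : (0 : ℝ) < k := by exact_mod_cast hk
  have hb : √(1 - τ ^ 2) ^ k ≤ 1 / (5 * k) := by
    have h1 : √(1 - τ ^ 2) ≤ Real.exp (-(τ ^ 2) / 2) := by
      refine Real.sqrt_le_iff.2 ⟨(Real.exp_pos _).le, ?_⟩
      have := Real.add_one_le_exp (-(τ ^ 2))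
      rw [← Real.exp_nat_mul]
      calc 1 - τ ^ 2 ≤ Real.exp (-(τ ^ 2)) := by linarith
        _ = _ := by congr 1; push_cast; ring
    calc √(1 - τ ^ 2) ^ k ≤ Real.exp (-(τ ^ 2) / 2) ^ k :=
          pow_le_pow_left₀ (Real.sqrt_nonneg _) h1 k
      _ = Real.exp (-Real.log (5 * k)) := by
          rw [← Real.exp_nat_mul, hτ]
          congr 1
          field_simp
      _ = 1 / (5 * k) := by
          rw [Real.exp_neg, Real.exp_log (by positivity), one_div]
  have hsub : {x : UnitSphere k | ∃ j, τ < |(x : EuclideanSpace ℝ (Fin k)) j|} ⊆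
      ⋃ j : Fin k, ({x : UnitSphere k |
          τ < ⟪EuclideanSpace.single j (1 : ℝ), (x : EuclideanSpace ℝ (Fin k))⟫} ∪
        {x : UnitSphere k |
          τ < ⟪-EuclideanSpace.single j (1 : ℝ), (x : EuclideanSpace ℝ (Fin k))⟫}) := by
    rintro x ⟨j, hj⟩
    rw [Set.mem_iUnion]
    refine ⟨j, ?_⟩
    rcases lt_abs.1 hj with h | h
    · left; simpa [EuclideanSpace.inner_single_left] using h
    · right; simpa [EuclideanSpace.inner_single_left, inner_neg_left] using h
  have h2 : ∀ e : EuclideanSpace ℝ (Fin k), ‖e‖ = 1 →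
      uniformSphere k {x | τ < ⟪e, (x : EuclideanSpace ℝ (Fin k))⟫} ≤
        ENNReal.ofReal (1 / (5 * k)) := fun e he =>
    (uniformSphere_cap_le hk he hτ0 hτ1).trans (ENNReal.ofReal_le_ofReal hb)
  calc _ ≤ _ := measure_mono hsub
    _ ≤ ∑ j : Fin k, _ := measure_iUnion_fintype_le _ _
    _ ≤ ∑ j : Fin k, (ENNReal.ofReal (1 / (5 * k)) + ENNReal.ofReal (1 / (5 * k))) :=
        Finset.sum_le_sum fun j _ => (measure_union_le _ _).trans
          (add_le_add (h2 _ (by simp)) (h2 _ (by simp)))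
    _ = ENNReal.ofReal (2 / 5) := by
        rw [← ENNReal.ofReal_add (by positivity) (by positivity), Finset.sum_const,
          Finset.card_univ, Fintype.card_fin, nsmul_eq_mul, ← ENNReal.ofReal_natCast,
          ← ENNReal.ofReal_mul (by positivity)]
        congr 1
        field_simp
        norm_num
    _ < _ := by
        rw [ENNReal.ofReal_lt_ofReal_iff (by norm_num)]
        norm_num

variable {n : ℕ} {ℓ : Seminorm ℝ (Fin n → ℝ)}

lemma IsSymmetricNorm.continuous (hℓ : IsSymmetricNorm ℓ) : Continuous ℓ := by
  refine (LipschitzWith.of_dist_le_mul (K := ⟨flatNorm ℓ n, flatNorm_nonneg ℓ n⟩)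
    fun x y => ?_).continuous
  calc dist (ℓ x) (ℓ y) ≤ ℓ (x - y) := by
        rw [Real.dist_eq]; exact abs_sub_map_le_sub ℓ x y
    _ ≤ ‖x - y‖ * flatNorm ℓ n :=
        hℓ.le_mul_flatNorm (fun i => norm_le_pi_norm (x - y) i) (norm_nonneg _)
    _ = _ := by rw [dist_eq_norm, mul_comm]; rfl

lemma IsSymmetricNorm.continuous_onSphere (hℓ : IsSymmetricNorm ℓ) (k : ℕ) :
    Continuous (onSphere (restrictNorm ℓ k)) := by
  have h1 : Continuous (pad k n) := LinearMap.continuous_of_finiteDimensional _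
  have h2 : Continuous (restrictNorm ℓ k) := hℓ.continuous.comp h1
  unfold onSphere
  refine h2.comp ?_
  fun_prop

lemma IsSymmetricNorm.restrictNorm_le (hℓ : IsSymmetricNorm ℓ) {x : Fin k → ℝ} {c : ℝ}
    (hc : 0 ≤ c) (hx : ∀ i, |x i| ≤ c) : restrictNorm ℓ k x ≤ c * flatNorm ℓ k := by
  rw [flatNorm]
  conv_rhs => rw [← abs_of_nonneg hc, ← Real.norm_eq_abs, ← map_smul_eq_mul]
  refine hℓ.mono fun i => ?_
  by_cases h : (i : ℕ) < k
  · simpa [pad, h, abs_of_nonneg hc] using hx _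
  · simp [pad, h]

lemma IsSymmetricNorm.onSphere_pos (hℓ : IsSymmetricNorm ℓ) (hkn : k ≤ n) (x : UnitSphere k) :
    0 < onSphere (restrictNorm ℓ k) x := by
  refine lt_of_le_of_ne (apply_nonneg _ _) fun h => ?_
  have h0 := hℓ.definite _ h.symm
  have hx : (x : EuclideanSpace ℝ (Fin k)) = 0 := by
    ext i
    have := congrFun h0 ⟨i, i.2.trans_le hkn⟩
    simpa [pad] using this
  have := x.2
  rw [mem_sphere_zero_iff_norm, hx, norm_zero] at this
  exact zero_ne_one this

lemma IsSymmetricNorm.exists_isMedian (hℓ : IsSymmetricNorm ℓ) (hk : 0 < k) :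
    ∃ M, IsMedian (restrictNorm ℓ k) M := by
  have := isProbabilityMeasure_uniformSphere hk
  exact exists_median _ (hℓ.continuous_onSphere k).measurable

lemma IsSymmetricNorm.median_pos (hℓ : IsSymmetricNorm ℓ) (hk : 0 < k) (hkn : k ≤ n) :
    0 < median (restrictNorm ℓ k) := by
  have : Nonempty (Fin k) := ⟨⟨0, hk⟩⟩
  have : Nonempty (UnitSphere k) := (NormedSpace.sphere_nonempty.2 zero_le_one).to_subtype
  obtain ⟨x₀, hx₀⟩ := (hℓ.continuous_onSphere k).exists_forall_le_of_hasCompactSupport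
    (HasCompactSupport.of_compactSpace _)
  refine (hℓ.onSphere_pos hkn x₀).trans_le (le_csInf (hℓ.exists_isMedian hk) fun M hM => ?_)
  obtain ⟨x, hx⟩ : {x | onSphere (restrictNorm ℓ k) x ≤ M}.Nonempty := by
    by_contra h
    have := hM.2
    rw [Set.not_nonempty_iff_eq_empty.1 h] at this
    simp at this
    norm_num at this
  exact (hx₀ x).trans hx

/-- The median is at most a `√(log k)` factor above the norm of the flat unit vector. -/
lemma IsSymmetricNorm.median_le (hℓ : IsSymmetricNorm ℓ) (hk : 0 < k) (hkn : k ≤ n) :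
    median (restrictNorm ℓ k) ≤ 2 * √(Real.log (5 * k) / k) * flatNorm ℓ k := by
  have := isProbabilityMeasure_uniformSphere hk
  have : Nonempty (Fin k) := ⟨⟨0, hk⟩⟩
  have : Nonempty (UnitSphere k) := (NormedSpace.sphere_nonempty.2 zero_le_one).to_subtype
  have hk' : (1 : ℝ) ≤ k := by exact_mod_cast hk
  obtain ⟨M, hM⟩ := hℓ.exists_isMedian (k := k) hk
  have hbdd : BddBelow {M | IsMedian (restrictNorm ℓ k) M} := by
    refine ⟨0, fun M' hM' => ?_⟩
    by_contra! h
    have h1 : {x | onSphere (restrictNorm ℓ k) x ≤ M'} = ∅ := by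
      ext x
      simpa using h.trans (hℓ.onSphere_pos hkn x)
    have := hM'.2
    rw [h1] at this
    simp at this
    norm_num at this
  refine (csInf_le hbdd hM).trans ?_
  have hlog : 0 ≤ Real.log (5 * k) := Real.log_nonneg (by linarith)
  set u := √(Real.log (5 * k) / k) with hu
  have hu0 : 0 ≤ u := Real.sqrt_nonneg _
  have hu2 : u ^ 2 = Real.log (5 * k) / k := Real.sq_sqrt (by positivity)
  -- it suffices to find a point with small coordinates at which the norm is at least the median
  suffices h : ∃ x : UnitSphere k, M ≤ onSphere (restrictNorm ℓ k) x ∧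
      ∀ j, |(x : EuclideanSpace ℝ (Fin k)) j| ≤ 2 * u by
    obtain ⟨x, hx, hj⟩ := h
    exact hx.trans (hℓ.restrictNorm_le (by positivity) hj)
  -- for `2 u ≥ 1` all points have small coordinates, otherwise more than half of them do
  by_cases hu1 : 1 ≤ 2 * u
  · obtain ⟨x, hx⟩ : {x | M ≤ onSphere (restrictNorm ℓ k) x}.Nonempty := by
      by_contra h
      have := hM.1
      rw [Set.not_nonempty_iff_eq_empty.1 h] at this
      simp at this
      norm_num at this
    refine ⟨x, hx, fun j => le_trans ?_ hu1⟩
    have h1 : ‖(x : EuclideanSpace ℝ (Fin k))‖ = 1 := by simp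
    exact (PiLp.norm_apply_le (x : EuclideanSpace ℝ (Fin k)) j).trans h1.le
  · have hs2 : (√2 * u) ^ 2 = 2 * Real.log (5 * k) / k := by
      rw [mul_pow, Real.sq_sqrt zero_le_two, hu2]; ring
    have hlt := uniformSphere_exists_coord_lt hk (τ := √2 * u) (by positivity) hs2 (by
      rw [mul_pow, Real.sq_sqrt zero_le_two]; nlinarith)
    have hge : ENNReal.ofReal (1 / 2) ≤
        uniformSphere k {x | M ≤ onSphere (restrictNorm ℓ k) x} :=
      ENNReal.ofReal_le_of_le_toReal hM.1
    obtain ⟨x, hx, hx2⟩ : ∃ x, x ∈ {x | M ≤ onSphere (restrictNorm ℓ k) x} ∧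
        x ∉ {x : UnitSphere k | ∃ j, √2 * u < |(x : EuclideanSpace ℝ (Fin k)) j|} := by
      by_contra! h
      exact absurd (hge.trans (measure_mono h)) (not_le.2 hlt)
    refine ⟨x, hx, fun j => ?_⟩
    simp only [Set.mem_ofPred_eq, not_exists, not_lt] at hx2
    refine (hx2 j).trans ?_
    gcongr
    exact Real.sqrt_le_iff.2 ⟨by norm_num, by norm_num⟩

lemma IsSymmetricNorm.onSphere_le_mmc_mul_median (hℓ : IsSymmetricNorm ℓ) (hk : 0 < k)
    (hkn : k ≤ n) (x : UnitSphere k) :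
    onSphere (restrictNorm ℓ k) x ≤ mmc ℓ * median (restrictNorm ℓ k) := by
  obtain ⟨k, rfl⟩ : ∃ k', k = k' + 1 := ⟨k - 1, by omega⟩
  rw [← div_le_iff₀ (hℓ.median_pos hk hkn)]
  have hb : BddAbove (Set.range fun x : UnitSphere (k + 1) =>
      onSphere (restrictNorm ℓ (k + 1)) x / median (restrictNorm ℓ (k + 1))) :=
    (isCompact_range ((hℓ.continuous_onSphere _).div_const _)).bddAbove
  refine (le_ciSup hb x).trans ?_
  exact le_ciSup (f := fun k : Fin n => mc (restrictNorm ℓ ((k : ℕ) + 1)))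
    (Set.finite_range _).bddAbove ⟨k, by omega⟩

lemma IsSymmetricNorm.mmc_nonneg (hℓ : IsSymmetricNorm ℓ) (hn : 0 < n) : 0 ≤ mmc ℓ := by
  have : Nonempty (Fin 1) := ⟨0⟩
  have : Nonempty (UnitSphere 1) := (NormedSpace.sphere_nonempty.2 zero_le_one).to_subtype
  obtain ⟨x⟩ := this
  have h1 := hℓ.onSphere_le_mmc_mul_median one_pos hn x
  have h2 := hℓ.onSphere_pos hn x
  exact (pos_of_mul_pos_left (h2.trans_le h1) (hℓ.median_pos one_pos hn).le).le

/-- Up to the factor `mmc ℓ √(log j)`, the norm of the flat Euclidean unit vector increases with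
the size of its support: the vector with the smaller support is a point of the unit sphere of `ℝʲ`,
and there the norm is at most `mmc ℓ` times the median. -/
lemma IsSymmetricNorm.flatNorm_div_sqrt_le (hℓ : IsSymmetricNorm ℓ) {j : ℕ} (hk : 0 < k)
    (hkj : k ≤ j) (hjn : j ≤ n) :
    flatNorm ℓ k / √k ≤ mmc ℓ * (2 * √(Real.log (5 * j) / j) * flatNorm ℓ j) := by
  have hj : 0 < j := by omega
  have hk' : (0 : ℝ) < k := by exact_mod_cast hk
  let v : EuclideanSpace ℝ (Fin j) := WithLp.toLp 2 fun i => if (i : ℕ) < k then 1 / √(k : ℝ) else 0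
  have hv : ‖v‖ = 1 := by
    have h1 : (Finset.univ.filter fun i : Fin j => (i : ℕ) < k).card = k := by
      have := Fin.card_filter_val_lt (n := j) (m := k)
      omega
    rw [EuclideanSpace.norm_eq, Real.sqrt_eq_one]
    simp only [v, Real.norm_eq_abs, sq_abs, ite_pow, div_pow, one_pow, Real.sq_sqrt hk'.le]
    rw [← Finset.sum_filter_add_sum_filter_not Finset.univ (fun i : Fin j => (i : ℕ) < k),
      Finset.sum_congr rfl (g := fun _ => 1 / (k : ℝ)) (by simp +contextual),
      Finset.sum_congr (s₁ := Finset.univ.filter fun i : Fin j => ¬ (i : ℕ) < k) rfl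
        (g := fun _ => 0) (by simp +contextual)]
    simp [h1, hk'.ne']
  have hx := hℓ.onSphere_le_mmc_mul_median hj hjn ⟨v, by simpa using hv⟩
  have heq : onSphere (restrictNorm ℓ j) ⟨v, by simpa using hv⟩ = flatNorm ℓ k / √k := by
    rw [div_eq_inv_mul, flatNorm]
    conv_rhs => rw [← abs_of_nonneg (inv_nonneg.2 (Real.sqrt_nonneg (k : ℝ))), ← Real.norm_eq_abs,
      ← map_smul_eq_mul]
    change ℓ _ = ℓ _
    congr 1
    funext i
    by_cases h : (i : ℕ) < k
    · simp [pad, v, h, h.trans_le hkj]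
    · simp [pad, v, h]
  rw [heq] at hx
  exact hx.trans (mul_le_mul_of_nonneg_left (hℓ.median_le hj hjn) (hℓ.mmc_nonneg (by omega)))

end Median

/-! ### The sampling step: upper bound for a fixed vector -/

section Sampling

variable {n t : ℕ} {ℓ : Seminorm ℝ (Fin n → ℝ)}

/-- The law of the sampling bits `z_{i,j}`. -/
noncomputable abbrev bitLaw (n t : ℕ) : Measure (Fin (t + 1) × Fin n → Bool) :=
  Measure.pi fun ij : Fin (t + 1) × Fin n => bernoulliMeasure true false (halfPow ij.1)

lemma integral_bit (f : Bool → ℝ) (ij : Fin (t + 1) × Fin n) :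
    ∫ z, f (z ij) ∂bitLaw n t =
      (1 / 2) ^ (ij.1 : ℕ) * f true + (1 - (1 / 2) ^ (ij.1 : ℕ)) * f false := by
  have h := integral_comp_eval (μ := fun ij : Fin (t + 1) × Fin n =>
    bernoulliMeasure true false (halfPow ij.1)) (i := ij) (f := f)
    (Measurable.of_discrete).aestronglyMeasurable
  rw [h, integral_bernoulliMeasure]
  rfl

/-- Multiplication with `D̃`, as a linear map into Euclidean space, for given sampling bits. -/
noncomputable def sampleMap (ℓ : Seminorm ℝ (Fin n → ℝ)) (z : Fin (t + 1) × Fin n → Bool) :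
    (Fin n → ℝ) →ₗ[ℝ] EuclideanSpace ℝ (Fin (t + 1) × Fin n) where
  toFun y := WithLp.toLp 2 fun ij => weight ℓ ij.1 * if z ij then y ij.2 else 0
  map_add' x y := by
    ext ij
    by_cases h : z ij <;> simp [h, mul_add]
  map_smul' a x := by
    ext ij
    by_cases h : z ij <;> simp [h, mul_left_comm]

lemma norm_sampleMap_sq (ℓ : Seminorm ℝ (Fin n → ℝ)) (z : Fin (t + 1) × Fin n → Bool)
    (y : Fin n → ℝ) :
    ‖sampleMap ℓ z y‖ ^ 2 =
      ∑ i : Fin (t + 1), ∑ j, (weight ℓ i) ^ 2 * (if z (i, j) then y j ^ 2 else 0) := by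
  rw [EuclideanSpace.norm_sq_eq, Fintype.sum_prod_type]
  refine Finset.sum_congr rfl fun i _ => Finset.sum_congr rfl fun j _ => ?_
  by_cases h : z (i, j) <;> simp [sampleMap, h, mul_pow]

lemma weight_nonneg (ℓ : Seminorm ℝ (Fin n → ℝ)) (i : ℕ) : 0 ≤ weight ℓ i := apply_nonneg ℓ _

lemma sqrt_add_le_sqrt_add_sqrt {x y : ℝ} (hx : 0 ≤ x) (hy : 0 ≤ y) : √(x + y) ≤ √x + √y := by
  refine Real.sqrt_le_iff.2 ⟨by positivity, ?_⟩
  have := mul_nonneg (Real.sqrt_nonneg x) (Real.sqrt_nonneg y)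
  nlinarith [Real.sq_sqrt hx, Real.sq_sqrt hy]

lemma sqrt_le_of_pos {x θ : ℝ} (hx : 0 ≤ x) (hθ : 0 < θ) : √x ≤ (x / θ + θ) / 2 := by
  have h := Real.sq_sqrt hx
  have : x / θ + θ - 2 * √x = (√x - θ) ^ 2 / θ := by
    field_simp
    nlinarith
  have h2 : 0 ≤ (√x - θ) ^ 2 / θ := by positivity
  linarith

/-- A pointwise bound on `‖D̃ y‖` that is affine in the sampling bits: on each level the coordinates
in `H i` are treated by the triangle inequality, the others by the inequality
`√X ≤ (X / θ + θ) / 2`. -/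
lemma norm_sampleMap_le (ℓ : Seminorm ℝ (Fin n → ℝ)) (z : Fin (t + 1) × Fin n → Bool)
    (y : Fin n → ℝ) (H : Fin (t + 1) → Finset (Fin n)) {θ : ℝ} (hθ : 0 < θ) :
    ‖sampleMap ℓ z y‖ ≤ ∑ i, ∑ j,
      (if j ∈ H i then weight ℓ i * |y j| else (weight ℓ i) ^ 2 * y j ^ 2 / (2 * θ)) *
        (if z (i, j) then 1 else 0) + (t + 1) * (θ / 2) := by
  classical
  have hsqrt : ∀ i : Fin (t + 1), √(∑ j, (weight ℓ i) ^ 2 * (if z (i, j) then y j ^ 2 else 0)) ≤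
      ∑ j, (if j ∈ H i then weight ℓ i * |y j| else (weight ℓ i) ^ 2 * y j ^ 2 / (2 * θ)) *
        (if z (i, j) then 1 else 0) + θ / 2 := by
    intro i
    have hnn : ∀ j, 0 ≤ (weight ℓ i) ^ 2 * (if z (i, j) then y j ^ 2 else 0) := fun j => by
      split_ifs <;> positivity
    rw [← Finset.sum_add_sum_compl (H i)]
    have hsq : ∀ j, √((weight ℓ i) ^ 2 * (if z (i, j) then y j ^ 2 else 0)) =
        weight ℓ i * |y j| * (if z (i, j) then 1 else 0) := by
      intro j
      by_cases h : z (i, j)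
      · rw [if_pos h, if_pos h, ← mul_pow, Real.sqrt_sq_eq_abs, abs_mul,
          abs_of_nonneg (weight_nonneg ℓ i), mul_one]
      · simp [h]
    calc _ ≤ √(∑ j ∈ H i, (weight ℓ i) ^ 2 * (if z (i, j) then y j ^ 2 else 0)) +
          √(∑ j ∈ (H i)ᶜ, (weight ℓ i) ^ 2 * (if z (i, j) then y j ^ 2 else 0)) :=
          sqrt_add_le_sqrt_add_sqrt (Finset.sum_nonneg fun j _ => hnn j)
            (Finset.sum_nonneg fun j _ => hnn j)
      _ ≤ (∑ j ∈ H i, √((weight ℓ i) ^ 2 * (if z (i, j) then y j ^ 2 else 0))) +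
          ((∑ j ∈ (H i)ᶜ, (weight ℓ i) ^ 2 * (if z (i, j) then y j ^ 2 else 0)) / θ + θ) / 2 := by
          refine add_le_add ?_ (sqrt_le_of_pos (Finset.sum_nonneg fun j _ => hnn j) hθ)
          generalize H i = S
          induction S using Finset.induction_on with
          | empty => simp
          | insert a S ha ih =>
            rw [Finset.sum_insert ha, Finset.sum_insert ha]
            exact (sqrt_add_le_sqrt_add_sqrt (hnn a)
              (Finset.sum_nonneg fun j _ => hnn j)).trans (by gcongr)
      _ = _ := by
          rw [← Finset.sum_add_sum_compl (H i) (fun j => (if j ∈ H i then weight ℓ i * |y j|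
            else (weight ℓ i) ^ 2 * y j ^ 2 / (2 * θ)) * (if z (i, j) then 1 else 0)),
            add_div, add_assoc, Finset.sum_div, Finset.sum_div]
          congr 1
          · refine Finset.sum_congr rfl fun j hj => ?_
            rw [hsq, if_pos hj]
          · congr 1
            refine Finset.sum_congr rfl fun j hj => ?_
            rw [if_neg (Finset.mem_compl.1 hj)]
            by_cases h : z (i, j) <;> simp [h]
            field_simp
  have htri : ‖sampleMap ℓ z y‖ ≤
      ∑ i : Fin (t + 1), √(∑ j, (weight ℓ i) ^ 2 * (if z (i, j) then y j ^ 2 else 0)) := by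
    refine le_of_sq_le_sq ?_ (Finset.sum_nonneg fun i _ => Real.sqrt_nonneg _)
    rw [norm_sampleMap_sq]
    have h0 : ∀ i : Fin (t + 1),
        0 ≤ ∑ j, (weight ℓ i) ^ 2 * (if z (i, j) then y j ^ 2 else 0) := fun i =>
      Finset.sum_nonneg fun j _ => by split_ifs <;> positivity
    calc _ = ∑ i : Fin (t + 1),
          √(∑ j, (weight ℓ i) ^ 2 * (if z (i, j) then y j ^ 2 else 0)) ^ 2 :=
          Finset.sum_congr rfl fun i _ => (Real.sq_sqrt (h0 i)).symm
      _ ≤ _ := Finset.sum_sq_le_sq_sum_of_nonneg fun i _ => Real.sqrt_nonneg _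
  refine htri.trans ((Finset.sum_le_sum fun i _ => hsqrt i).trans (le_of_eq ?_))
  rw [Finset.sum_add_distrib, Finset.sum_const, Finset.card_univ, Fintype.card_fin, nsmul_eq_mul]
  push_cast
  rfl

lemma IsSymmetricNorm.one_le_three_mul_mmc (hℓ : IsSymmetricNorm ℓ) (hn : 0 < n) :
    1 ≤ 3 * mmc ℓ := by
  have h := hℓ.flatNorm_div_sqrt_le one_pos le_rfl hn
  have hw := hℓ.flatNorm_pos hn one_pos
  have hm := hℓ.mmc_nonneg hn
  have h5 : √(Real.log 5) ≤ 3 / 2 := by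
    refine Real.sqrt_le_iff.2 ⟨by norm_num, ?_⟩
    rw [Real.log_le_iff_le_exp (by norm_num)]
    have h1 := Real.exp_one_gt_d9
    calc (5 : ℝ) ≤ 2.7182818283 ^ 2 := by norm_num
      _ ≤ Real.exp 1 ^ 2 := by gcongr
      _ = Real.exp 2 := by rw [← Real.exp_nat_mul]; norm_num
      _ ≤ _ := Real.exp_le_exp.2 (by norm_num)
  simp only [Nat.cast_one, Real.sqrt_one, div_one, mul_one] at h
  have h3 : flatNorm ℓ 1 ≤ 3 * mmc ℓ * flatNorm ℓ 1 := by
    calc _ ≤ mmc ℓ * (2 * √(Real.log 5) * flatNorm ℓ 1) := h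
      _ ≤ mmc ℓ * (2 * (3 / 2) * flatNorm ℓ 1) := by gcongr
      _ = _ := by ring
  exact le_of_mul_le_mul_right (by linarith) hw

/-- The expected norm of `D̃ y` is at most `O(mmc ℓ · log² n) · ℓ y`. On level `i`, the `2 ^ i`
largest coordinates of `y` are controlled through the first moment of the sampling bits, the other
coordinates through the second moment. -/
lemma IsSymmetricNorm.integral_norm_sampleMap_le (hℓ : IsSymmetricNorm ℓ) (hn : 0 < n)
    (y : Fin n → ℝ) :
    ∫ z, ‖sampleMap ℓ z y‖ ∂bitLaw n t ≤
      (t + 1) * (8 * mmc ℓ * (1 + Real.log (5 * n)) * ℓ y) := by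
  classical
  by_cases hy0 : ℓ y = 0
  · have : y = 0 := hℓ.definite y hy0
    simp [this]
  have hy : 0 < ℓ y := lt_of_le_of_ne (apply_nonneg _ _) (Ne.symm hy0)
  obtain ⟨σ, hσ⟩ := exists_perm_antitone_abs y
  have hn1 : (1 : ℝ) ≤ n := by exact_mod_cast hn
  set Λ := 1 + Real.log (5 * n) with hΛ
  have hlog : 0 ≤ Real.log (5 * n) := Real.log_nonneg (by linarith)
  have hm3 := hℓ.one_le_three_mul_mmc hn
  have hm : 0 < mmc ℓ := by linarith
  set θ := 2 * mmc ℓ * Λ * ℓ y with hθd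
  have hθ : 0 < θ := by positivity
  have hΛ0 : Λ ≠ 0 := by positivity
  have hharm : ∑ r : Fin n, 1 / ((r : ℝ) + 1) ≤ Λ := by
    have h1 := harmonic_le_one_add_log n
    rw [harmonic] at h1
    push_cast at h1
    rw [Finset.sum_range] at h1
    simp only [one_div]
    refine h1.trans ?_
    rw [hΛ]
    gcongr
    linarith
  let H : Fin (t + 1) → Finset (Fin n) := fun i =>
    (Finset.univ.filter fun r : Fin n => (r : ℕ) < 2 ^ (i : ℕ)).map σ.toEmbedding
  have hH : ∀ i r, σ r ∈ H i ↔ (r : ℕ) < 2 ^ (i : ℕ) := by intro i r; simp [H]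
  let c : Fin (t + 1) → Fin n → ℝ := fun i j =>
    if j ∈ H i then weight ℓ i * |y j| else (weight ℓ i) ^ 2 * y j ^ 2 / (2 * θ)
  -- contribution of a single coordinate
  have hc : ∀ i r, c i (σ r) * (1 / 2) ^ (i : ℕ) ≤
      (1 / ((r : ℝ) + 1)) * (2 * ℓ y + mmc ℓ * ℓ y) := by
    intro i r
    have hr0 : (0 : ℝ) < (r : ℝ) + 1 := by positivity
    have hs := hℓ.sorted_mul_flatNorm_le hσ r
    have hwr := hℓ.flatNorm_pos hn (b := (r : ℕ) + 1) (by omega)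
    have h2i : (0 : ℝ) < 2 ^ (i : ℕ) := by positivity
    by_cases h : (r : ℕ) < 2 ^ (i : ℕ)
    · simp only [c, hH, h, if_true]
      have h1 := hℓ.flatNorm_le_two_mul_div (j := (r : ℕ) + 1) (k := 2 ^ (i : ℕ)) (by omega) h
      rw [← weight_eq_flatNorm] at h1
      push_cast at h1
      calc weight ℓ i * |y (σ r)| * (1 / 2) ^ (i : ℕ)
          ≤ (2 * (2 ^ (i : ℕ) / ((r : ℝ) + 1)) * flatNorm ℓ (r + 1)) * |y (σ r)| *
              (1 / 2) ^ (i : ℕ) := by gcongr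
        _ = (1 / ((r : ℝ) + 1)) * (2 * (|y (σ r)| * flatNorm ℓ (r + 1))) := by
            rw [one_div_pow]
            field_simp
        _ ≤ (1 / ((r : ℝ) + 1)) * (2 * ℓ y + mmc ℓ * ℓ y) := by
            gcongr
            have : 0 ≤ mmc ℓ * ℓ y := by positivity
            linarith
    · simp only [c, hH, h, if_false]
      have h1 := hℓ.flatNorm_div_sqrt_le (k := 2 ^ (i : ℕ)) (j := (r : ℕ) + 1) (by positivity)
        (by omega) (by omega)
      rw [← weight_eq_flatNorm] at h1
      push_cast at h1
      have h2 : weight ℓ i / √(2 ^ (i : ℕ)) * |y (σ r)| ≤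
          2 * mmc ℓ * √(Real.log (5 * (r + 1)) / (r + 1)) * ℓ y := by
        calc _ ≤ mmc ℓ * (2 * √(Real.log (5 * (r + 1)) / (r + 1)) * flatNorm ℓ (r + 1)) *
              |y (σ r)| := by gcongr
          _ = 2 * mmc ℓ * √(Real.log (5 * (r + 1)) / (r + 1)) *
              (|y (σ r)| * flatNorm ℓ (r + 1)) := by ring
          _ ≤ _ := by gcongr
      have h3 := pow_le_pow_left₀ (mul_nonneg (div_nonneg (weight_nonneg ℓ i) (Real.sqrt_nonneg _))
        (abs_nonneg _)) h2 2
      have hrn : ((r : ℕ) : ℝ) + 1 ≤ n := by exact_mod_cast r.2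
      have hl0 : 0 ≤ Real.log (5 * ((r : ℝ) + 1)) := Real.log_nonneg (by
        have : (0 : ℝ) ≤ r := by positivity
        linarith)
      have hl1 : Real.log (5 * ((r : ℝ) + 1)) ≤ Λ := by
        rw [hΛ]
        have : Real.log (5 * ((r : ℝ) + 1)) ≤ Real.log (5 * n) :=
          Real.log_le_log (by positivity) (by linarith)
        linarith
      rw [mul_pow, mul_pow, mul_pow, div_pow, Real.sq_sqrt (by positivity),
        Real.sq_sqrt (by positivity), sq_abs] at h3
      calc (weight ℓ i) ^ 2 * y (σ r) ^ 2 / (2 * θ) * (1 / 2) ^ (i : ℕ)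
          = ((weight ℓ i) ^ 2 / 2 ^ (i : ℕ) * y (σ r) ^ 2) / (2 * θ) := by
            rw [one_div_pow]; ring
        _ ≤ ((2 * mmc ℓ) ^ 2 * (Real.log (5 * (r + 1)) / (r + 1)) * ℓ y ^ 2) / (2 * θ) := by
            gcongr
        _ ≤ ((2 * mmc ℓ) ^ 2 * (Λ / (r + 1)) * ℓ y ^ 2) / (2 * θ) := by gcongr
        _ = (1 / ((r : ℝ) + 1)) * (mmc ℓ * ℓ y) := by
            rw [hθd]
            field_simp
        _ ≤ _ := by
            gcongr
            linarith
  have hint : ∫ z, ‖sampleMap ℓ z y‖ ∂bitLaw n t ≤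
      ∑ i : Fin (t + 1), ∑ j, c i j * (1 / 2) ^ (i : ℕ) + (t + 1) * (θ / 2) := by
    calc _ ≤ ∫ z, (∑ i, ∑ j, c i j * (if z (i, j) then 1 else 0) + (t + 1) * (θ / 2))
          ∂bitLaw n t :=
          integral_mono Integrable.of_finite Integrable.of_finite
            fun z => norm_sampleMap_le ℓ z y H hθ
      _ = _ := by
          rw [integral_add Integrable.of_finite Integrable.of_finite,
            integral_finsetSum _ fun i _ => Integrable.of_finite]
          congr 1
          · refine Finset.sum_congr rfl fun i _ => ?_
            rw [integral_finsetSum _ fun i _ => Integrable.of_finite]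
            refine Finset.sum_congr rfl fun j _ => ?_
            rw [integral_const_mul, integral_bit (fun b => if b then 1 else 0)]
            simp
          · simp
  refine hint.trans ?_
  have hsum : ∀ i : Fin (t + 1), ∑ j, c i j * (1 / 2) ^ (i : ℕ) ≤
      Λ * (2 * ℓ y + mmc ℓ * ℓ y) := by
    intro i
    rw [← Equiv.sum_comp σ]
    calc _ ≤ ∑ r : Fin n, (1 / ((r : ℝ) + 1)) * (2 * ℓ y + mmc ℓ * ℓ y) :=
          Finset.sum_le_sum fun r _ => hc i r
      _ ≤ _ := by rw [← Finset.sum_mul]; gcongr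
  calc _ ≤ ∑ i : Fin (t + 1), Λ * (2 * ℓ y + mmc ℓ * ℓ y) + (t + 1) * (θ / 2) := by
        gcongr with i; exact hsum i
    _ = (t + 1) * (Λ * (2 * ℓ y + mmc ℓ * ℓ y) + θ / 2) := by
        rw [Finset.sum_const, Finset.card_univ, Fintype.card_fin, nsmul_eq_mul]
        push_cast
        ring
    _ ≤ _ := by
        gcongr
        rw [hθd]
        have : 0 ≤ Λ * ℓ y := by positivity
        nlinarith
/-! ### The sampling step: lower bound for a fixed vector -/

lemma norm_sampleMap_sq_ge (ℓ : Seminorm ℝ (Fin n → ℝ)) (z : Fin (t + 1) × Fin n → Bool)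
    {y : Fin n → ℝ} (i : Fin (t + 1)) {S : Finset (Fin n)} {a : ℝ} (ha : 0 ≤ a)
    (hS : ∀ j ∈ S, a ≤ |y j|) :
    weight ℓ i ^ 2 * a ^ 2 * (S.filter fun j => z (i, j) = true).card ≤ ‖sampleMap ℓ z y‖ ^ 2 := by
  rw [norm_sampleMap_sq]
  have hnn : ∀ (i' : Fin (t + 1)) j, 0 ≤ (weight ℓ i') ^ 2 * (if z (i', j) then y j ^ 2 else 0) :=
      fun i' j => by
    split_ifs <;> positivity
  calc weight ℓ i ^ 2 * a ^ 2 * (S.filter fun j => z (i, j) = true).card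
      = ∑ j ∈ S.filter fun j => z (i, j) = true, weight ℓ i ^ 2 * a ^ 2 := by
        rw [Finset.sum_const, nsmul_eq_mul]; ring
    _ ≤ ∑ j ∈ S.filter fun j => z (i, j) = true,
          weight ℓ i ^ 2 * (if z (i, j) then y j ^ 2 else 0) := by
        refine Finset.sum_le_sum fun j hj => ?_
        rw [Finset.mem_filter] at hj
        rw [if_pos hj.2, ← sq_abs (y j)]
        have := hS j hj.1
        gcongr
    _ ≤ ∑ j, weight ℓ i ^ 2 * (if z (i, j) then y j ^ 2 else 0) :=
        Finset.sum_le_univ_sum_of_nonneg fun j => hnn i j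
    _ ≤ _ := Finset.single_le_sum (f := fun i' : Fin (t + 1) =>
        ∑ j, weight ℓ i' ^ 2 * (if z (i', j) then y j ^ 2 else 0))
        (fun i' _ => Finset.sum_nonneg fun j _ => hnn i' j) (Finset.mem_univ i)

/-- Chernoff bound for the number of sampled coordinates on one level. -/
lemma bitLaw_card_filter_le (i : Fin (t + 1)) (S : Finset (Fin n)) :
    (bitLaw n t).real {z | ((S.filter fun j => z (i, j) = true).card : ℝ) ≤
      S.card / 2 ^ (i : ℕ) / 4} ≤ Real.exp (-(S.card / 2 ^ (i : ℕ)) / 4) := by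
  classical
  set m : ℝ := S.card / 2 ^ (i : ℕ) with hm
  have hm0 : 0 ≤ m := by positivity
  let T : Finset (Fin (t + 1) × Fin n) := S.map ⟨fun j => (i, j), fun a b h => by simpa using h⟩
  let f : Fin (t + 1) × Fin n → Bool → ℝ := fun ij b =>
    if ij ∈ T then (if b then 1 / 2 else 1) else 1
  have hprod : ∀ z : Fin (t + 1) × Fin n → Bool, ∏ ij, f ij (z ij) =
      (1 / 2) ^ (S.filter fun j => z (i, j) = true).card := by
    intro z
    simp only [f, Finset.prod_ite_mem, Finset.univ_inter, T, Finset.prod_map]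
    rw [Finset.prod_ite, Finset.prod_const, Finset.prod_const_one, mul_one]
    rfl
  have hint : ∫ z, ∏ ij, f ij (z ij) ∂bitLaw n t = (1 - (1 / 2) ^ (i : ℕ) / 2) ^ S.card := by
    rw [integral_fintype_prod_eq_prod]
    have h1 : ∀ ij : Fin (t + 1) × Fin n,
        ∫ b, f ij b ∂bernoulliMeasure true false (halfPow ij.1) =
          if ij ∈ T then 1 - (1 / 2) ^ (ij.1 : ℕ) / 2 else 1 := by
      intro ij
      rw [integral_bernoulliMeasure]
      by_cases h : ij ∈ T
      · simp only [f, h, if_true, halfPow, smul_eq_mul]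
        simp
        ring
      · simp [f, h]
    simp_rw [h1]
    simp only [Finset.prod_ite_mem, Finset.univ_inter, T, Finset.prod_map]
    exact Finset.prod_const (s := S) (1 - (1 / 2 : ℝ) ^ (i : ℕ) / 2)
  have hmarkov := mul_meas_ge_le_integral_of_nonneg (μ := bitLaw n t)
    (f := fun z => ∏ ij, f ij (z ij))
    (Filter.Eventually.of_forall fun z => by simp only [hprod]; positivity)
    Integrable.of_finite (Real.exp (-(m / 4) * Real.log 2))
  rw [hint] at hmarkov
  have hsub : {z : Fin (t + 1) × Fin n → Bool |
      ((S.filter fun j => z (i, j) = true).card : ℝ) ≤ m / 4} ⊆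
      {z | Real.exp (-(m / 4) * Real.log 2) ≤ ∏ ij, f ij (z ij)} := by
    intro z hz
    simp only [Set.mem_ofPred_eq] at hz ⊢
    rw [hprod, one_div, inv_pow, ← Real.rpow_natCast, Real.rpow_def_of_pos (by norm_num),
      ← Real.exp_neg, Real.exp_le_exp]
    have := Real.log_pos (one_lt_two)
    nlinarith
  have hbase : (1 - (1 / 2 : ℝ) ^ (i : ℕ) / 2) ^ S.card ≤ Real.exp (-(m / 2)) := by
    have h1 : (1 - (1 / 2 : ℝ) ^ (i : ℕ) / 2) ≤ Real.exp (-((1 / 2 : ℝ) ^ (i : ℕ) / 2)) := by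
      have := Real.add_one_le_exp (-((1 / 2 : ℝ) ^ (i : ℕ) / 2))
      linarith
    have h0 : 0 ≤ (1 - (1 / 2 : ℝ) ^ (i : ℕ) / 2) := by
      have : (1 / 2 : ℝ) ^ (i : ℕ) ≤ 1 := pow_le_one₀ (by norm_num) (by norm_num)
      linarith
    refine (pow_le_pow_left₀ h0 h1 _).trans (le_of_eq ?_)
    rw [← Real.exp_nat_mul, hm, one_div_pow]
    congr 1
    ring
  calc _ ≤ _ := measureReal_mono hsub
    _ = Real.exp (m / 4 * Real.log 2) * (Real.exp (-(m / 4) * Real.log 2) *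
        (bitLaw n t).real {z | Real.exp (-(m / 4) * Real.log 2) ≤ ∏ ij, f ij (z ij)}) := by
        rw [← mul_assoc, ← Real.exp_add]
        simp
    _ ≤ Real.exp (m / 4 * Real.log 2) * Real.exp (-(m / 2)) := by
        gcongr
        exact hmarkov.trans hbase
    _ ≤ _ := by
        rw [← Real.exp_add, Real.exp_le_exp]
        have := Real.log_two_lt_d9
        nlinarith

/-- On level `0` every coordinate is kept, since the sampling probability is one. -/
lemma bitLaw_exists_first_level_eq_false :
    (bitLaw n t).real {z | ∃ j, z (0, j) = false} = 0 := by
  have h : {z : Fin (t + 1) × Fin n → Bool | ∃ j, z (0, j) = false} =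
      ⋃ j, {z | z (0, j) = false} := by ext z; simp
  rw [measureReal_eq_zero_iff, h]
  refine measure_iUnion_null fun j => ?_
  refine Measure.pi_eval_preimage_null (μ := fun ij : Fin (t + 1) × Fin n =>
    bernoulliMeasure true false (halfPow ij.1)) (i := ((0 : Fin (t + 1)), j)) (s := {false}) ?_
  have : halfPow 0 = 1 := by ext; simp [halfPow]
  simp [this]

/-- For a fixed vector the sampling step loses more than a factor `O(log n · √(2 ^ q))` with
probability at most `exp (-2 ^ q / 4)`. Let the dominant level set of `y` have `2 ^ s` elements. If
`s ≤ q`, then level `0`, which keeps all of them, is enough; otherwise about `2 ^ q` of them are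
sampled on level `s - q`. -/
lemma IsSymmetricNorm.prob_norm_sampleMap_lt (hℓ : IsSymmetricNorm ℓ) (hn : 0 < n) {q : ℕ}
    (hq : n ≤ 2 ^ (q + t)) (y : Fin n → ℝ) :
    (bitLaw n t).real {z | ‖sampleMap ℓ z y‖ < ℓ y / (2 * (Nat.log 2 n + 1 : ℕ) * √(2 ^ q))} ≤
      Real.exp (-(2 ^ q) / 4) := by
  obtain ⟨s, S, a, hsn, hSc, ha, hSa, hle⟩ := hℓ.exists_level hn y
  set L : ℕ := Nat.log 2 n + 1
  have hL : (0 : ℝ) < L := by positivity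
  have hQ : (0 : ℝ) < 2 ^ q := by positivity
  have hw := flatNorm_nonneg ℓ (2 ^ s)
  -- it suffices to bound the square from below
  have hred : ∀ z : Fin (t + 1) × Fin n → Bool,
      (a * flatNorm ℓ (2 ^ s)) ^ 2 / (4 * 2 ^ q) ≤ ‖sampleMap ℓ z y‖ ^ 2 →
      ¬ ‖sampleMap ℓ z y‖ < ℓ y / (2 * L * √(2 ^ q)) := by
    intro z hz hlt
    have h1 : ℓ y / (2 * L * √(2 ^ q)) ≤ a * flatNorm ℓ (2 ^ s) / (2 * √(2 ^ q)) := by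
      rw [div_le_div_iff₀ (by positivity) (by positivity)]
      calc ℓ y * (2 * √(2 ^ q)) ≤ (L * (a * flatNorm ℓ (2 ^ s))) * (2 * √(2 ^ q)) := by gcongr
        _ = _ := by ring
    have h2 := pow_lt_pow_left₀ (hlt.trans_le h1) (norm_nonneg _) two_ne_zero
    rw [div_pow, mul_pow 2, Real.sq_sqrt hQ.le] at h2
    norm_num at h2
    linarith
  by_cases hs : s ≤ q
  · refine le_trans (le_of_eq ?_) (Real.exp_pos _).le
    refine le_antisymm ?_ measureReal_nonneg
    rw [← bitLaw_exists_first_level_eq_false (n := n) (t := t)]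
    refine measureReal_mono fun z hz => ?_
    simp only [Set.mem_ofPred_eq] at hz ⊢
    by_contra! hall
    refine hred z ?_ hz
    have h1 := norm_sampleMap_sq_ge ℓ z 0 ha hSa
    have h2 : S.filter (fun j => z (0, j) = true) = S :=
      Finset.filter_true_of_mem fun j _ => by simpa using hall j
    rw [h2, hSc, weight_eq_flatNorm] at h1
    refine le_trans ?_ h1
    have h3 := hℓ.flatNorm_mul_le (2 ^ s) 1
    rw [mul_one] at h3
    push_cast at h3 ⊢
    rw [div_le_iff₀ (by positivity)]
    have h4 : (2 : ℝ) ^ s ≤ 2 ^ q := pow_le_pow_right₀ one_le_two hs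
    have hw1 := flatNorm_nonneg ℓ 1
    calc (a * flatNorm ℓ (2 ^ s)) ^ 2 ≤ (a * (2 ^ s * flatNorm ℓ 1)) ^ 2 := by gcongr
      _ = flatNorm ℓ 1 ^ 2 * a ^ 2 * 2 ^ s * 2 ^ s := by ring
      _ ≤ flatNorm ℓ 1 ^ 2 * a ^ 2 * 2 ^ s * (4 * 2 ^ q) := by
          gcongr
          linarith
  · have hst : s ≤ q + t := (Nat.pow_le_pow_iff_right (by norm_num : 1 < 2)).1 (hsn.trans hq)
    have hcard : (S.card : ℝ) / 2 ^ (s - q) = 2 ^ q := by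
      rw [hSc, div_eq_iff (by positivity)]
      push_cast
      rw [← pow_add]
      congr 1
      omega
    have hch := bitLaw_card_filter_le (n := n) (t := t) ⟨s - q, by omega⟩ S
    simp only [hcard] at hch
    refine le_trans (measureReal_mono fun z hz => ?_) hch
    simp only [Set.mem_ofPred_eq] at hz ⊢
    by_contra! hgt
    refine hred z ?_ hz
    refine le_trans ?_ (norm_sampleMap_sq_ge ℓ z ⟨s - q, by omega⟩ ha hSa)
    have h3 := hℓ.flatNorm_mul_le (2 ^ q) (2 ^ (s - q))
    rw [← pow_add, show q + (s - q) = s by omega, ← weight_eq_flatNorm ℓ (s - q)] at h3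
    push_cast at h3
    have hw1 := weight_nonneg ℓ (s - q)
    rw [div_le_iff₀ (by positivity)]
    calc (a * flatNorm ℓ (2 ^ s)) ^ 2 ≤ (a * (2 ^ q * weight ℓ (s - q))) ^ 2 := by gcongr
      _ = weight ℓ (s - q) ^ 2 * a ^ 2 * (2 ^ q / 4) * (4 * 2 ^ q) := by ring
      _ ≤ _ := by gcongr

/-- A crude bound on the sampling step that holds for all outcomes. -/
lemma IsSymmetricNorm.norm_sampleMap_le_pow (hℓ : IsSymmetricNorm ℓ) (ht : 2 ^ t ≤ n)
    (z : Fin (t + 1) × Fin n → Bool) (v : Fin n → ℝ) : ‖sampleMap ℓ z v‖ ≤ n ^ 2 * ℓ v := by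
  have htn : t + 1 ≤ n := (Nat.lt_two_pow_self (n := t)).trans_le ht
  have hℓv : 0 ≤ ℓ v := apply_nonneg ℓ v
  have hterm : ∀ (i : Fin (t + 1)) (j : Fin n),
      (weight ℓ i) ^ 2 * (if z (i, j) then v j ^ 2 else 0) ≤ (n * ℓ v) ^ 2 := by
    intro i j
    have h1 : weight ℓ i ≤ n * flatNorm ℓ 1 := by
      rw [weight_eq_flatNorm]
      have h2 : flatNorm ℓ (2 ^ (i : ℕ)) ≤ flatNorm ℓ n := by
        rcases le_total (2 ^ (i : ℕ)) n with h | h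
        · exact hℓ.flatNorm_mono h
        · exact (flatNorm_le_flatNorm_n ℓ h).le
      have h3 := hℓ.flatNorm_mul_le n 1
      rw [mul_one] at h3
      exact h2.trans h3
    have h4 := hℓ.abs_mul_flatNorm_one_le v j
    have h5 : weight ℓ i * |v j| ≤ n * ℓ v := by
      calc _ ≤ n * flatNorm ℓ 1 * |v j| := by gcongr
        _ = n * (|v j| * flatNorm ℓ 1) := by ring
        _ ≤ _ := by gcongr
    split_ifs
    · rw [← sq_abs (v j), ← mul_pow]
      exact pow_le_pow_left₀ (mul_nonneg (weight_nonneg ℓ _) (abs_nonneg _)) h5 2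
    · rw [mul_zero]; positivity
  refine le_of_sq_le_sq ?_ (by positivity)
  rw [norm_sampleMap_sq]
  calc _ ≤ ∑ i : Fin (t + 1), ∑ j : Fin n, (n * ℓ v) ^ 2 :=
        Finset.sum_le_sum fun i _ => Finset.sum_le_sum fun j _ => hterm i j
    _ = ((t + 1 : ℕ) : ℝ) * n * (n * ℓ v) ^ 2 := by simp; ring
    _ ≤ (n : ℝ) * n * (n * ℓ v) ^ 2 := by gcongr
    _ = _ := by ring

end Sampling

/-! ### Auerbach bases and the sampling step on a subspace -/

section Auerbach

variable {n t r : ℕ} {ℓ : Seminorm ℝ (Fin n → ℝ)}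

/-- Every subspace has an Auerbach basis: unit vectors with respect to which every coordinate of a
vector is bounded by its norm. They maximize the determinant over the unit ball of the subspace. -/
lemma IsSymmetricNorm.exists_auerbach (hℓ : IsSymmetricNorm ℓ) (hn : 0 < n)
    (V : Submodule ℝ (Fin n → ℝ)) :
    ∃ u : Fin (Module.finrank ℝ V) → (Fin n → ℝ), (∀ k, ℓ (u k) ≤ 1) ∧
      (∀ v ∈ V, ∃ x : Fin (Module.finrank ℝ V) → ℝ, v = ∑ k, x k • u k) ∧
      ∀ (x : Fin (Module.finrank ℝ V) → ℝ) k, |x k| ≤ ℓ (∑ l, x l • u l) := by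
  classical
  set r := Module.finrank ℝ V
  let b := Module.finBasis ℝ V
  let S : Set V := {v | ℓ (v : Fin n → ℝ) ≤ 1}
  have hw1 := hℓ.flatNorm_pos hn one_pos
  have hSc : IsCompact S := by
    refine Metric.isCompact_of_isClosed_isBounded
      (isClosed_le (hℓ.continuous.comp continuous_subtype_val) continuous_const) ?_
    refine (Metric.isBounded_closedBall (x := (0 : V)) (r := 1 / flatNorm ℓ 1)).subset
      fun v hv => ?_
    rw [mem_closedBall_zero_iff, Submodule.coe_norm, pi_norm_le_iff_of_nonneg (by positivity)]
    intro j
    rw [le_div_iff₀ hw1]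
    exact (hℓ.abs_mul_flatNorm_one_le _ j).trans hv
  have hKc : IsCompact (Set.univ.pi fun _ : Fin r => S) := isCompact_univ_pi fun _ => hSc
  have hcont : Continuous fun w : Fin r → V => |b.det w| := by
    refine continuous_abs.comp ?_
    have h1 : Continuous fun w : Fin r → V => b.toMatrix w := by
      refine continuous_matrix fun i j => ?_
      have : Continuous (b.coord i) := LinearMap.continuous_of_finiteDimensional _
      exact this.comp (continuous_apply j)
    exact h1.matrix_det
  have hKne : (Set.univ.pi fun _ : Fin r => S).Nonempty :=
    ⟨0, fun k _ => by simp [S]⟩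
  obtain ⟨u, huK, humax⟩ := hKc.exists_isMaxOn hKne hcont.continuousOn
  have huS : ∀ k, ℓ (u k : Fin n → ℝ) ≤ 1 := fun k => huK k trivial
  have hdet : 0 < |b.det u| := by
    have hb0 : ∀ k, 0 < ℓ (b k : Fin n → ℝ) := by
      intro k
      refine lt_of_le_of_ne (apply_nonneg _ _) fun h => b.ne_zero k ?_
      exact Subtype.ext (hℓ.definite _ h.symm)
    have hmem : (fun k => (ℓ (b k : Fin n → ℝ))⁻¹ • b k) ∈ Set.univ.pi fun _ : Fin r => S := by
      intro k _
      simp only [S, Set.mem_ofPred_eq, Submodule.coe_smul, map_smul_eq_mul]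
      rw [Real.norm_of_nonneg (inv_nonneg.2 (hb0 k).le), inv_mul_cancel₀ (hb0 k).ne']
    have h2 := humax hmem
    simp only [Set.mem_ofPred_eq] at h2
    refine lt_of_lt_of_le ?_ h2
    rw [b.det.map_smul_univ (fun k => (ℓ (b k : Fin n → ℝ))⁻¹) b, b.det_self, smul_eq_mul,
      mul_one, abs_pos]
    exact Finset.prod_ne_zero_iff.2 fun k _ => inv_ne_zero (hb0 k).ne'
  obtain ⟨-, hspan⟩ := (Module.Basis.is_basis_iff_det b (v := u)).2
    (isUnit_iff_ne_zero.2 (abs_pos.1 hdet))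
  refine ⟨fun k => u k, huS, fun v hv => ?_, fun x k => ?_⟩
  · have : (⟨v, hv⟩ : V) ∈ Submodule.span ℝ (Set.range u) := by rw [hspan]; trivial
    obtain ⟨x, hx⟩ := (Submodule.mem_span_range_iff_exists_fun ℝ).1 this
    refine ⟨x, ?_⟩
    have := congrArg Subtype.val hx
    simpa using this.symm
  · set v : V := ∑ l, x l • u l with hv
    have hvc : (v : Fin n → ℝ) = ∑ l, x l • (u l : Fin n → ℝ) := by simp [hv]
    rw [← hvc]
    -- Cramer's rule
    have hcramer : b.det (Function.update u k v) = x k * b.det u := by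
      rw [hv, b.det.map_update_sum, Finset.sum_eq_single k]
      · rw [b.det.map_update_smul, Function.update_eq_self, smul_eq_mul]
      · intro l _ hl
        rw [b.det.map_update_smul, b.det.map_update_self _ (Ne.symm hl), smul_zero]
      · simp
    have hle : |b.det (Function.update u k v)| ≤ ℓ (v : Fin n → ℝ) * |b.det u| := by
      by_cases h0 : ℓ (v : Fin n → ℝ) = 0
      · have : v = 0 := Subtype.ext (hℓ.definite _ h0)
        rw [this, b.det.map_coord_zero k (by simp)]
        simp
      · have hpos : 0 < ℓ (v : Fin n → ℝ) := lt_of_le_of_ne (apply_nonneg _ _) (Ne.symm h0)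
        have hmem : Function.update u k ((ℓ (v : Fin n → ℝ))⁻¹ • v) ∈
            Set.univ.pi fun _ : Fin r => S := by
          intro l _
          by_cases hl : l = k
          · subst hl
            simp only [Function.update_self, S, Set.mem_ofPred_eq, Submodule.coe_smul,
              map_smul_eq_mul]
            rw [Real.norm_of_nonneg (inv_nonneg.2 hpos.le), inv_mul_cancel₀ hpos.ne']
          · rw [Function.update_of_ne hl]
            exact huS l
        have h2 := humax hmem
        simp only [Set.mem_ofPred_eq] at h2
        rw [b.det.map_update_smul, smul_eq_mul, abs_mul, abs_inv, abs_of_pos hpos,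
          inv_mul_le_iff₀ hpos] at h2
        exact h2
    rw [hcramer, abs_mul] at hle
    exact le_of_mul_le_mul_right hle hdet

/-- Upper bound for the sampling step on a subspace with an Auerbach basis `u`. -/
lemma IsSymmetricNorm.prob_exists_norm_sampleMap_gt (hℓ : IsSymmetricNorm ℓ) (hn : 0 < n)
    {u : Fin r → (Fin n → ℝ)} (hu : ∀ k, ℓ (u k) ≤ 1)
    (hcoord : ∀ (x : Fin r → ℝ) k, |x k| ≤ ℓ (∑ l, x l • u l)) (hr : 0 < r) :
    (bitLaw n t).real {z | ∃ x : Fin r → ℝ,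
      100 * r * ((t + 1) * (8 * mmc ℓ * (1 + Real.log (5 * n)))) * ℓ (∑ k, x k • u k) <
        ‖sampleMap ℓ z (∑ k, x k • u k)‖} ≤ 1 / 100 := by
  have hm : 0 < mmc ℓ := by linarith [hℓ.one_le_three_mul_mmc hn]
  have hn1 : (1 : ℝ) ≤ n := by exact_mod_cast hn
  have hlog : 0 ≤ Real.log (5 * n) := Real.log_nonneg (by linarith)
  set B := (t + 1) * (8 * mmc ℓ * (1 + Real.log (5 * n))) with hB
  have hB0 : 0 < B := by positivity
  have hmarkov := mul_meas_ge_le_integral_of_nonneg (μ := bitLaw n t)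
    (f := fun z => ∑ k, ‖sampleMap ℓ z (u k)‖)
    (Filter.Eventually.of_forall fun z => Finset.sum_nonneg fun k _ => norm_nonneg _)
    Integrable.of_finite (100 * r * B)
  rw [integral_finsetSum _ fun i _ => Integrable.of_finite] at hmarkov
  have hint : ∑ k, ∫ z, ‖sampleMap ℓ z (u k)‖ ∂bitLaw n t ≤ r * B := by
    calc _ ≤ ∑ k : Fin r, B := by
          refine Finset.sum_le_sum fun k _ => (hℓ.integral_norm_sampleMap_le hn (u k)).trans ?_
          calc _ = B * ℓ (u k) := by rw [hB]; ring
            _ ≤ B := mul_le_of_le_one_right hB0.le (hu k)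
      _ = r * B := by simp
  have hsub : {z : Fin (t + 1) × Fin n → Bool | ∃ x : Fin r → ℝ,
      100 * r * B * ℓ (∑ k, x k • u k) < ‖sampleMap ℓ z (∑ k, x k • u k)‖} ⊆
      {z | 100 * r * B ≤ ∑ k, ‖sampleMap ℓ z (u k)‖} := by
    rintro z ⟨x, hx⟩
    simp only [Set.mem_ofPred_eq]
    set v := ∑ k, x k • u k with hv
    have h1 : ‖sampleMap ℓ z v‖ ≤ ℓ v * ∑ k, ‖sampleMap ℓ z (u k)‖ := by
      rw [Finset.mul_sum]
      conv_lhs => rw [hv, map_sum]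
      refine (norm_sum_le _ _).trans (Finset.sum_le_sum fun k _ => ?_)
      rw [map_smul, norm_smul]
      gcongr
      exact hcoord x k
    have h2 : ℓ v * (100 * r * B) < ℓ v * ∑ k, ‖sampleMap ℓ z (u k)‖ := by linarith
    exact (lt_of_mul_lt_mul_left h2 (apply_nonneg _ _)).le
  have h3 := hmarkov.trans hint
  have hr' : (0 : ℝ) < r * B := by positivity
  refine (measureReal_mono hsub).trans ?_
  rw [le_div_iff₀ (by norm_num)]
  refine le_of_mul_le_mul_left ?_ hr'
  linarith

/-- A grid in Auerbach coordinates is a net: if the sampling step does not shrink any grid point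
too much, then it does not shrink any vector of the subspace too much. -/
lemma IsSymmetricNorm.le_norm_sampleMap_of_grid (hℓ : IsSymmetricNorm ℓ) (ht : 2 ^ t ≤ n)
    {u : Fin r → (Fin n → ℝ)} (hu : ∀ k, ℓ (u k) ≤ 1)
    (hcoord : ∀ (x : Fin r → ℝ) k, |x k| ≤ ℓ (∑ l, x l • u l)) {M : ℕ} (hM0 : 0 < M) {β : ℝ}
    (hβ : 1 ≤ β) (hM : 4 * β * n ^ 2 * r ≤ M) (hn : 0 < n)
    (z : Fin (t + 1) × Fin n → Bool)
    (hz : ∀ m : Fin r → Fin (2 * M + 1),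
      ℓ (∑ k, (((m k : ℕ) : ℝ) / M - 1) • u k) / β ≤
        ‖sampleMap ℓ z (∑ k, (((m k : ℕ) : ℝ) / M - 1) • u k)‖)
    (x : Fin r → ℝ) : ℓ (∑ k, x k • u k) / (2 * β) ≤ ‖sampleMap ℓ z (∑ k, x k • u k)‖ := by
  have hM' : (0 : ℝ) < M := by exact_mod_cast hM0
  have hn1 : (1 : ℝ) ≤ n := by exact_mod_cast hn
  have hβ0 : 0 < β := by linarith
  set v := ∑ k, x k • u k with hv
  by_cases h0 : ℓ v = 0
  · rw [h0, zero_div]; exact norm_nonneg _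
  have hpos : 0 < ℓ v := lt_of_le_of_ne (apply_nonneg _ _) (Ne.symm h0)
  -- normalize the vector and round its coordinates down to the grid
  let x' : Fin r → ℝ := fun k => x k / ℓ v
  have hx' : ∀ k, |x' k| ≤ 1 := fun k => by
    rw [abs_div, abs_of_pos hpos]
    exact div_le_one_of_le₀ (hcoord x k) hpos.le
  have hv' : v = ℓ v • ∑ k, x' k • u k := by
    rw [Finset.smul_sum, hv]
    refine Finset.sum_congr rfl fun k _ => ?_
    rw [smul_smul, mul_div_cancel₀ _ h0]
  set v' := ∑ k, x' k • u k with hv'd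
  have hℓv' : ℓ v' = 1 := by
    have : ℓ v = ℓ v * ℓ v' := by
      conv_lhs => rw [hv', map_smul_eq_mul, Real.norm_of_nonneg hpos.le]
    have h2 : ℓ v * (ℓ v' - 1) = 0 := by linarith
    rcases mul_eq_zero.1 h2 with h | h
    · exact absurd h h0
    · linarith
  let m : Fin r → Fin (2 * M + 1) := fun k => ⟨⌊(x' k + 1) * M⌋₊, by
    have h1 := (abs_le.1 (hx' k)).2
    have h2 : (x' k + 1) * M ≤ (2 * M : ℕ) := by push_cast; nlinarith
    have := Nat.floor_le_floor h2
    rw [Nat.floor_natCast] at this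
    omega⟩
  have hm : ∀ k, |x' k - (((m k : ℕ) : ℝ) / M - 1)| ≤ 1 / M := by
    intro k
    have h1 := (abs_le.1 (hx' k)).1
    have hnn : 0 ≤ (x' k + 1) * M := mul_nonneg (by linarith) hM'.le
    have h2 := Nat.floor_le hnn
    have h3 := Nat.lt_floor_add_one ((x' k + 1) * M)
    have h4 : x' k - (((m k : ℕ) : ℝ) / M - 1) =
        ((x' k + 1) * M - ⌊(x' k + 1) * M⌋₊) / M := by
      simp only [m]
      field_simp
      ring
    rw [h4, abs_div, abs_of_pos hM']
    gcongr
    rw [abs_le]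
    constructor <;> linarith
  set y := ∑ k, (((m k : ℕ) : ℝ) / M - 1) • u k with hy
  have hdiff : ℓ (v' - y) ≤ r / M := by
    rw [hv'd, hy, ← Finset.sum_sub_distrib]
    calc _ ≤ ∑ k, ℓ (x' k • u k - (((m k : ℕ) : ℝ) / M - 1) • u k) :=
          Finset.le_sum_of_subadditive ℓ (map_zero ℓ).le (map_add_le_add ℓ) _ _
      _ ≤ ∑ k : Fin r, 1 / (M : ℝ) := by
          refine Finset.sum_le_sum fun k _ => ?_
          rw [← sub_smul, map_smul_eq_mul]
          calc _ ≤ 1 / (M : ℝ) * 1 := mul_le_mul (hm k) (hu k) (apply_nonneg _ _) (by positivity)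
            _ = _ := mul_one _
      _ = r / M := by simp [div_eq_mul_inv]
  have hrM : n ^ 2 * ((r : ℝ) / M) ≤ 1 / (4 * β) := by
    rw [← mul_div_assoc, div_le_div_iff₀ hM' (by positivity)]
    linarith
  have hrM1 : (r : ℝ) / M ≤ n ^ 2 * ((r : ℝ) / M) :=
    le_mul_of_one_le_left (by positivity) (one_le_pow₀ hn1)
  have hrM2 : (r : ℝ) / M ≤ 1 / 4 := by
    refine (hrM1.trans hrM).trans ?_
    gcongr
    linarith
  have hy1 : 3 / 4 ≤ ℓ y := by
    have h1 : ℓ v' ≤ ℓ (v' - y) + ℓ y := by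
      calc ℓ v' = ℓ ((v' - y) + y) := by rw [sub_add_cancel]
        _ ≤ _ := map_add_le_add ℓ _ _
    linarith
  have hfinal : 1 / (2 * β) ≤ ‖sampleMap ℓ z v'‖ := by
    have h1 := hz m
    have h2 : ‖sampleMap ℓ z y‖ ≤ ‖sampleMap ℓ z v'‖ + ‖sampleMap ℓ z (v' - y)‖ := by
      rw [map_sub]
      have := norm_sub_le (sampleMap ℓ z v') (sampleMap ℓ z v' - sampleMap ℓ z y)
      rwa [sub_sub_cancel] at this
    have h3 := hℓ.norm_sampleMap_le_pow ht z (v' - y)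
    have h4 : ‖sampleMap ℓ z (v' - y)‖ ≤ 1 / (4 * β) := by
      refine h3.trans (le_trans ?_ hrM)
      gcongr
    have h5 : 3 / 4 / β ≤ ‖sampleMap ℓ z y‖ := by
      refine le_trans ?_ h1
      gcongr
    have h6 : 3 / 4 / β = 1 / (2 * β) + 1 / (4 * β) := by field_simp; norm_num
    linarith
  have hnorm : ‖sampleMap ℓ z v‖ = ℓ v * ‖sampleMap ℓ z v'‖ := by
    conv_lhs => rw [hv', LinearMap.map_smul, norm_smul, Real.norm_of_nonneg hpos.le]
  rw [hnorm]
  calc ℓ v / (2 * β) = ℓ v * (1 / (2 * β)) := by ring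
    _ ≤ _ := by gcongr

/-- Lower bound for the sampling step on a subspace with an Auerbach basis `u`: with high
probability the sampling step loses at most a factor `O(log n · √(r log n))`. -/
lemma IsSymmetricNorm.prob_exists_norm_sampleMap_lt (hℓ : IsSymmetricNorm ℓ) (hn : 2 ≤ n)
    (ht : 2 ^ t ≤ n) {a : ℕ} (ha : 8 ≤ a) (hat : n ≤ 2 ^ (a + t)) (hr : 0 < r) (hrn : r ≤ n)
    {u : Fin r → (Fin n → ℝ)} (hu : ∀ k, ℓ (u k) ≤ 1)
    (hcoord : ∀ (x : Fin r → ℝ) k, |x k| ≤ ℓ (∑ l, x l • u l)) :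
    (bitLaw n t).real {z | ∃ x : Fin r → ℝ,
      ‖sampleMap ℓ z (∑ k, x k • u k)‖ < ℓ (∑ k, x k • u k) /
        (4 * (Nat.log 2 n + 1 : ℕ) * √(2 ^ (a + 1) * r * (Nat.log 2 n + 1 : ℕ)))} ≤
      1 / 100 := by
  set L := Nat.log 2 n + 1 with hLd
  have hL2 : 2 ≤ L := by
    have : 1 ≤ Nat.log 2 n := Nat.log_pos (by norm_num) hn
    omega
  have hnL : n < 2 ^ L := Nat.lt_pow_succ_log_self (by norm_num) n
  have hLlt : L < 2 ^ L := Nat.lt_two_pow_self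
  -- the number of surviving coordinates `2 ^ q` is of the order of the entropy of the grid
  set X := 2 ^ a * r * L with hX
  have hX0 : X ≠ 0 := by positivity
  set q := Nat.log 2 X + 1 with hq
  have hq1 : X < 2 ^ q := Nat.lt_pow_succ_log_self (by norm_num) X
  have hq2 : 2 ^ q ≤ 2 * X := by
    rw [hq, pow_succ, mul_comm]
    exact Nat.mul_le_mul_left 2 (Nat.pow_log_le_self 2 hX0)
  have hqa : q ≤ a + 1 + 2 * L := by
    refine (Nat.pow_le_pow_iff_right (by norm_num : 1 < 2)).1 (hq2.trans ?_)
    calc 2 * X = 2 ^ (a + 1) * r * L := by rw [hX]; ring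
      _ ≤ 2 ^ (a + 1) * 2 ^ L * 2 ^ L := by gcongr; omega
      _ = _ := by rw [← pow_add, ← pow_add]; congr 1; ring
  have hqt : n ≤ 2 ^ (q + t) := by
    refine hat.trans (Nat.pow_le_pow_right (by norm_num) ?_)
    have : 2 ^ a ≤ 2 ^ q := by
      refine le_trans ?_ hq1.le
      rw [hX, mul_assoc]
      exact Nat.le_mul_of_pos_right _ (by positivity)
    have := (Nat.pow_le_pow_iff_right (by norm_num : 1 < 2)).1 this
    omega
  -- the mesh `1 / M` is fine enough for the crude bound `‖D̃ v‖ ≤ n² ℓ(v)` on rounding errors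
  set e := 3 + q + 4 * L with he
  set M := 2 ^ e with hMd
  have hL0 : (1 : ℝ) ≤ L := by exact_mod_cast (by omega : 1 ≤ L)
  set β : ℝ := 2 * L * √(2 ^ q) with hβd
  have hsq1 : (1 : ℝ) ≤ √(2 ^ q) := Real.one_le_sqrt.2 (one_le_pow₀ one_le_two)
  have hβ : 1 ≤ β := by rw [hβd]; nlinarith
  have hMβ : 4 * β * n ^ 2 * r ≤ M := by
    have h1 : √((2 : ℝ) ^ q) ≤ 2 ^ q := by
      refine Real.sqrt_le_iff.2 ⟨by positivity, ?_⟩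
      have : (1 : ℝ) ≤ 2 ^ q := one_le_pow₀ one_le_two
      nlinarith
    have hrL : r ≤ 2 ^ L := by omega
    have h2 : 4 * (2 * L * 2 ^ q) * n ^ 2 * r ≤ M := by
      calc 4 * (2 * L * 2 ^ q) * n ^ 2 * r
          ≤ 4 * (2 * 2 ^ L * 2 ^ q) * (2 ^ L) ^ 2 * 2 ^ L := by gcongr
        _ = M := by rw [hMd, he]; ring
    have h3 : β ≤ 2 * L * 2 ^ q := by rw [hβd]; gcongr
    refine le_trans (b := ((4 * (2 * L * 2 ^ q) * n ^ 2 * r : ℕ) : ℝ)) ?_ (by exact_mod_cast h2)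
    push_cast
    gcongr
  -- the exponent in the union bound
  have hexp : ((e + 2) * r : ℝ) - 2 ^ q / 4 ≤ -5 := by
    have h1 : 32 * a ≤ 2 ^ a := by
      clear * - ha
      induction a, ha using Nat.le_induction with
      | base => norm_num
      | succ k hk ih => rw [pow_succ]; omega
    have h2 : (6 + a + 6 * L) * r * 4 + 20 ≤ 2 ^ a * r * L := by
      have hrL : 1 ≤ r * L := Nat.mul_pos hr (by omega)
      calc (6 + a + 6 * L) * r * 4 + 20 ≤ (6 * L + a * L + 6 * L) * r * 4 + 20 * (r * L) := by
            gcongr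
            · nlinarith
            · exact Nat.le_mul_of_pos_right _ (by omega)
            · nlinarith
        _ = (68 + 4 * a) * (r * L) := by ring
        _ ≤ 2 ^ a * (r * L) := by gcongr; omega
        _ = _ := by ring
    have h3 : (e + 2) * r * 4 + 20 ≤ 2 ^ q := by
      calc (e + 2) * r * 4 + 20 ≤ (6 + a + 6 * L) * r * 4 + 20 := by
            have : e + 2 ≤ 6 + a + 6 * L := by omega
            gcongr
        _ ≤ X := h2
        _ ≤ _ := hq1.le
    have h4 : ((e : ℝ) + 2) * r * 4 + 20 ≤ 2 ^ q := by exact_mod_cast h3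
    linarith
  have hsub : {z : Fin (t + 1) × Fin n → Bool | ∃ x : Fin r → ℝ,
      ‖sampleMap ℓ z (∑ k, x k • u k)‖ < ℓ (∑ k, x k • u k) /
        (4 * L * √(2 ^ (a + 1) * r * L))} ⊆
      ⋃ m : Fin r → Fin (2 * M + 1), {z | ‖sampleMap ℓ z (∑ k, (((m k : ℕ) : ℝ) / M - 1) • u k)‖ <
        ℓ (∑ k, (((m k : ℕ) : ℝ) / M - 1) • u k) / (2 * L * √(2 ^ q))} := by
    rintro z ⟨x, hx⟩
    rw [Set.mem_iUnion]
    by_contra! hall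
    have h1 := hℓ.le_norm_sampleMap_of_grid ht hu hcoord (M := M) (by positivity) hβ hMβ
      (by omega) z (fun m => not_lt.1 (hall m)) x
    refine absurd hx (not_lt.2 (le_trans ?_ h1))
    have h2 : √((2 : ℝ) ^ q) ≤ √(2 ^ (a + 1) * r * L) := by
      refine Real.sqrt_le_sqrt ?_
      calc (2 : ℝ) ^ q ≤ 2 * X := by exact_mod_cast hq2
        _ = _ := by rw [hX]; push_cast; ring
    have h3 : 2 * β ≤ 4 * L * √(2 ^ (a + 1) * r * L) := by
      calc 2 * β = 4 * L * √(2 ^ q) := by rw [hβd]; ring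
        _ ≤ _ := by gcongr
    gcongr
  calc _ ≤ _ := measureReal_mono hsub
    _ ≤ ∑ m : Fin r → Fin (2 * M + 1), _ := measureReal_iUnion_fintype_le _
    _ ≤ ∑ m : Fin r → Fin (2 * M + 1), Real.exp (-(2 ^ q) / 4) :=
        Finset.sum_le_sum fun m _ => hℓ.prob_norm_sampleMap_lt (by omega) hqt _
    _ = ((2 * M + 1 : ℕ) : ℝ) ^ r * Real.exp (-(2 ^ q) / 4) := by simp
    _ ≤ Real.exp ((e + 2) * r) * Real.exp (-(2 ^ q) / 4) := by
        gcongr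
        have h1 : ((2 * M + 1 : ℕ) : ℝ) ≤ 2 ^ (e + 2) := by
          have : 2 * M + 1 ≤ 2 ^ (e + 2) := by
            have : 1 ≤ M := Nat.one_le_two_pow
            rw [pow_add, ← hMd]
            omega
          exact_mod_cast this
        have h2 : (2 : ℝ) ≤ Real.exp 1 := by linarith [Real.add_one_le_exp (1 : ℝ)]
        calc _ ≤ ((2 : ℝ) ^ (e + 2)) ^ r := by gcongr
          _ ≤ (Real.exp 1 ^ (e + 2)) ^ r := by gcongr
          _ = _ := by
            rw [← pow_mul, ← Real.exp_nat_mul]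
            push_cast
            rw [mul_one]
    _ ≤ Real.exp (-5) := by
        rw [← Real.exp_add, Real.exp_le_exp]
        linarith
    _ ≤ 1 / 100 := by
        rw [Real.exp_neg, ← one_div]
        gcongr
        have h1 := Real.exp_one_gt_d9
        calc (100 : ℝ) ≤ 2.7182818283 ^ 5 := by norm_num
          _ ≤ Real.exp 1 ^ 5 := by gcongr
          _ = Real.exp 5 := by rw [← Real.exp_nat_mul]; norm_num

end Auerbach

/-! ### CountSketch -/

section CountSketch

open scoped RealInnerProductSpace

variable {ι : Type*} [Fintype ι] [DecidableEq ι] {m : ℕ}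

/-- The sign encoded by a bit. -/
def bitSign (b : Bool) : ℝ := if b then 1 else -1

lemma bitSign_not (b : Bool) : bitSign (!b) = -bitSign b := by cases b <;> simp [bitSign]

lemma bitSign_mul_self (b : Bool) : bitSign b * bitSign b = 1 := by cases b <;> simp [bitSign]

lemma uniformOn_univ_real_singleton {α : Type*} [Fintype α] [Nonempty α] [MeasurableSpace α]
    [MeasurableSingletonClass α] (a : α) :
    (uniformOn Set.univ : Measure α).real {a} = 1 / Fintype.card α := by
  rw [measureReal_def, uniformOn_univ, Measure.count_singleton]
  simp

/-- The law of the signs. -/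
noncomputable abbrev signLaw (ι : Type*) [Fintype ι] : Measure (ι → Bool) :=
  Measure.pi fun _ : ι => (uniformOn Set.univ : Measure Bool)

/-- The law of the hash function. -/
noncomputable abbrev hashLaw (ι : Type*) [Fintype ι] (m : ℕ) : Measure (ι → Fin m) :=
  Measure.pi fun _ : ι => (uniformOn Set.univ : Measure (Fin m))

lemma measurePreserving_not :
    MeasurePreserving not (uniformOn Set.univ : Measure Bool) (uniformOn Set.univ) := by
  refine ⟨Measurable.of_discrete, Measure.ext_of_singleton fun b => ?_⟩
  rw [Measure.map_apply Measurable.of_discrete (measurableSet_singleton b), uniformOn_univ,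
    uniformOn_univ, show not ⁻¹' {b} = {!b} by ext c; cases b <;> cases c <;> simp]
  simp

/-- Expectations of functions that are odd in one of the signs vanish. -/
lemma integral_eq_zero_of_flip (p : ι) (g : (ι → Bool) → ℝ)
    (hg : ∀ s, g (Function.update s p (!s p)) = -g s) : ∫ s, g s ∂signLaw ι = 0 := by
  have hmp : MeasurePreserving (fun (s : ι → Bool) i => (if i = p then not else id) (s i))
      (signLaw ι) (signLaw ι) := by
    refine measurePreserving_pi _ _ fun i => ?_
    split_ifs
    · exact measurePreserving_not
    · exact MeasurePreserving.id _
  have hfun : (fun (s : ι → Bool) i => (if i = p then not else id) (s i)) =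
      fun s => Function.update s p (!s p) := by
    funext s i
    by_cases h : i = p
    · subst h; simp
    · simp [h]
  rw [hfun] at hmp
  have h1 : ∫ s, g s ∂signLaw ι = -∫ s, g s ∂signLaw ι := by
    conv_lhs => rw [← hmp.map_eq]
    rw [integral_map Measurable.of_discrete.aemeasurable
      Measurable.of_discrete.aestronglyMeasurable, ← integral_neg]
    exact integral_congr_ae (Filter.Eventually.of_forall hg)
  linarith

lemma integral_four_signs {k l k' l' : ι} (hkl : k ≠ l)
    (h1 : ¬ (k' = k ∧ l' = l)) (h2 : ¬ (k' = l ∧ l' = k)) :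
    ∫ s : ι → Bool, (bitSign (s k) * bitSign (s l)) * (bitSign (s k') * bitSign (s l'))
      ∂signLaw ι = 0 := by
  by_cases hk : k' = k ∨ l' = k
  · have hl1 : k' ≠ l := by rintro rfl; rcases hk with h | h <;> simp_all
    have hl2 : l' ≠ l := by rintro rfl; rcases hk with h | h <;> simp_all
    refine integral_eq_zero_of_flip l _ fun s => ?_
    rw [Function.update_self, Function.update_of_ne hkl, Function.update_of_ne hl1,
      Function.update_of_ne hl2, bitSign_not]
    ring
  · push Not at hk
    refine integral_eq_zero_of_flip k _ fun s => ?_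
    rw [Function.update_self, Function.update_of_ne hkl.symm, Function.update_of_ne hk.1,
      Function.update_of_ne hk.2, bitSign_not]
    ring

/-- The second moment of a Rademacher chaos of order two. -/
lemma integral_chaos_sq_le (a : ι → ι → ℝ) (ha : ∀ k, a k k = 0) :
    ∫ s : ι → Bool, (∑ k, ∑ l, a k l * (bitSign (s k) * bitSign (s l))) ^ 2 ∂signLaw ι ≤
      2 * ∑ k, ∑ l, a k l ^ 2 := by
  have hsq : ∀ s : ι → Bool, (∑ k, ∑ l, a k l * (bitSign (s k) * bitSign (s l))) ^ 2 =
      ∑ p : ι × ι, ∑ p' : ι × ι, (a p.1 p.2 * a p'.1 p'.2) *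
        ((bitSign (s p.1) * bitSign (s p.2)) * (bitSign (s p'.1) * bitSign (s p'.2))) := by
    intro s
    rw [← Fintype.sum_prod_type' (f := fun k l => a k l * (bitSign (s k) * bitSign (s l))), sq,
      Finset.sum_mul_sum]
    exact Finset.sum_congr rfl fun p _ => Finset.sum_congr rfl fun p' _ => by ring
  simp_rw [hsq]
  rw [integral_finsetSum _ fun i _ => Integrable.of_finite]
  have hterm : ∀ p p' : ι × ι, ∫ s : ι → Bool, (a p.1 p.2 * a p'.1 p'.2) *
      ((bitSign (s p.1) * bitSign (s p.2)) * (bitSign (s p'.1) * bitSign (s p'.2))) ∂signLaw ι ≤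
      (if p' = p then a p.1 p.2 ^ 2 else 0) +
        (if p' = p.swap then (a p.1 p.2 ^ 2 + a p.2 p.1 ^ 2) / 2 else 0) := by
    rintro ⟨k, l⟩ ⟨k', l'⟩
    have hnn : 0 ≤ (if (k', l') = (k, l) then a k l ^ 2 else 0) +
        (if (k', l') = (k, l).swap then (a k l ^ 2 + a l k ^ 2) / 2 else 0) := by
      split_ifs <;> positivity
    simp only
    rw [integral_const_mul]
    by_cases hkl : k = l
    · refine le_trans (le_of_eq ?_) hnn
      subst hkl; rw [ha, zero_mul, zero_mul]
    by_cases hkl' : k' = l'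
    · subst hkl'; rw [ha, mul_zero, zero_mul]; exact hnn
    by_cases h1 : k' = k ∧ l' = l
    · obtain ⟨rfl, rfl⟩ := h1
      have : ∀ s : ι → Bool, (bitSign (s k') * bitSign (s l')) *
          (bitSign (s k') * bitSign (s l')) = 1 := fun s => by
        rw [mul_mul_mul_comm, bitSign_mul_self, bitSign_mul_self, one_mul]
      simp [this, hkl, sq]
    by_cases h2 : k' = l ∧ l' = k
    · obtain ⟨rfl, rfl⟩ := h2
      have : ∀ s : ι → Bool, (bitSign (s l') * bitSign (s k')) *
          (bitSign (s k') * bitSign (s l')) = 1 := fun s => by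
        rw [mul_comm (bitSign (s l')), mul_mul_mul_comm, bitSign_mul_self, bitSign_mul_self,
          one_mul]
      simp only [this, integral_const, probReal_univ, smul_eq_mul, mul_one, Prod.swap_prod_mk,
        if_true, Prod.mk.injEq, hkl', false_and, if_false, zero_add]
      nlinarith [sq_nonneg (a l' k' - a k' l')]
    rw [integral_four_signs hkl h1 h2, mul_zero]
    exact hnn
  calc _ ≤ ∑ p : ι × ι, ∑ p' : ι × ι, ((if p' = p then a p.1 p.2 ^ 2 else 0) +
        (if p' = p.swap then (a p.1 p.2 ^ 2 + a p.2 p.1 ^ 2) / 2 else 0)) := by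
        refine Finset.sum_le_sum fun p _ => ?_
        rw [integral_finsetSum _ fun i _ => Integrable.of_finite]
        exact Finset.sum_le_sum fun p' _ => hterm p p'
    _ = ∑ p : ι × ι, a p.1 p.2 ^ 2 + ∑ p : ι × ι, (a p.1 p.2 ^ 2 + a p.2 p.1 ^ 2) / 2 := by
        rw [← Finset.sum_add_distrib]
        refine Finset.sum_congr rfl fun p _ => ?_
        rw [Finset.sum_add_distrib]
        simp
    _ = 2 * ∑ p : ι × ι, a p.1 p.2 ^ 2 := by
        rw [← Finset.sum_div, Finset.sum_add_distrib,
          ← Equiv.sum_comp (Equiv.prodComm ι ι) (fun p : ι × ι => a p.2 p.1 ^ 2)]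
        simp only [Equiv.prodComm_apply, Prod.fst_swap, Prod.snd_swap]
        ring
    _ = _ := by rw [Fintype.sum_prod_type]

lemma integral_hash_collision [NeZero m] {k l : ι} (hkl : k ≠ l) :
    ∫ h : ι → Fin m, (if h k = h l then (1 : ℝ) else 0) ∂hashLaw ι m = 1 / m := by
  have h1 : ∀ h : ι → Fin m, (if h k = h l then (1 : ℝ) else 0) =
      ∑ b : Fin m, ∏ i, (if i ∈ ({k, l} : Finset ι) then (if h i = b then 1 else 0) else 1) := by
    intro h
    simp only [Finset.prod_ite_mem, Finset.univ_inter, Finset.prod_pair hkl]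
    simp [eq_comm]
  simp_rw [h1]
  rw [integral_finsetSum _ fun i _ => Integrable.of_finite]
  have h2 : ∀ b : Fin m, ∫ h : ι → Fin m,
      ∏ i, (if i ∈ ({k, l} : Finset ι) then (if h i = b then (1 : ℝ) else 0) else 1)
        ∂hashLaw ι m = 1 / m * (1 / m) := by
    intro b
    rw [integral_fintype_prod_eq_prod (f := fun i (x : Fin m) =>
      if i ∈ ({k, l} : Finset ι) then (if x = b then (1 : ℝ) else 0) else 1)]
    have h3 : ∀ i : ι, ∫ x : Fin m, (if i ∈ ({k, l} : Finset ι) then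
        (if x = b then (1 : ℝ) else 0) else 1) ∂(uniformOn Set.univ : Measure (Fin m)) =
        if i ∈ ({k, l} : Finset ι) then 1 / (m : ℝ) else 1 := by
      intro i
      split_ifs
      · have : (fun x : Fin m => if x = b then (1 : ℝ) else 0) =
            Set.indicator {b} (fun _ => 1) := by
          funext x; simp [Set.indicator_apply]
        rw [this, integral_indicator_const _ (measurableSet_singleton b),
          uniformOn_univ_real_singleton]
        simp
      · simp
    simp_rw [h3]
    rw [Finset.prod_ite_mem, Finset.univ_inter, Finset.prod_pair hkl]
  simp_rw [h2]
  have : (m : ℝ) ≠ 0 := by exact_mod_cast NeZero.ne m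
  simp
  field_simp

/-- Multiplication with the CountSketch matrix `Φ D`, for given signs and hash values. -/
noncomputable def countSketchMap (p : (ι → Bool) × (ι → Fin m)) :
    EuclideanSpace ℝ ι →ₗ[ℝ] EuclideanSpace ℝ (Fin m) where
  toFun v := WithLp.toLp 2 fun b => ∑ k, if p.2 k = b then bitSign (p.1 k) * v k else 0
  map_add' x y := by
    ext b
    simp only [PiLp.add_apply, ← Finset.sum_add_distrib]
    refine Finset.sum_congr rfl fun k _ => ?_
    split_ifs <;> simp [mul_add]
  map_smul' a x := by
    ext b
    simp only [PiLp.smul_apply, smul_eq_mul, RingHom.id_apply, Finset.mul_sum]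
    refine Finset.sum_congr rfl fun k _ => ?_
    split_ifs <;> simp [mul_left_comm]

/-- The error of CountSketch on an inner product is a Rademacher chaos supported on collisions. -/
lemma inner_countSketchMap_sub (p : (ι → Bool) × (ι → Fin m)) (u v : EuclideanSpace ℝ ι) :
    ⟪countSketchMap p u, countSketchMap p v⟫ - ⟪u, v⟫ =
      ∑ k, ∑ l, (if k ≠ l ∧ p.2 k = p.2 l then u k * v l else 0) *
        (bitSign (p.1 k) * bitSign (p.1 l)) := by
  have h1 : ⟪countSketchMap p u, countSketchMap p v⟫ =
      ∑ k, ∑ l, (if p.2 k = p.2 l then u k * v l else 0) *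
        (bitSign (p.1 k) * bitSign (p.1 l)) := by
    simp only [PiLp.inner_apply, countSketchMap, LinearMap.coe_mk, AddHom.coe_mk,
      RCLike.inner_apply, conj_trivial]
    have h2 : ∀ b : Fin m, (∑ k, if p.2 k = b then bitSign (p.1 k) * v k else 0) *
        (∑ k, if p.2 k = b then bitSign (p.1 k) * u k else 0) =
        ∑ k, ∑ l, if p.2 k = b then (if p.2 l = b then
          u k * v l * (bitSign (p.1 k) * bitSign (p.1 l)) else 0) else 0 := by
      intro b
      rw [mul_comm, Finset.sum_mul_sum]
      refine Finset.sum_congr rfl fun k _ => Finset.sum_congr rfl fun l _ => ?_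
      split_ifs <;> ring
    simp_rw [h2]
    rw [Finset.sum_comm]
    refine Finset.sum_congr rfl fun k _ => ?_
    rw [Finset.sum_comm]
    refine Finset.sum_congr rfl fun l _ => ?_
    simp [eq_comm]
  have h3 : ⟪u, v⟫ = ∑ k, ∑ l, (if k = l then u k * v l else 0) *
      (bitSign (p.1 k) * bitSign (p.1 l)) := by
    simp only [PiLp.inner_apply, RCLike.inner_apply, conj_trivial]
    refine Finset.sum_congr rfl fun k _ => ?_
    rw [Finset.sum_eq_single k]
    · simp [bitSign_mul_self, mul_comm]
    · intro l _ hl; simp [hl.symm]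
    · simp
  rw [h1, h3, ← Finset.sum_sub_distrib]
  refine Finset.sum_congr rfl fun k _ => ?_
  rw [← Finset.sum_sub_distrib]
  refine Finset.sum_congr rfl fun l _ => ?_
  by_cases hkl : k = l
  · subst hkl; simp
  · simp [hkl]

lemma integral_inner_countSketchMap_sub_sq_le [NeZero m] (u v : EuclideanSpace ℝ ι) :
    ∫ p, (⟪countSketchMap p u, countSketchMap p v⟫ - ⟪u, v⟫) ^ 2
      ∂((signLaw ι).prod (hashLaw ι m)) ≤ 2 / m * (‖u‖ ^ 2 * ‖v‖ ^ 2) := by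
  have hm : (0 : ℝ) < m := by exact_mod_cast Nat.pos_of_ne_zero (NeZero.ne m)
  rw [integral_prod_symm _ Integrable.of_finite]
  have h1 : ∀ h : ι → Fin m, ∫ s : ι → Bool,
      (⟪countSketchMap (s, h) u, countSketchMap (s, h) v⟫ - ⟪u, v⟫) ^ 2 ∂signLaw ι ≤
      2 * ∑ k, ∑ l, (if k ≠ l then u k ^ 2 * v l ^ 2 else 0) *
        (if h k = h l then 1 else 0) := by
    intro h
    simp_rw [inner_countSketchMap_sub]
    refine (integral_chaos_sq_le (fun k l => if k ≠ l ∧ h k = h l then u k * v l else 0)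
      (by simp)).trans (le_of_eq ?_)
    congr 1
    refine Finset.sum_congr rfl fun k _ => Finset.sum_congr rfl fun l _ => ?_
    by_cases h1 : k = l
    · simp [h1]
    · by_cases h2 : h k = h l <;> simp [h1, h2, mul_pow]
  calc _ ≤ ∫ h : ι → Fin m, 2 * ∑ k, ∑ l, (if k ≠ l then u k ^ 2 * v l ^ 2 else 0) *
        (if h k = h l then 1 else 0) ∂hashLaw ι m :=
        integral_mono Integrable.of_finite Integrable.of_finite h1
    _ = 2 * ∑ k, ∑ l, (if k ≠ l then u k ^ 2 * v l ^ 2 else 0) * (1 / m) := by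
        rw [integral_const_mul, integral_finsetSum _ fun i _ => Integrable.of_finite]
        congr 1
        refine Finset.sum_congr rfl fun k _ => ?_
        rw [integral_finsetSum _ fun i _ => Integrable.of_finite]
        refine Finset.sum_congr rfl fun l _ => ?_
        rw [integral_const_mul]
        by_cases hkl : k = l
        · simp [hkl]
        · rw [integral_hash_collision hkl]
    _ ≤ 2 * ∑ k, ∑ l, (u k ^ 2 * v l ^ 2) * (1 / m) := by
        gcongr with k _ l _
        split_ifs
        · exact le_rfl
        · positivity
    _ = _ := by
        rw [EuclideanSpace.real_norm_sq_eq, EuclideanSpace.real_norm_sq_eq, Finset.sum_mul_sum]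
        simp_rw [← Finset.sum_mul]
        ring

/-- CountSketch is a subspace embedding when the number of buckets is quadratic in the
dimension. -/
lemma prob_countSketchMap_distort [NeZero m] (W : Submodule ℝ (EuclideanSpace ℝ ι))
    (hm : 800 * Module.finrank ℝ W ^ 2 ≤ m) :
    ((signLaw ι).prod (hashLaw ι m)).real {p | ∃ v ∈ W,
      ‖countSketchMap p v‖ < 1 / 2 * ‖v‖ ∨ 2 * ‖v‖ < ‖countSketchMap p v‖} ≤ 1 / 100 := by
  set b := stdOrthonormalBasis ℝ W
  set r := Module.finrank ℝ W
  have hm0 : (0 : ℝ) < m := by exact_mod_cast Nat.pos_of_ne_zero (NeZero.ne m)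
  let X : (ι → Bool) × (ι → Fin m) → Fin r → Fin r → ℝ := fun p i j =>
    ⟪countSketchMap p (b i : EuclideanSpace ℝ ι), countSketchMap p (b j : EuclideanSpace ℝ ι)⟫ -
      ⟪(b i : EuclideanSpace ℝ ι), (b j : EuclideanSpace ℝ ι)⟫
  -- Markov's inequality for the squared Frobenius norm of the error of the Gram matrix
  have hmarkov := mul_meas_ge_le_integral_of_nonneg (μ := (signLaw ι).prod (hashLaw ι m))
    (f := fun p => ∑ i, ∑ j, X p i j ^ 2)
    (Filter.Eventually.of_forall fun z => by positivity) Integrable.of_finite (1 / 4)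
  have hint : ∫ p, ∑ i, ∑ j, X p i j ^ 2 ∂((signLaw ι).prod (hashLaw ι m)) ≤ 1 / 400 := by
    rw [integral_finsetSum _ fun i _ => Integrable.of_finite]
    calc _ ≤ ∑ i : Fin r, ∑ j : Fin r, 2 / (m : ℝ) := by
          refine Finset.sum_le_sum fun i _ => ?_
          rw [integral_finsetSum _ fun i _ => Integrable.of_finite]
          refine Finset.sum_le_sum fun j _ =>
            (integral_inner_countSketchMap_sub_sq_le _ _).trans (le_of_eq ?_)
          rw [← Submodule.coe_norm, ← Submodule.coe_norm, b.norm_eq_one, b.norm_eq_one]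
          ring
      _ = 2 * r ^ 2 / m := by simp; ring
      _ ≤ 1 / 400 := by
          rw [div_le_div_iff₀ hm0 (by norm_num)]
          have : (800 * r ^ 2 : ℝ) ≤ m := by exact_mod_cast hm
          linarith
  have hsub : {p : (ι → Bool) × (ι → Fin m) | ∃ v ∈ W,
      ‖countSketchMap p v‖ < 1 / 2 * ‖v‖ ∨ 2 * ‖v‖ < ‖countSketchMap p v‖} ⊆
      {p | 1 / 4 ≤ ∑ i, ∑ j, X p i j ^ 2} := by
    rintro p ⟨v, hv, hbad⟩
    by_contra hlt
    simp only [Set.mem_ofPred_eq, not_le] at hlt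
    let y : Fin r → ℝ := fun i => b.repr ⟨v, hv⟩ i
    have hvy : v = ∑ i, y i • (b i : EuclideanSpace ℝ ι) := by
      have := congrArg Subtype.val (b.sum_repr ⟨v, hv⟩)
      simpa using this.symm
    have hny : ‖v‖ ^ 2 = ∑ i, y i ^ 2 := by
      have h1 : ‖b.repr ⟨v, hv⟩‖ = ‖v‖ := by rw [b.repr.norm_map]; rfl
      rw [← h1, EuclideanSpace.real_norm_sq_eq]
    have hdiff : ‖countSketchMap p v‖ ^ 2 - ‖v‖ ^ 2 = ∑ q : Fin r × Fin r,
        (y q.1 * y q.2) * X p q.1 q.2 := by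
      rw [← real_inner_self_eq_norm_sq, ← real_inner_self_eq_norm_sq, Fintype.sum_prod_type]
      conv_lhs => rw [hvy]
      simp only [map_sum, map_smul, sum_inner, inner_sum, real_inner_smul_left,
        real_inner_smul_right, ← Finset.sum_sub_distrib, X]
      refine Finset.sum_congr rfl fun i _ => Finset.sum_congr rfl fun j _ => ?_
      rw [real_inner_comm (countSketchMap p (b i : EuclideanSpace ℝ ι)),
        real_inner_comm (b i : EuclideanSpace ℝ ι)]
      ring
    have hcs : (‖countSketchMap p v‖ ^ 2 - ‖v‖ ^ 2) ^ 2 ≤ (1 / 2 * ‖v‖ ^ 2) ^ 2 := by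
      rw [hdiff]
      refine (Finset.sum_mul_sq_le_sq_mul_sq _ _ _).trans ?_
      rw [Fintype.sum_prod_type, Fintype.sum_prod_type]
      have h1 : ∑ i, ∑ j, (y i * y j) ^ 2 = (‖v‖ ^ 2) ^ 2 := by
        rw [hny, sq (∑ i, y i ^ 2), Finset.sum_mul_sum]
        simp [mul_pow]
      simp only
      rw [h1]
      calc (‖v‖ ^ 2) ^ 2 * ∑ i, ∑ j, X p i j ^ 2 ≤ (‖v‖ ^ 2) ^ 2 * (1 / 4) := by gcongr
        _ = _ := by ring
    have habs := abs_le_of_sq_le_sq' hcs (by positivity)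
    rcases hbad with h | h
    · have := pow_lt_pow_left₀ h (norm_nonneg _) two_ne_zero
      nlinarith [sq_nonneg ‖v‖]
    · have := pow_lt_pow_left₀ h (by positivity) two_ne_zero
      nlinarith [sq_nonneg ‖v‖]
  have := measureReal_mono (μ := (signLaw ι).prod (hashLaw ι m)) hsub
  linarith

end CountSketch

/-! ### The Gaussian embedding -/

section Gaussian

open scoped RealInnerProductSpace

variable {m₁ m₂ : ℕ}

/-- The law of the Gaussian entries. -/
noncomputable abbrev gaussLaw (m₁ m₂ : ℕ) : Measure (Fin m₂ × Fin m₁ → ℝ) :=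
  Measure.pi fun _ : Fin m₂ × Fin m₁ => gaussianReal 0 1

lemma integral_exp_mul_sq_gaussianReal {c : ℝ} (hc : c < 1 / 2) :
    ∫ x, Real.exp (c * x ^ 2) ∂gaussianReal 0 1 = 1 / √(1 - 2 * c) := by
  rw [integral_gaussianReal_eq_integral_smul one_ne_zero]
  have h1 : ∀ x : ℝ, gaussianPDFReal 0 1 x • Real.exp (c * x ^ 2) =
      (√(2 * Real.pi))⁻¹ * Real.exp (-(1 / 2 - c) * x ^ 2) := by
    intro x
    rw [gaussianPDFReal, smul_eq_mul, mul_assoc, ← Real.exp_add]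
    simp only [NNReal.coe_one, mul_one, sub_zero]
    congr 2
    ring
  simp_rw [h1]
  rw [integral_const_mul, integral_gaussian, ← Real.sqrt_inv, ← Real.sqrt_mul (by positivity),
    one_div √(1 - 2 * c), ← Real.sqrt_inv]
  congr 1
  have h2 : 1 - 2 * c ≠ 0 := by linarith
  have h3 : 1 / 2 - c ≠ 0 := by linarith
  field_simp

lemma covariance_gaussLaw_eval (p p' : Fin m₂ × Fin m₁) :
    cov[fun g => g p, fun g => g p'; gaussLaw m₁ m₂] = if p = p' then 1 else 0 := by
  have hmp := fun q => measurePreserving_eval (fun _ : Fin m₂ × Fin m₁ => gaussianReal 0 1) q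
  have hmem : ∀ q : Fin m₂ × Fin m₁, MemLp (fun g : Fin m₂ × Fin m₁ → ℝ => g q) 2
      (gaussLaw m₁ m₂) := fun q =>
    (memLp_id_gaussianReal' (μ := 0) (v := 1) 2 (by simp)).comp_measurePreserving (hmp q)
  have hind : iIndepFun (fun (q : Fin m₂ × Fin m₁) (g : Fin m₂ × Fin m₁ → ℝ) => g q)
      (gaussLaw m₁ m₂) := iIndepFun_pi (X := fun _ => id) fun _ => aemeasurable_id
  split_ifs with h
  · subst h
    rw [covariance_self (measurable_pi_apply p).aemeasurable]
    have h1 := variance_map (μ := gaussLaw m₁ m₂) (X := fun x : ℝ => x)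
      (Y := fun g : Fin m₂ × Fin m₁ → ℝ => g p) aemeasurable_id'
      (measurable_pi_apply p).aemeasurable
    rw [show (gaussLaw m₁ m₂).map (fun g => g p) = gaussianReal 0 1 from (hmp p).map_eq,
      variance_fun_id_gaussianReal] at h1
    simpa [Function.comp_def] using h1.symm
  · exact (hind.indepFun h).covariance_eq_zero (hmem p) (hmem p')

/-- The entries of `G v` for a unit vector `v` are independent standard Gaussians. -/
lemma gaussLaw_rows {v : EuclideanSpace ℝ (Fin m₁)} (hv : ‖v‖ = 1) :
    iIndepFun (fun (a : Fin m₂) (g : Fin m₂ × Fin m₁ → ℝ) => ∑ b, g (a, b) * v b)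
      (gaussLaw m₁ m₂) ∧
    ∀ a : Fin m₂, (gaussLaw m₁ m₂).map (fun g => ∑ b, g (a, b) * v b) = gaussianReal 0 1 := by
  have hmp := fun q => measurePreserving_eval (fun _ : Fin m₂ × Fin m₁ => gaussianReal 0 1) q
  have hmem : ∀ q : Fin m₂ × Fin m₁, MemLp (fun g : Fin m₂ × Fin m₁ → ℝ => g q) 2
      (gaussLaw m₁ m₂) := fun q =>
    (memLp_id_gaussianReal' (μ := 0) (v := 1) 2 (by simp)).comp_measurePreserving (hmp q)
  have hind : iIndepFun (fun (q : Fin m₂ × Fin m₁) (g : Fin m₂ × Fin m₁ → ℝ) => g q)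
      (gaussLaw m₁ m₂) := iIndepFun_pi (X := fun _ => id) fun _ => aemeasurable_id
  have hg1 : ∀ q : Fin m₂ × Fin m₁,
      HasGaussianLaw (fun g : Fin m₂ × Fin m₁ → ℝ => g q) (gaussLaw m₁ m₂) := fun q =>
    ⟨by rw [show (gaussLaw m₁ m₂).map (fun g => g q) = gaussianReal 0 1 from (hmp q).map_eq]
        infer_instance⟩
  have hgauss := iIndepFun.hasGaussianLaw hg1 hind
  let T : (Fin m₂ × Fin m₁ → ℝ) →L[ℝ] (Fin m₂ → ℝ) :=
    ContinuousLinearMap.pi fun a => ∑ b, v b • ContinuousLinearMap.proj (a, b)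
  have hT : ∀ g a, T g a = ∑ b, g (a, b) * v b := by
    intro g a
    simp [T, mul_comm]
  have hX : HasGaussianLaw (fun (g : Fin m₂ × Fin m₁ → ℝ) (a : Fin m₂) =>
      ∑ b, g (a, b) * v b) (gaussLaw m₁ m₂) := by
    have := hgauss.map_fun T
    refine this.congr (Filter.Eventually.of_forall fun g => ?_)
    funext a
    exact (hT g a)
  have hcov : ∀ a a' : Fin m₂, cov[fun g => ∑ b, g (a, b) * v b,
      fun g => ∑ b, g (a', b) * v b; gaussLaw m₁ m₂] = if a = a' then 1 else 0 := by
    intro a a'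
    rw [covariance_fun_sum_fun_sum (X := fun b (g : Fin m₂ × Fin m₁ → ℝ) => g (a, b) * v b)
      (Y := fun b (g : Fin m₂ × Fin m₁ → ℝ) => g (a', b) * v b)
      (fun b => (hmem (a, b)).mul_const _) (fun b => (hmem (a', b)).mul_const _)]
    simp_rw [covariance_mul_const_left, covariance_mul_const_right, covariance_gaussLaw_eval]
    split_ifs with h
    · subst h
      have h1 : ‖v‖ ^ 2 = ∑ b, v b ^ 2 := EuclideanSpace.real_norm_sq_eq v
      rw [hv, one_pow] at h1
      refine Eq.trans ?_ h1.symm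
      refine Finset.sum_congr rfl fun b _ => ?_
      rw [Finset.sum_eq_single b]
      · simp [sq]
      · intro b' _ hb'; simp [hb'.symm]
      · simp
    · simp [h]
  refine ⟨hX.iIndepFun_of_covariance_eq_zero fun a a' haa' => ?_, fun a => ?_⟩
  · rw [hcov, if_neg haa']
  · have hmeas : Measurable fun g : Fin m₂ × Fin m₁ → ℝ => ∑ b, g (a, b) * v b := by fun_prop
    have hmean : ∫ g, ∑ b, g (a, b) * v b ∂gaussLaw m₁ m₂ = 0 := by
      rw [integral_finsetSum _ fun b _ => ((hmem (a, b)).mul_const _).integrable one_le_two]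
      refine Finset.sum_eq_zero fun b _ => ?_
      rw [integral_mul_const]
      have h1 := integral_comp_eval (μ := fun _ : Fin m₂ × Fin m₁ => gaussianReal 0 1)
        (i := (a, b)) (f := fun x => x) aestronglyMeasurable_id
      rw [h1, integral_id_gaussianReal, zero_mul]
    rw [(hX.eval a).map_eq_gaussianReal, hmean, ← covariance_self hmeas.aemeasurable, hcov]
    simp

/-- Multiplication with the normalized Gaussian matrix `(1 / √m₂) G`. -/
noncomputable def gaussMap (g : Fin m₂ × Fin m₁ → ℝ) :
    EuclideanSpace ℝ (Fin m₁) →ₗ[ℝ] EuclideanSpace ℝ (Fin m₂) where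
  toFun v := WithLp.toLp 2 fun a => 1 / √(m₂ : ℝ) * ∑ b, g (a, b) * v b
  map_add' x y := by
    ext a
    simp [mul_add, Finset.sum_add_distrib]
  map_smul' c x := by
    ext a
    simp only [PiLp.smul_apply, smul_eq_mul, RingHom.id_apply, Finset.mul_sum]
    exact Finset.sum_congr rfl fun b _ => by ring

lemma norm_gaussMap_sq (hm : 0 < m₂) (g : Fin m₂ × Fin m₁ → ℝ) (v : EuclideanSpace ℝ (Fin m₁)) :
    m₂ * ‖gaussMap g v‖ ^ 2 = ∑ a, (∑ b, g (a, b) * v b) ^ 2 := by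
  have hm' : (0 : ℝ) < m₂ := by exact_mod_cast hm
  rw [EuclideanSpace.real_norm_sq_eq, Finset.mul_sum]
  refine Finset.sum_congr rfl fun a _ => ?_
  simp only [gaussMap, LinearMap.coe_mk, AddHom.coe_mk, mul_pow, div_pow, Real.sq_sqrt hm'.le]
  field_simp

lemma integral_exp_norm_gaussMap_sq (hm : 0 < m₂) {v : EuclideanSpace ℝ (Fin m₁)} (hv : ‖v‖ = 1)
    {c : ℝ} (hc : c < 1 / 2) :
    ∫ g, Real.exp (c * (m₂ * ‖gaussMap g v‖ ^ 2)) ∂gaussLaw m₁ m₂ =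
      (1 / √(1 - 2 * c)) ^ m₂ := by
  obtain ⟨hind, hlaw⟩ := gaussLaw_rows (m₂ := m₂) hv
  have hmeas : ∀ a : Fin m₂, Measurable fun g : Fin m₂ × Fin m₁ → ℝ => ∑ b, g (a, b) * v b := by
    intro a; fun_prop
  have h1 : ∀ g : Fin m₂ × Fin m₁ → ℝ, Real.exp (c * (m₂ * ‖gaussMap g v‖ ^ 2)) =
      ∏ a, Real.exp (c * (∑ b, g (a, b) * v b) ^ 2) := by
    intro g
    rw [norm_gaussMap_sq hm, Finset.mul_sum, Real.exp_sum]
  simp_rw [h1]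
  have hf : Measurable fun x : ℝ => Real.exp (c * x ^ 2) := by fun_prop
  rw [hind.integral_fun_prod_comp (f := fun _ x => Real.exp (c * x ^ 2))
    (fun a => (hmeas a).aemeasurable) fun a => hf.aestronglyMeasurable]
  have h2 : ∀ a : Fin m₂, ∫ g, Real.exp (c * (∑ b, g (a, b) * v b) ^ 2) ∂gaussLaw m₁ m₂ =
      1 / √(1 - 2 * c) := by
    intro a
    rw [← integral_exp_mul_sq_gaussianReal hc, ← hlaw a,
      integral_map (hmeas a).aemeasurable hf.aestronglyMeasurable]
  simp [h2]

/-- The exponential Markov inequality; the sign of `c` selects the upper or the lower tail. -/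
lemma prob_norm_gaussMap_of_exp (hm : 0 < m₂) {v : EuclideanSpace ℝ (Fin m₁)} (hv : ‖v‖ = 1)
    {c : ℝ} (hc : c < 1 / 2) (ε : ℝ) :
    (gaussLaw m₁ m₂).real {g | c * ε ≤ c * ‖gaussMap g v‖ ^ 2} ≤
      (Real.exp (-(c * ε)) / √(1 - 2 * c)) ^ m₂ := by
  have hint := integral_exp_norm_gaussMap_sq hm hv hc
  have hpos : 0 < √(1 - 2 * c) := Real.sqrt_pos.2 (by linarith)
  -- the integral does not vanish, hence the integrand is integrable
  have hi : Integrable (fun g => Real.exp (c * (m₂ * ‖gaussMap g v‖ ^ 2))) (gaussLaw m₁ m₂) := by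
    by_contra h
    rw [integral_undef h] at hint
    exact absurd hint (by positivity)
  have hmarkov := mul_meas_ge_le_integral_of_nonneg (μ := gaussLaw m₁ m₂)
    (Filter.Eventually.of_forall fun g => (Real.exp_pos _).le) hi (Real.exp (m₂ * (c * ε)))
  rw [hint] at hmarkov
  have hset : {g : Fin m₂ × Fin m₁ → ℝ | c * ε ≤ c * ‖gaussMap g v‖ ^ 2} =
      {g | Real.exp (m₂ * (c * ε)) ≤ Real.exp (c * (m₂ * ‖gaussMap g v‖ ^ 2))} := by
    ext g
    have hm' : (0 : ℝ) < m₂ := by exact_mod_cast hm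
    simp only [Set.mem_ofPred_eq, Real.exp_le_exp]
    rw [mul_left_comm c, mul_le_mul_iff_right₀ hm']
  rw [hset]
  calc _ = Real.exp (-(m₂ * (c * ε))) * (Real.exp (m₂ * (c * ε)) * (gaussLaw m₁ m₂).real
        {g | Real.exp (m₂ * (c * ε)) ≤ Real.exp (c * (m₂ * ‖gaussMap g v‖ ^ 2))}) := by
        rw [← mul_assoc (Real.exp (-_)), ← Real.exp_add, neg_add_cancel, Real.exp_zero, one_mul]
    _ ≤ Real.exp (-(m₂ * (c * ε))) * (1 / √(1 - 2 * c)) ^ m₂ := by gcongr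
    _ = _ := by
        rw [div_pow, div_pow, one_pow, ← Real.exp_nat_mul, mul_neg, mul_one_div]

/-- Tail bounds for the chi-square distribution. -/
lemma prob_norm_gaussMap_unit (hm : 0 < m₂) {v : EuclideanSpace ℝ (Fin m₁)} (hv : ‖v‖ = 1) :
    (gaussLaw m₁ m₂).real {g | ‖gaussMap g v‖ < 1 / 2 ∨ 2 < ‖gaussMap g v‖} ≤
      2 * (3 / 4) ^ m₂ := by
  have hlow := prob_norm_gaussMap_of_exp hm hv (c := -1) (by norm_num) (1 / 4)
  have hupp := prob_norm_gaussMap_of_exp hm hv (c := 1 / 4) (by norm_num) 4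
  have he := Real.exp_one_lt_d9
  have he' := Real.exp_one_gt_d9
  have h1 : Real.exp (-(-1 * (1 / 4))) / √(1 - 2 * -1) ≤ 3 / 4 := by
    refine le_of_pow_le_pow_left₀ (n := 4) (by norm_num) (by norm_num) ?_
    rw [div_pow, ← Real.exp_nat_mul, show (√(1 - 2 * -1 : ℝ)) ^ 4 = (√(1 - 2 * -1 : ℝ) ^ 2) ^ 2 by
      ring, Real.sq_sqrt (by norm_num)]
    norm_num
    rw [div_le_iff₀ (by norm_num)]
    linarith
  have h2 : Real.exp (-(1 / 4 * 4)) / √(1 - 2 * (1 / 4)) ≤ 3 / 4 := by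
    refine le_of_pow_le_pow_left₀ (n := 2) (by norm_num) (by norm_num) ?_
    rw [div_pow, Real.sq_sqrt (by norm_num), ← Real.exp_nat_mul]
    have h3 : Real.exp (-2) ≤ 1 / 4 := by
      rw [Real.exp_neg, ← one_div]
      gcongr
      calc (4 : ℝ) ≤ 2.7182818283 ^ 2 := by norm_num
        _ ≤ Real.exp 1 ^ 2 := by gcongr
        _ = Real.exp 2 := by rw [← Real.exp_nat_mul]; norm_num
    norm_num
    rw [div_le_iff₀ (by norm_num)]
    linarith
  have hsub : {g : Fin m₂ × Fin m₁ → ℝ | ‖gaussMap g v‖ < 1 / 2 ∨ 2 < ‖gaussMap g v‖} ⊆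
      {g | (-1 : ℝ) * (1 / 4) ≤ -1 * ‖gaussMap g v‖ ^ 2} ∪
      {g | (1 / 4 : ℝ) * 4 ≤ 1 / 4 * ‖gaussMap g v‖ ^ 2} := by
    rintro g (hg | hg)
    · left
      simp only [Set.mem_ofPred_eq]
      nlinarith [norm_nonneg (gaussMap g v)]
    · right
      simp only [Set.mem_ofPred_eq]
      nlinarith
  calc _ ≤ _ := measureReal_mono hsub
    _ ≤ _ := measureReal_union_le _ _
    _ ≤ (3 / 4) ^ m₂ + (3 / 4) ^ m₂ := by
        refine add_le_add (hlow.trans ?_) (hupp.trans ?_)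
        · exact pow_le_pow_left₀ (by positivity) h1 _
        · exact pow_le_pow_left₀ (by positivity) h2 _
    _ = _ := by ring

/-- The volume bound for separated subsets of the unit ball. -/
lemma card_le_of_separated_of_norm_le_one {E : Type*} [NormedAddCommGroup E] [NormedSpace ℝ E]
    [FiniteDimensional ℝ E] (s : Finset E) (hs : ∀ c ∈ s, ‖c‖ ≤ 1)
    (h : ∀ c ∈ s, ∀ d ∈ s, c ≠ d → 1 / 16 ≤ ‖c - d‖) :
    s.card ≤ 33 ^ Module.finrank ℝ E := by
  borelize E
  let μ : Measure E := Measure.addHaar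
  have D : Set.Pairwise (s : Set E) (Function.onFun Disjoint fun c =>
      Metric.ball (c : E) (1 / 32)) := by
    rintro c hc d hd hcd
    apply Metric.ball_disjoint_ball
    rw [dist_eq_norm]
    linarith [h c hc d hd hcd]
  have A_subset : (⋃ c ∈ s, Metric.ball (c : E) (1 / 32)) ⊆ Metric.ball (0 : E) (33 / 32) := by
    refine Set.iUnion₂_subset fun x hx => Metric.ball_subset_ball' ?_
    rw [dist_zero_right]
    linarith [hs x hx]
  have I : (s.card : ENNReal) * ENNReal.ofReal ((1 / 32) ^ Module.finrank ℝ E) *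
      μ (Metric.ball 0 1) ≤
      ENNReal.ofReal ((33 / 32) ^ Module.finrank ℝ E) * μ (Metric.ball 0 1) := by
    calc _ = μ (⋃ c ∈ s, Metric.ball (c : E) (1 / 32)) := by
          rw [measure_biUnion_finset D fun c _ => measurableSet_ball]
          simp only [μ.addHaar_ball_of_pos _ (show (0 : ℝ) < 1 / 32 by norm_num),
            Finset.sum_const, nsmul_eq_mul, mul_assoc]
      _ ≤ μ (Metric.ball (0 : E) (33 / 32)) := measure_mono A_subset
      _ = _ := μ.addHaar_ball_of_pos _ (by norm_num)
  have J := (ENNReal.mul_le_mul_iff_left (Metric.measure_ball_pos μ (0 : E) zero_lt_one).ne'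
    measure_ball_lt_top.ne).1 I
  have K : (s.card : ℝ) ≤ (33 : ℝ) ^ Module.finrank ℝ E := by
    have := ENNReal.toReal_le_of_le_ofReal (by positivity) J
    rw [ENNReal.toReal_mul, ENNReal.toReal_natCast, ENNReal.toReal_ofReal (by positivity), div_pow,
      div_pow, one_pow, mul_one_div] at this
    exact (div_le_div_iff_of_pos_right (by positivity)).1 this
  exact mod_cast K

/-- A `1 / 16`-net of the unit sphere. -/
lemma exists_sphere_net (E : Type*) [NormedAddCommGroup E] [NormedSpace ℝ E]
    [FiniteDimensional ℝ E] :
    ∃ T : Finset E, (∀ c ∈ T, ‖c‖ = 1) ∧ T.card ≤ 33 ^ Module.finrank ℝ E ∧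
      ∀ v : E, ‖v‖ = 1 → ∃ c ∈ T, ‖v - c‖ ≤ 1 / 16 := by
  classical
  let P : Finset E → Prop := fun T => (∀ c ∈ T, ‖c‖ = 1) ∧
    ∀ c ∈ T, ∀ d ∈ T, c ≠ d → 1 / 16 ≤ ‖c - d‖
  have hcard : ∀ T, P T → T.card ≤ 33 ^ Module.finrank ℝ E := fun T hT =>
    card_le_of_separated_of_norm_le_one T (fun c hc => (hT.1 c hc).le) hT.2
  -- a separated set of maximal cardinality
  let S : Set ℕ := {k | ∃ T, P T ∧ T.card = k}
  have hSne : S.Nonempty := ⟨0, ∅, ⟨by simp, by simp⟩, rfl⟩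
  have hSb : BddAbove S := ⟨33 ^ Module.finrank ℝ E, by rintro k ⟨T, hT, rfl⟩; exact hcard T hT⟩
  obtain ⟨T, hT, hTc⟩ := Nat.sSup_mem hSne hSb
  refine ⟨T, hT.1, hcard T hT, fun v hv => ?_⟩
  by_contra! hfar
  have hvT : v ∉ T := fun h => by
    have := hfar v h
    rw [sub_self, norm_zero] at this
    norm_num at this
  have hins : P (insert v T) := by
    refine ⟨?_, ?_⟩
    · intro c hc
      rcases Finset.mem_insert.1 hc with rfl | hc
      · exact hv
      · exact hT.1 c hc
    · intro c hc d hd hcd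
      rcases Finset.mem_insert.1 hc with rfl | hc' <;>
        rcases Finset.mem_insert.1 hd with rfl | hd'
      · exact absurd rfl hcd
      · exact (hfar d hd').le
      · rw [norm_sub_rev]; exact (hfar c hc').le
      · exact hT.2 c hc' d hd' hcd
  have hmem : (insert v T).card ∈ S := ⟨_, hins, rfl⟩
  have := le_csSup hSb hmem
  rw [Finset.card_insert_of_notMem hvT, ← hTc] at this
  omega

lemma norm_apply_bounds_of_net {E F : Type*} [NormedAddCommGroup E] [NormedSpace ℝ E]
    [FiniteDimensional ℝ E] [NormedAddCommGroup F] [NormedSpace ℝ F] (f : E →ₗ[ℝ] F)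
    {T : Finset E} (hT : ∀ v : E, ‖v‖ = 1 → ∃ c ∈ T, ‖v - c‖ ≤ 1 / 16)
    (hf : ∀ c ∈ T, 1 / 2 ≤ ‖f c‖ ∧ ‖f c‖ ≤ 2) (v : E) :
    1 / 4 * ‖v‖ ≤ ‖f v‖ ∧ ‖f v‖ ≤ 4 * ‖v‖ := by
  set Γ := ‖LinearMap.toContinuousLinearMap f‖
  have hΓ : ∀ v, ‖f v‖ ≤ Γ * ‖v‖ := (LinearMap.toContinuousLinearMap f).le_opNorm
  have hΓ0 : 0 ≤ Γ := norm_nonneg _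
  have hunit : ∀ v : E, ‖v‖ = 1 → 1 / 2 - Γ / 16 ≤ ‖f v‖ ∧ ‖f v‖ ≤ 2 + Γ / 16 := by
    intro v hv
    obtain ⟨c, hc, hvc⟩ := hT v hv
    obtain ⟨h1, h2⟩ := hf c hc
    have h3 : ‖f (v - c)‖ ≤ Γ / 16 := (hΓ _).trans (by nlinarith)
    rw [map_sub] at h3
    have h4 := norm_sub_norm_le (f v) (f c)
    have h5 := norm_sub_norm_le (f c) (f v)
    rw [norm_sub_rev] at h5
    constructor <;> linarith
  have hscale : ∀ v : E, (1 / 2 - Γ / 16) * ‖v‖ ≤ ‖f v‖ ∧ ‖f v‖ ≤ (2 + Γ / 16) * ‖v‖ := by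
    intro v
    by_cases hv : v = 0
    · simp [hv]
    have hpos : 0 < ‖v‖ := norm_pos_iff.2 hv
    obtain ⟨h1, h2⟩ := hunit (‖v‖⁻¹ • v) (by
      rw [norm_smul, norm_inv, norm_norm, inv_mul_cancel₀ hpos.ne'])
    rw [map_smul, norm_smul, norm_inv, norm_norm] at h1 h2
    rw [inv_mul_eq_div, le_div_iff₀ hpos] at h1
    rw [inv_mul_eq_div, div_le_iff₀ hpos] at h2
    exact ⟨h1, h2⟩
  have hΓle : Γ ≤ 2 + Γ / 16 :=
    ContinuousLinearMap.opNorm_le_bound _ (by positivity) fun v => (hscale v).2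
  obtain ⟨h1, h2⟩ := hscale v
  have hv0 := norm_nonneg v
  constructor <;> nlinarith

/-- The Gaussian embedding is a subspace embedding when the number of rows is linear in the
dimension. -/
lemma prob_gaussMap_distort (W : Submodule ℝ (EuclideanSpace ℝ (Fin m₁))) {d : ℕ} (hd : 1 ≤ d)
    (hW : Module.finrank ℝ W ≤ d) (hm : 800 * d ≤ m₂) :
    (gaussLaw m₁ m₂).real {g | ∃ v ∈ W,
      ‖gaussMap g v‖ < 1 / 4 * ‖v‖ ∨ 4 * ‖v‖ < ‖gaussMap g v‖} ≤ 1 / 100 := by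
  obtain ⟨T, hT1, hTc, hTnet⟩ := exists_sphere_net W
  have hsub : {g : Fin m₂ × Fin m₁ → ℝ | ∃ v ∈ W,
      ‖gaussMap g v‖ < 1 / 4 * ‖v‖ ∨ 4 * ‖v‖ < ‖gaussMap g v‖} ⊆
      ⋃ c ∈ T, {g | ‖gaussMap g (c : EuclideanSpace ℝ (Fin m₁))‖ < 1 / 2 ∨
        2 < ‖gaussMap g (c : EuclideanSpace ℝ (Fin m₁))‖} := by
    rintro g ⟨v, hv, hbad⟩
    by_contra hgood
    simp only [Set.mem_iUnion, Set.mem_ofPred_eq, not_exists, not_or, not_lt] at hgood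
    have h := norm_apply_bounds_of_net ((gaussMap g).domRestrict W) hTnet
      (fun c hc => hgood c hc) ⟨v, hv⟩
    have h1 : 1 / 4 * ‖v‖ ≤ ‖gaussMap g v‖ := h.1
    have h2 : ‖gaussMap g v‖ ≤ 4 * ‖v‖ := h.2
    rcases hbad with h' | h' <;> linarith
  calc _ ≤ _ := measureReal_mono hsub (measure_ne_top _ _)
    _ ≤ ∑ c ∈ T, _ := measureReal_biUnion_finset_le _ _
    _ ≤ ∑ c ∈ T, 2 * (3 / 4 : ℝ) ^ m₂ := Finset.sum_le_sum fun c hc =>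
        prob_norm_gaussMap_unit (by omega) (hT1 c hc)
    _ = T.card * (2 * (3 / 4 : ℝ) ^ m₂) := by rw [Finset.sum_const, nsmul_eq_mul]
    _ ≤ 33 ^ d * (2 * ((3 / 4 : ℝ) ^ 40) ^ d) := by
        have h1 : (T.card : ℝ) ≤ 33 ^ d := by
          have : T.card ≤ 33 ^ d := hTc.trans (Nat.pow_le_pow_right (by norm_num) hW)
          exact_mod_cast this
        have h2 : (3 / 4 : ℝ) ^ m₂ ≤ ((3 / 4 : ℝ) ^ 40) ^ d := by
          rw [← pow_mul]
          exact pow_le_pow_of_le_one (by norm_num) (by norm_num) (by omega)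
        gcongr
    _ = 2 * (33 * (3 / 4 : ℝ) ^ 40) ^ d := by rw [mul_pow]; ring
    _ ≤ 2 * (1 / 200) ^ d := by gcongr; norm_num
    _ ≤ 2 * (1 / 200) ^ 1 := by
        gcongr 2 * ?_
        exact pow_le_pow_of_le_one (by norm_num) (by norm_num) hd
    _ = 1 / 100 := by norm_num

end Gaussian

/-! ### The program and its semantics -/

section Machine

/-- Started in memory `s`, the program `P` halts after at most `k` steps in a memory
satisfying `Q`. -/
def Runs (P : Program) (s : Memory) (k : ℕ) (Q : Memory → Prop) : Prop :=
  ∃ k' s', k' ≤ k ∧ Exec P s k' s' ∧ Q s'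

lemma Runs.mono {P : Program} {s : Memory} {k l : ℕ} {Q R : Memory → Prop} (h : Runs P s k Q)
    (hkl : k ≤ l) (hQR : ∀ s', Q s' → R s') : Runs P s l R := by
  obtain ⟨k', s', hk, he, hq⟩ := h
  exact ⟨k', s', hk.trans hkl, he, hQR _ hq⟩

lemma Runs.instr {i : Instr} {s : Memory} {Q : Memory → Prop} (h : Q (i.run s)) :
    Runs (.instr i) s 1 Q :=
  ⟨1, _, le_rfl, .instr i s, h⟩

lemma Runs.seq {P P' : Program} {s : Memory} {k l : ℕ} {Q : Memory → Prop}
    (h : Runs P s k fun s' => Runs P' s' l Q) : Runs (.seq P P') s (k + l) Q := by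
  obtain ⟨k', s', hk, he, l', s'', hl, he', hq⟩ := h
  exact ⟨k' + l', s'', add_le_add hk hl, .seq he he', hq⟩

/-- A sequence of elementary instructions followed by a program. -/
def Program.block (l : List Instr) (P : Program) : Program :=
  l.foldr (fun i Q => .seq (.instr i) Q) P

lemma Runs.block {l : List Instr} {P : Program} {s : Memory} {k : ℕ} {Q : Memory → Prop}
    (h : Runs P (l.foldl (fun s i => i.run s) s) k Q) :
    Runs (.block l P) s (l.length + k) Q := by
  induction l generalizing s with
  | nil => simpa [Program.block] using h
  | cons i l ih =>
    have := Runs.seq (Runs.instr (i := i) (s := s) (Q := fun s' => Runs (.block l P) s' _ Q)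
      (ih h))
    exact this.mono (by simp only [List.length_cons]; omega) fun _ h => h

/-- Rule for a loop whose counter runs from `lo` up to `hi`. -/
lemma Runs.while {x y : ℕ} {P : Program} {lo hi : ℕ} (J : ℕ → Memory → Prop) (f : ℕ → ℕ)
    (hJ : ∀ q s, J q s → s.w x = q ∧ s.w y = hi)
    (hbody : ∀ q s, lo ≤ q → q < hi → J q s → Runs P s (f q) (J (q + 1)))
    {s : Memory} (hs : J lo s) :
    Runs (.whileLt x y P) s (∑ q ∈ Finset.Ico lo hi, (f q + 1) + 1) (J (max lo hi)) := by
  have key : ∀ m q s, lo ≤ q → hi - q = m → J q s → Runs (.whileLt x y P) s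
      (∑ q ∈ Finset.Ico q hi, (f q + 1) + 1) (J (max q hi)) := by
    intro m
    induction m with
    | zero =>
      intro q s _ hm hq
      have h := hJ q s hq
      refine ⟨1, s, by omega, .whileFalse (by omega), ?_⟩
      rwa [max_eq_left (by omega)]
    | succ m ih =>
      intro q s hlo hm hq
      have h := hJ q s hq
      have hlt : q < hi := by omega
      obtain ⟨k, s', hk, he, hq'⟩ := hbody q s hlo hlt hq
      obtain ⟨k', s'', hk', he', hq''⟩ := ih (q + 1) s' (by omega) (by omega) hq'
      refine ⟨k + k' + 1, s'', ?_, .whileTrue (by omega) he he', ?_⟩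
      · rw [Finset.sum_eq_sum_Ico_succ_bot hlt]
        omega
      · rw [max_eq_right hlt.le]
        rwa [max_eq_right (by omega)] at hq''
  exact key _ lo s le_rfl rfl hs

lemma Ico_max_right (lo hi : ℕ) : Finset.Ico lo (max lo hi) = Finset.Ico lo hi := by
  ext q
  simp only [Finset.mem_Ico]
  omega

/-- Add the multiple `r₂` of a column of `Φ D` to the array `5`. -/
def addColumnLoop : Program :=
  .whileLt 15 16 (.block [.loadW 17 5 15, .loadR 3 2 15, .mulR 3 2 3, .loadR 4 5 17, .addR 4 4 3,
    .storeR 5 17 4] (.instr (.addW 15 15 6)))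

lemma runs_addColumnLoop (s : Memory) (h6 : s.w 6 = 1) :
    Runs addColumnLoop s (8 * (s.w 16 - s.w 15) + 1) fun s' =>
      s'.W = s.W ∧ (∀ a, a ≠ 5 → s'.R a = s.R a) ∧
      (∀ b, s'.R 5 b = s.R 5 b + ∑ q ∈ Finset.Ico (s.w 15) (s.w 16),
        if s.W 5 q = b then s.r 2 * s.R 2 q else 0) ∧
      (∀ i, i ≠ 15 → i ≠ 17 → s'.w i = s.w i) ∧ (∀ i, i ≠ 3 → i ≠ 4 → s'.r i = s.r i) := by
  let J : ℕ → Memory → Prop := fun q s' => s'.w 15 = q ∧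
      s'.W = s.W ∧ (∀ a, a ≠ 5 → s'.R a = s.R a) ∧
      (∀ b, s'.R 5 b = s.R 5 b + ∑ q ∈ Finset.Ico (s.w 15) q,
        if s.W 5 q = b then s.r 2 * s.R 2 q else 0) ∧
      (∀ i, i ≠ 15 → i ≠ 17 → s'.w i = s.w i) ∧ (∀ i, i ≠ 3 → i ≠ 4 → s'.r i = s.r i)
  have hJ : ∀ q s', J q s' → s'.w 15 = q ∧ s'.w 16 = s.w 16 := by
    rintro q s' ⟨h1, -, -, -, h5, -⟩
    exact ⟨h1, h5 16 (by norm_num) (by norm_num)⟩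
  have hbody : ∀ q s', s.w 15 ≤ q → q < s.w 16 → J q s' →
      Runs (.block [.loadW 17 5 15, .loadR 3 2 15, .mulR 3 2 3, .loadR 4 5 17, .addR 4 4 3,
        .storeR 5 17 4] (.instr (.addW 15 15 6))) s' 7 (J (q + 1)) := by
    rintro q s' hlo - ⟨h1, h2, h3, h4, h5, h6'⟩
    refine Runs.block (k := 1) (Runs.instr ?_)
    have e6 : s'.w 6 = 1 := by rw [h5 6 (by norm_num) (by norm_num), h6]
    have e2 : s'.r 2 = s.r 2 := h6' 2 (by norm_num) (by norm_num)
    have eR : s'.R 2 = s.R 2 := h3 2 (by norm_num)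
    refine ⟨?_, ?_, ?_, ?_, ?_, ?_⟩
    · simp [Instr.run, h1, e6]
    · simp [Instr.run, h2]
    · intro a ha
      simp [Instr.run, ha, h3 a ha]
    · intro b
      rw [Finset.sum_Ico_succ_top hlo, ← add_assoc, ← h4 b]
      by_cases hb : s.W 5 q = b
      · subst hb
        simp [Instr.run, h1, h2, e2, eR]
      · simp [Instr.run, h1, h2, hb, Function.update_of_ne (Ne.symm hb)]
    · intro i hi hi'
      simp [Instr.run, hi, hi', h5 i hi hi']
    · intro i hi hi'
      simp [Instr.run, hi, hi', h6' i hi hi']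
  have h0 : J (s.w 15) s := ⟨rfl, rfl, fun _ _ => rfl, by simp, fun _ _ _ => rfl, fun _ _ _ => rfl⟩
  refine (Runs.while J (fun _ => 7) hJ hbody h0).mono ?_ ?_
  · simp only [Finset.sum_const, Nat.card_Ico, smul_eq_mul]
    omega
  · rintro s' ⟨-, h2, h3, h4, h5, h6'⟩
    rw [Ico_max_right] at h4
    exact ⟨h2, h3, h4, h5, h6'⟩

/-- Add the multiple `r₁` of a column of `Φ D D̃` to the array `5`. -/
def addSampledLoop : Program :=
  .whileLt 12 13 (.block [.loadW 14 3 12, .loadR 2 1 12, .mulR 2 1 2, .loadW 15 4 14,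
    .addW 21 14 6, .loadW 16 4 21] (.seq addColumnLoop (.instr (.addW 12 12 6))))

lemma runs_addSampledLoop (s : Memory) (h6 : s.w 6 = 1) :
    Runs addSampledLoop s (∑ q ∈ Finset.Ico (s.w 12) (s.w 13),
        (9 + 8 * (s.W 4 (s.W 3 q + 1) - s.W 4 (s.W 3 q))) + 1) fun s' =>
      s'.W = s.W ∧ (∀ a, a ≠ 5 → s'.R a = s.R a) ∧
      (∀ b, s'.R 5 b = s.R 5 b + ∑ q ∈ Finset.Ico (s.w 12) (s.w 13),
        ∑ q' ∈ Finset.Ico (s.W 4 (s.W 3 q)) (s.W 4 (s.W 3 q + 1)),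
          if s.W 5 q' = b then s.r 1 * s.R 1 q * s.R 2 q' else 0) ∧
      (∀ i, i < 12 → s'.w i = s.w i) ∧ s'.w 13 = s.w 13 ∧ (∀ i, i < 2 → s'.r i = s.r i) := by
  let J : ℕ → Memory → Prop := fun q s' => s'.w 12 = q ∧
      s'.W = s.W ∧ (∀ a, a ≠ 5 → s'.R a = s.R a) ∧
      (∀ b, s'.R 5 b = s.R 5 b + ∑ q ∈ Finset.Ico (s.w 12) q,
        ∑ q' ∈ Finset.Ico (s.W 4 (s.W 3 q)) (s.W 4 (s.W 3 q + 1)),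
          if s.W 5 q' = b then s.r 1 * s.R 1 q * s.R 2 q' else 0) ∧
      (∀ i, i < 12 → s'.w i = s.w i) ∧ s'.w 13 = s.w 13 ∧ (∀ i, i < 2 → s'.r i = s.r i)
  have hJ : ∀ q s', J q s' → s'.w 12 = q ∧ s'.w 13 = s.w 13 := by
    rintro q s' ⟨h1, -, -, -, -, h5, -⟩
    exact ⟨h1, h5⟩
  have hbody : ∀ q s', s.w 12 ≤ q → q < s.w 13 → J q s' →
      Runs (.block [.loadW 14 3 12, .loadR 2 1 12, .mulR 2 1 2, .loadW 15 4 14,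
        .addW 21 14 6, .loadW 16 4 21] (.seq addColumnLoop (.instr (.addW 12 12 6)))) s'
        (8 + 8 * (s.W 4 (s.W 3 q + 1) - s.W 4 (s.W 3 q))) (J (q + 1)) := by
    rintro q s' hlo - ⟨h1, h2, h3, h4, h5, h13, h6'⟩
    have e6 : s'.w 6 = 1 := by rw [h5 6 (by norm_num), h6]
    have e1 : s'.r 1 = s.r 1 := h6' 1 (by norm_num)
    have eR1 : s'.R 1 = s.R 1 := h3 1 (by norm_num)
    have eR2 : s'.R 2 = s.R 2 := h3 2 (by norm_num)
    refine (Runs.block (k := (8 * (s.W 4 (s.W 3 q + 1) - s.W 4 (s.W 3 q)) + 1) + 1)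
      (Runs.seq ?_)).mono (by simp only [List.length]; omega) fun _ h => h
    generalize hs1 : List.foldl (fun s i => Instr.run i s) s' _ = s1
    have a15 : s1.w 15 = s.W 4 (s.W 3 q) := by simp [← hs1, Instr.run, h1, h2]
    have a16 : s1.w 16 = s.W 4 (s.W 3 q + 1) := by simp [← hs1, Instr.run, h1, h2, e6]
    have ar : s1.r 2 = s.r 1 * s.R 1 q := by simp [← hs1, Instr.run, h1, e1, eR1]
    have aW : s1.W = s.W := by simp [← hs1, Instr.run, h2]
    have aR : s1.R = s'.R := by simp [← hs1, Instr.run]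
    have aw : ∀ i, i < 14 → s1.w i = s'.w i := by
      intro i hi
      have i1 : i ≠ 14 := by omega
      have i2 : i ≠ 15 := by omega
      have i3 : i ≠ 16 := by omega
      have i4 : i ≠ 21 := by omega
      simp [← hs1, Instr.run, i1, i2, i3, i4]
    have ar' : ∀ i, i < 2 → s1.r i = s'.r i := by
      intro i hi
      have i1 : i ≠ 2 := by omega
      simp [← hs1, Instr.run, i1]
    have hrun := runs_addColumnLoop s1 (by rw [aw 6 (by norm_num), e6])
    rw [a15, a16] at hrun
    refine hrun.mono le_rfl ?_
    rintro s2 ⟨b1, b2, b3, b4, b5⟩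
    refine Runs.instr ⟨?_, ?_, ?_, ?_, ?_, ?_, ?_⟩
    · simp [Instr.run, b4, aw, h1, e6]
    · simp [Instr.run, b1, aW]
    · intro a ha
      simp [Instr.run, b2 a ha, aR, h3 a ha]
    · intro b
      rw [Finset.sum_Ico_succ_top hlo, ← add_assoc, ← h4 b]
      simp only [Instr.run]
      rw [b3 b, aR, aW, ar, eR2]
    · intro i hi
      have i1 : i ≠ 15 := by omega
      have i2 : i ≠ 17 := by omega
      have i3 : i ≠ 12 := by omega
      simp [Instr.run, i3, b4 i i1 i2, aw i (by omega), h5 i hi]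
    · simp [Instr.run, b4, aw, h13]
    · intro i hi
      simp [Instr.run, b5 i (by omega) (by omega), ar' i hi, h6' i hi]
  have h0 : J (s.w 12) s := ⟨rfl, rfl, fun _ _ => rfl, by simp, fun _ _ => rfl, rfl,
    fun _ _ => rfl⟩
  refine (Runs.while J _ hJ hbody h0).mono ?_ ?_
  · refine Nat.add_le_add_right (Finset.sum_le_sum fun q _ => ?_) 1
    omega
  · rintro s' ⟨-, h2, h3, h4, h5, h6'⟩
    rw [Ico_max_right] at h4
    exact ⟨h2, h3, h4, h5, h6'⟩

/-- The number of steps for adding a multiple of the column `j` of `Φ D D̃`. -/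
def sampledCost (W : ℕ → ℕ → ℕ) (j : ℕ) : ℕ :=
  ∑ q ∈ Finset.Ico (W 2 j) (W 2 (j + 1)), (9 + 8 * (W 4 (W 3 q + 1) - W 4 (W 3 q))) + 1

/-- The entry `b` of the column `j` of `Φ D D̃`, as it is read off from the memory. -/
noncomputable def sampledEntry (W : ℕ → ℕ → ℕ) (R : ℕ → ℕ → ℝ) (j b : ℕ) : ℝ :=
  ∑ q ∈ Finset.Ico (W 2 j) (W 2 (j + 1)),
    ∑ q' ∈ Finset.Ico (W 4 (W 3 q)) (W 4 (W 3 q + 1)), if W 5 q' = b then R 1 q * R 2 q' else 0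

/-- Add a column of `Φ D D̃ A` to the array `5`. -/
def addProductLoop : Program :=
  .whileLt 9 10 (.block [.loadW 11 1 9, .loadR 1 0 9, .loadW 12 2 11, .addW 21 11 6,
    .loadW 13 2 21] (.seq addSampledLoop (.instr (.addW 9 9 6))))

lemma runs_addProductLoop (s : Memory) (h6 : s.w 6 = 1) :
    Runs addProductLoop s (∑ q ∈ Finset.Ico (s.w 9) (s.w 10),
        (7 + sampledCost s.W (s.W 1 q)) + 1) fun s' =>
      s'.W = s.W ∧ (∀ a, a ≠ 5 → s'.R a = s.R a) ∧
      (∀ b, s'.R 5 b = s.R 5 b + ∑ q ∈ Finset.Ico (s.w 9) (s.w 10),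
        s.R 0 q * sampledEntry s.W s.R (s.W 1 q) b) ∧
      (∀ i, i < 9 → s'.w i = s.w i) ∧ s'.w 10 = s.w 10 := by
  let J : ℕ → Memory → Prop := fun q s' => s'.w 9 = q ∧
      s'.W = s.W ∧ (∀ a, a ≠ 5 → s'.R a = s.R a) ∧
      (∀ b, s'.R 5 b = s.R 5 b + ∑ q ∈ Finset.Ico (s.w 9) q,
        s.R 0 q * sampledEntry s.W s.R (s.W 1 q) b) ∧
      (∀ i, i < 9 → s'.w i = s.w i) ∧ s'.w 10 = s.w 10
  have hJ : ∀ q s', J q s' → s'.w 9 = q ∧ s'.w 10 = s.w 10 := by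
    rintro q s' ⟨h1, -, -, -, -, h5⟩
    exact ⟨h1, h5⟩
  have hbody : ∀ q s', s.w 9 ≤ q → q < s.w 10 → J q s' →
      Runs (.block [.loadW 11 1 9, .loadR 1 0 9, .loadW 12 2 11, .addW 21 11 6,
        .loadW 13 2 21] (.seq addSampledLoop (.instr (.addW 9 9 6)))) s'
        (6 + sampledCost s.W (s.W 1 q)) (J (q + 1)) := by
    rintro q s' hlo - ⟨h1, h2, h3, h4, h5, h10⟩
    have e6 : s'.w 6 = 1 := by rw [h5 6 (by norm_num), h6]
    have eR0 : s'.R 0 = s.R 0 := h3 0 (by norm_num)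
    have eR1 : s'.R 1 = s.R 1 := h3 1 (by norm_num)
    have eR2 : s'.R 2 = s.R 2 := h3 2 (by norm_num)
    refine (Runs.block (k := sampledCost s.W (s.W 1 q) + 1)
      (Runs.seq ?_)).mono (by simp only [List.length]; omega) fun _ h => h
    generalize hs1 : List.foldl (fun s i => Instr.run i s) s' _ = s1
    have a12 : s1.w 12 = s.W 2 (s.W 1 q) := by simp [← hs1, Instr.run, h1, h2]
    have a13 : s1.w 13 = s.W 2 (s.W 1 q + 1) := by simp [← hs1, Instr.run, h1, h2, e6]
    have ar : s1.r 1 = s.R 0 q := by simp [← hs1, Instr.run, h1, eR0]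
    have aW : s1.W = s.W := by simp [← hs1, Instr.run, h2]
    have aR : s1.R = s'.R := by simp [← hs1, Instr.run]
    have aw : ∀ i, i < 11 → s1.w i = s'.w i := by
      intro i hi
      have i1 : i ≠ 11 := by omega
      have i2 : i ≠ 12 := by omega
      have i3 : i ≠ 13 := by omega
      have i4 : i ≠ 21 := by omega
      simp [← hs1, Instr.run, i1, i2, i3, i4]
    have hrun := runs_addSampledLoop s1 (by rw [aw 6 (by norm_num), e6])
    rw [a12, a13, aW] at hrun
    refine hrun.mono le_rfl ?_
    rintro s2 ⟨b1, b2, b3, b4, -, -⟩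
    refine Runs.instr ⟨?_, ?_, ?_, ?_, ?_, ?_⟩
    · simp [Instr.run, b4, aw, h1, e6]
    · simp [Instr.run, b1]
    · intro a ha
      simp [Instr.run, b2 a ha, aR, h3 a ha]
    · intro b
      rw [Finset.sum_Ico_succ_top hlo, ← add_assoc, ← h4 b]
      simp only [Instr.run]
      rw [b3 b, aR, ar, eR1, eR2, sampledEntry, Finset.mul_sum]
      congr 1
      refine Finset.sum_congr rfl fun q' _ => ?_
      rw [Finset.mul_sum]
      refine Finset.sum_congr rfl fun q'' _ => ?_
      split_ifs <;> ring
    · intro i hi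
      have i3 : i ≠ 9 := by omega
      simp [Instr.run, i3, b4 i (by omega), aw i (by omega), h5 i hi]
    · simp [Instr.run, b4, aw, h10]
  have h0 : J (s.w 9) s := ⟨rfl, rfl, fun _ _ => rfl, by simp, fun _ _ => rfl, rfl⟩
  refine (Runs.while J _ hJ hbody h0).mono ?_ ?_
  · refine Nat.add_le_add_right (Finset.sum_le_sum fun q _ => ?_) 1
    omega
  · rintro s' ⟨-, h2, h3, h4, h5, h6'⟩
    rw [Ico_max_right] at h4
    exact ⟨h2, h3, h4, h5, h6'⟩

/-- Set the first `m₁` cells of the array `5` to `r₀`. -/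
def clearLoop : Program := .whileLt 8 3 (.block [.storeR 5 8 0] (.instr (.addW 8 8 6)))

lemma runs_clearLoop (s : Memory) (h6 : s.w 6 = 1) (h8 : s.w 8 = 0) :
    Runs clearLoop s (3 * s.w 3 + 1) fun s' =>
      s'.W = s.W ∧ (∀ a, a ≠ 5 → s'.R a = s.R a) ∧ (∀ b < s.w 3, s'.R 5 b = s.r 0) ∧
      (∀ i, i ≠ 8 → s'.w i = s.w i) ∧ s'.r = s.r := by
  let J : ℕ → Memory → Prop := fun q s' => s'.w 8 = q ∧
      s'.W = s.W ∧ (∀ a, a ≠ 5 → s'.R a = s.R a) ∧ (∀ b < q, s'.R 5 b = s.r 0) ∧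
      (∀ i, i ≠ 8 → s'.w i = s.w i) ∧ s'.r = s.r
  have hJ : ∀ q s', J q s' → s'.w 8 = q ∧ s'.w 3 = s.w 3 := by
    rintro q s' ⟨h1, -, -, -, h5, -⟩
    exact ⟨h1, h5 3 (by norm_num)⟩
  have hbody : ∀ q s', 0 ≤ q → q < s.w 3 → J q s' →
      Runs (.block [.storeR 5 8 0] (.instr (.addW 8 8 6))) s' 2 (J (q + 1)) := by
    rintro q s' - - ⟨h1, h2, h3, h4, h5, h6'⟩
    have e6 : s'.w 6 = 1 := by rw [h5 6 (by norm_num), h6]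
    refine Runs.block (k := 1) (Runs.instr ⟨?_, ?_, ?_, ?_, ?_, ?_⟩)
    · simp [Instr.run, h1, e6]
    · simp [Instr.run, h2]
    · intro a ha
      simp [Instr.run, ha, h3 a ha]
    · intro b hb
      by_cases hbq : b = q
      · subst hbq; simp [Instr.run, h1, h6']
      · simp [Instr.run, h1, Function.update_of_ne hbq, h4 b (by omega)]
    · intro i hi
      simp [Instr.run, hi, h5 i hi]
    · simp [Instr.run, h6']
  have h0 : J 0 s := ⟨h8, rfl, fun _ _ => rfl, by simp, fun _ _ => rfl, rfl⟩
  refine (Runs.while J (fun _ => 2) hJ hbody h0).mono ?_ ?_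
  · simp only [Finset.sum_const, Nat.card_Ico, smul_eq_mul]
    omega
  · rintro s' ⟨-, h2, h3, h4, h5, h6'⟩
    exact ⟨h2, h3, fun b hb => h4 b (hb.trans_le (le_max_right _ _)), h5, h6'⟩

/-- Add the inner product of a row of `G` with the array `5` to `r₂`. -/
def dotLoop : Program :=
  .whileLt 8 3 (.block [.loadR 3 3 19, .loadR 4 5 8, .mulR 3 3 4, .addR 2 2 3, .addW 19 19 6]
    (.instr (.addW 8 8 6)))

lemma runs_dotLoop (s : Memory) (h6 : s.w 6 = 1) (h8 : s.w 8 = 0) :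
    Runs dotLoop s (7 * s.w 3 + 1) fun s' =>
      s'.W = s.W ∧ s'.R = s.R ∧
      s'.r 2 = s.r 2 + ∑ b ∈ Finset.range (s.w 3), s.R 3 (s.w 19 + b) * s.R 5 b ∧
      s'.w 19 = s.w 19 + s.w 3 ∧ (∀ i, i ≠ 8 → i ≠ 19 → s'.w i = s.w i) := by
  let J : ℕ → Memory → Prop := fun q s' => s'.w 8 = q ∧
      s'.W = s.W ∧ s'.R = s.R ∧
      s'.r 2 = s.r 2 + ∑ b ∈ Finset.range q, s.R 3 (s.w 19 + b) * s.R 5 b ∧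
      s'.w 19 = s.w 19 + q ∧ (∀ i, i ≠ 8 → i ≠ 19 → s'.w i = s.w i)
  have hJ : ∀ q s', J q s' → s'.w 8 = q ∧ s'.w 3 = s.w 3 := by
    rintro q s' ⟨h1, -, -, -, -, h5⟩
    exact ⟨h1, h5 3 (by norm_num) (by norm_num)⟩
  have hbody : ∀ q s', 0 ≤ q → q < s.w 3 → J q s' →
      Runs (.block [.loadR 3 3 19, .loadR 4 5 8, .mulR 3 3 4, .addR 2 2 3, .addW 19 19 6]
        (.instr (.addW 8 8 6))) s' 6 (J (q + 1)) := by
    rintro q s' - - ⟨h1, h2, h3, h4, h19, h5⟩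
    have e6 : s'.w 6 = 1 := by rw [h5 6 (by norm_num) (by norm_num), h6]
    refine Runs.block (k := 1) (Runs.instr ⟨?_, ?_, ?_, ?_, ?_, ?_⟩)
    · simp [Instr.run, h1, e6]
    · simp [Instr.run, h2]
    · simp [Instr.run, h3]
    · rw [Finset.sum_range_succ, ← add_assoc, ← h4]
      simp [Instr.run, h1, h3, h19]
    · simp [Instr.run, h19, e6, add_assoc]
    · intro i hi hi'
      simp [Instr.run, hi, hi', h5 i hi hi']
  have h0 : J 0 s := ⟨h8, rfl, rfl, by simp, rfl, fun _ _ _ => rfl⟩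
  refine (Runs.while J (fun _ => 6) hJ hbody h0).mono ?_ ?_
  · simp only [Finset.sum_const, Nat.card_Ico, smul_eq_mul]
    omega
  · rintro s' ⟨-, h2, h3, h4, h5, h6'⟩
    rw [max_eq_right (Nat.zero_le _)] at h4 h5
    exact ⟨h2, h3, h4, h5, h6'⟩

/-- Write the product of `G` with the array `5` into a column of the output. -/
def outputLoop : Program :=
  .whileLt 18 4 (.block [.constW 8 0, .constR 2 0] (.seq dotLoop
    (.block [.storeR 4 20 2, .addW 20 20 1] (.instr (.addW 18 18 6)))))

lemma runs_outputLoop (s : Memory) (h6 : s.w 6 = 1) (h18 : s.w 18 = 0) (h19 : s.w 19 = 0)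
    (hd : 0 < s.w 1) :
    Runs outputLoop s (s.w 4 * (7 * s.w 3 + 7) + 1) fun s' =>
      s'.W = s.W ∧ (∀ a, a ≠ 4 → s'.R a = s.R a) ∧
      (∀ a < s.w 4, s'.R 4 (s.w 20 + a * s.w 1) =
        ∑ b ∈ Finset.range (s.w 3), s.R 3 (a * s.w 3 + b) * s.R 5 b) ∧
      (∀ x, (∀ a < s.w 4, x ≠ s.w 20 + a * s.w 1) → s'.R 4 x = s.R 4 x) ∧
      (∀ i, i < 8 → s'.w i = s.w i) := by
  let J : ℕ → Memory → Prop := fun q s' => s'.w 18 = q ∧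
      s'.W = s.W ∧ (∀ a, a ≠ 4 → s'.R a = s.R a) ∧
      (∀ a < q, s'.R 4 (s.w 20 + a * s.w 1) =
        ∑ b ∈ Finset.range (s.w 3), s.R 3 (a * s.w 3 + b) * s.R 5 b) ∧
      (∀ x, (∀ a < q, x ≠ s.w 20 + a * s.w 1) → s'.R 4 x = s.R 4 x) ∧
      (∀ i, i < 8 → s'.w i = s.w i) ∧ s'.w 19 = q * s.w 3 ∧ s'.w 20 = s.w 20 + q * s.w 1
  have hJ : ∀ q s', J q s' → s'.w 18 = q ∧ s'.w 4 = s.w 4 := by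
    rintro q s' ⟨h1, -, -, -, -, h5, -⟩
    exact ⟨h1, h5 4 (by norm_num)⟩
  have hbody : ∀ q s', 0 ≤ q → q < s.w 4 → J q s' →
      Runs (.block [.constW 8 0, .constR 2 0] (.seq dotLoop
        (.block [.storeR 4 20 2, .addW 20 20 1] (.instr (.addW 18 18 6))))) s'
        (7 * s.w 3 + 6) (J (q + 1)) := by
    rintro q s' - - ⟨h1, h2, h3, h4, h5, hw, h19', h20⟩
    refine (Runs.block (k := (7 * s.w 3 + 1) + 3) (Runs.seq ?_)).mono
      (by simp only [List.length]; omega) fun _ h => h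
    generalize hs1 : List.foldl (fun s i => Instr.run i s) s' _ = s1
    have aw : ∀ i, i ≠ 8 → s1.w i = s'.w i := by
      intro i hi
      simp [← hs1, Instr.run, hi]
    have a8 : s1.w 8 = 0 := by simp [← hs1, Instr.run]
    have ar : s1.r 2 = 0 := by simp [← hs1, Instr.run]
    have aW : s1.W = s'.W := by simp [← hs1, Instr.run]
    have aR : s1.R = s'.R := by simp [← hs1, Instr.run]
    have a3 : s1.w 3 = s.w 3 := by rw [aw 3 (by norm_num), hw 3 (by norm_num)]
    have hrun := runs_dotLoop s1 (by rw [aw 6 (by norm_num), hw 6 (by norm_num), h6]) a8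
    rw [a3] at hrun
    refine hrun.mono le_rfl ?_
    rintro s2 ⟨b1, b2, b3, b4, b5⟩
    rw [aw 19 (by norm_num), h19', aR, h3 3 (by norm_num), h3 5 (by norm_num), ar, zero_add] at b3
    have e20 : s2.w 20 = s.w 20 + q * s.w 1 := by
      rw [b5 20 (by norm_num) (by norm_num), aw 20 (by norm_num), h20]
    have e1 : s2.w 1 = s.w 1 := by
      rw [b5 1 (by norm_num) (by norm_num), aw 1 (by norm_num), hw 1 (by norm_num)]
    have e6 : s2.w 6 = 1 := by
      rw [b5 6 (by norm_num) (by norm_num), aw 6 (by norm_num), hw 6 (by norm_num), h6]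
    have e18 : s2.w 18 = q := by
      rw [b5 18 (by norm_num) (by norm_num), aw 18 (by norm_num), h1]
    have e19 : s2.w 19 = (q + 1) * s.w 3 := by
      rw [b4, aw 19 (by norm_num), h19']; ring
    have eR : s2.R = s'.R := by rw [b2, aR]
    refine Runs.block (k := 1) (Runs.instr ⟨?_, ?_, ?_, ?_, ?_, ?_, ?_, ?_⟩)
    · simp [Instr.run, e18, e6]
    · simp [Instr.run, b1, aW, h2]
    · intro a ha
      simp [Instr.run, ha, eR, h3 a ha]
    · intro a ha
      by_cases haq : a = q
      · subst haq
        simp [Instr.run, e20, b3]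
      · have hne : s.w 20 + a * s.w 1 ≠ s.w 20 + q * s.w 1 := by
          intro h
          exact haq (Nat.eq_of_mul_eq_mul_right hd (by omega))
        simp only [Instr.run, List.foldl, e20, Function.update_self, Function.update_of_ne hne, eR]
        exact h4 a (by omega)
    · intro x hx
      have hne : x ≠ s.w 20 + q * s.w 1 := hx q (by omega)
      simp only [Instr.run, List.foldl, e20, Function.update_self, Function.update_of_ne hne, eR]
      exact h5 x fun a ha => hx a (by omega)
    · intro i hi
      have i1 : i ≠ 20 := by omega
      have i2 : i ≠ 18 := by omega
      simp [Instr.run, i1, i2, b5 i (by omega) (by omega), aw i (by omega), hw i hi]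
    · simp [Instr.run, e19]
    · simp [Instr.run, e20, e1]
      ring
  have h0 : J 0 s := ⟨h18, rfl, fun _ _ => rfl, by simp, fun _ _ => rfl, fun _ _ => rfl,
    by simpa using h19, by simp⟩
  refine (Runs.while J (fun _ => 7 * s.w 3 + 6) hJ hbody h0).mono ?_ ?_
  · simp only [Finset.sum_const, Nat.card_Ico, smul_eq_mul]
    rw [Nat.sub_zero]
  · rintro s' ⟨-, h2, h3, h4, h5, h6', -, -⟩
    rw [max_eq_right (Nat.zero_le _)] at h4 h5
    exact ⟨h2, h3, h4, h5, h6'⟩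

/-- The program that computes `S A`: every column of `A` is sent through the sparse factors `D̃`
and `Φ D` entry by entry, and the resulting vector with `m₁` entries is multiplied with the dense
factor. The real array `5` is the accumulator for that vector. Index registers: `0`-`4` hold the
dimensions, `5` the current column of `A`, `6` the constant `1`, `7` the constant `0`; the pairs
`9, 10`, `12, 13` and `15, 16` delimit the current columns of `A`, `D̃` and `Φ D`; `18`, `19` and
`20` run over the rows of `G`, the table of `G` and the cells of the output. -/
def sketchProgram : Program :=
  .block [.constW 6 1, .constW 7 0, .constW 5 0]
    (.whileLt 5 1 (.block [.constW 8 0, .constR 0 0] (.seq clearLoop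
      (.block [.loadW 9 0 5, .addW 21 5 6, .loadW 10 0 21] (.seq addProductLoop
        (.block [.constW 18 0, .constW 19 0, .addW 20 5 7] (.seq outputLoop
          (.instr (.addW 5 5 6)))))))))

/-- The number of steps that `sketchProgram` spends on the column `c`. -/
def columnCost (s : Memory) (c : ℕ) : ℕ :=
  ∑ q ∈ Finset.Ico (s.W 0 c) (s.W 0 (c + 1)), (7 + sampledCost s.W (s.W 1 q)) +
    (3 * s.w 3 + s.w 4 * (7 * s.w 3 + 7) + 13)

lemma runs_sketchProgram (s : Memory) (hd : 0 < s.w 1) :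
    Runs sketchProgram s (∑ c ∈ Finset.range (s.w 1), columnCost s c + 4) fun s' =>
      ∀ c < s.w 1, ∀ a < s.w 4, s'.R 4 (c + a * s.w 1) =
        ∑ b ∈ Finset.range (s.w 3), s.R 3 (a * s.w 3 + b) *
          ∑ q ∈ Finset.Ico (s.W 0 c) (s.W 0 (c + 1)),
            s.R 0 q * sampledEntry s.W s.R (s.W 1 q) b := by
  let J : ℕ → Memory → Prop := fun c s' => s'.w 5 = c ∧
      s'.W = s.W ∧ (∀ a, a < 4 → s'.R a = s.R a) ∧ (∀ i, i < 5 → s'.w i = s.w i) ∧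
      s'.w 6 = 1 ∧ s'.w 7 = 0 ∧
      ∀ c' < c, ∀ a < s.w 4, s'.R 4 (c' + a * s.w 1) =
        ∑ b ∈ Finset.range (s.w 3), s.R 3 (a * s.w 3 + b) *
          ∑ q ∈ Finset.Ico (s.W 0 c') (s.W 0 (c' + 1)),
            s.R 0 q * sampledEntry s.W s.R (s.W 1 q) b
  have hJ : ∀ c s', J c s' → s'.w 5 = c ∧ s'.w 1 = s.w 1 := by
    rintro c s' ⟨h1, -, -, h5, -⟩
    exact ⟨h1, h5 1 (by norm_num)⟩
  have hbody : ∀ c s', 0 ≤ c → c < s.w 1 → J c s' →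
      Runs (.block [.constW 8 0, .constR 0 0] (.seq clearLoop
        (.block [.loadW 9 0 5, .addW 21 5 6, .loadW 10 0 21] (.seq addProductLoop
          (.block [.constW 18 0, .constW 19 0, .addW 20 5 7] (.seq outputLoop
            (.instr (.addW 5 5 6)))))))) s' (columnCost s c - 1) (J (c + 1)) := by
    rintro c s' - hc ⟨h1, h2, h3, h4, h6, h7, hout⟩
    refine (Runs.block (k := (3 * s.w 3 + 1) + (3 + ((∑ q ∈ Finset.Ico (s.W 0 c) (s.W 0 (c + 1)),
      (7 + sampledCost s.W (s.W 1 q)) + 1) + (3 + ((s.w 4 * (7 * s.w 3 + 7) + 1) + 1)))))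
      (Runs.seq ?_)).mono (by simp only [List.length, columnCost]; omega) fun _ h => h
    generalize hs1 : List.foldl (fun s i => Instr.run i s) s' _ = s1
    have a8 : s1.w 8 = 0 := by simp [← hs1, Instr.run]
    have ar : s1.r 0 = 0 := by simp [← hs1, Instr.run]
    have aW : s1.W = s.W := by simp [← hs1, Instr.run, h2]
    have aR : s1.R = s'.R := by simp [← hs1, Instr.run]
    have aw : ∀ i, i < 8 → s1.w i = s'.w i := by
      intro i hi
      have i1 : i ≠ 8 := by omega
      simp [← hs1, Instr.run, i1]
    have a3 : s1.w 3 = s.w 3 := by rw [aw 3 (by norm_num), h4 3 (by norm_num)]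
    have hrun := runs_clearLoop s1 (by rw [aw 6 (by norm_num), h6]) a8
    rw [a3, ar] at hrun
    refine hrun.mono le_rfl ?_
    rintro s2 ⟨b1, b2, b3, b4, -⟩
    refine Runs.block (k := (∑ q ∈ Finset.Ico (s.W 0 c) (s.W 0 (c + 1)),
      (7 + sampledCost s.W (s.W 1 q)) + 1) + (3 + ((s.w 4 * (7 * s.w 3 + 7) + 1) + 1)))
      (Runs.seq ?_)
    have b4' : ∀ i, i < 8 → s2.w i = s'.w i := fun i hi => by
      rw [b4 i (by omega), aw i hi]
    have c5 : s2.w 5 = c := by rw [b4' 5 (by norm_num), h1]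
    have c6 : s2.w 6 = 1 := by rw [b4' 6 (by norm_num), h6]
    have cW : s2.W = s.W := by rw [b1, aW]
    have cR : ∀ a, a < 5 → s2.R a = s'.R a := fun a ha => by rw [b2 a (by omega), aR]
    generalize hs3 : List.foldl (fun s i => Instr.run i s) s2 _ = s3
    have d9 : s3.w 9 = s.W 0 c := by simp [← hs3, Instr.run, c5, cW]
    have d10 : s3.w 10 = s.W 0 (c + 1) := by simp [← hs3, Instr.run, c5, c6, cW]
    have dW : s3.W = s.W := by simp [← hs3, Instr.run, cW]
    have dR : s3.R = s2.R := by simp [← hs3, Instr.run]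
    have dw : ∀ i, i < 8 → s3.w i = s'.w i := by
      intro i hi
      have i1 : i ≠ 9 := by omega
      have i2 : i ≠ 10 := by omega
      have i3 : i ≠ 21 := by omega
      simp [← hs3, Instr.run, i1, i2, i3, b4' i hi]
    have hrun := runs_addProductLoop s3 (by rw [dw 6 (by norm_num), h6])
    rw [d9, d10, dW] at hrun
    refine hrun.mono le_rfl ?_
    have eR0 : s3.R 0 = s.R 0 := by rw [dR, cR 0 (by norm_num), h3 0 (by norm_num)]
    have eR1 : s3.R 1 = s.R 1 := by rw [dR, cR 1 (by norm_num), h3 1 (by norm_num)]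
    have eR2 : s3.R 2 = s.R 2 := by rw [dR, cR 2 (by norm_num), h3 2 (by norm_num)]
    have hentry : ∀ j b, sampledEntry s.W s3.R j b = sampledEntry s.W s.R j b := fun j b => by
      rw [sampledEntry, sampledEntry, eR1, eR2]
    rintro s4 ⟨f1, f2, f3, f4, -⟩
    have f3' : ∀ b < s.w 3, s4.R 5 b = ∑ q ∈ Finset.Ico (s.W 0 c) (s.W 0 (c + 1)),
        s.R 0 q * sampledEntry s.W s.R (s.W 1 q) b := by
      intro b hb
      rw [f3 b, dR, b3 b hb, zero_add, ← dR, eR0]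
      simp_rw [hentry]
    refine Runs.block (k := (s.w 4 * (7 * s.w 3 + 7) + 1) + 1) (Runs.seq ?_)
    have f4' : ∀ i, i < 8 → s4.w i = s'.w i := fun i hi => by
      rw [f4 i (by omega), dw i hi]
    have fR : ∀ a, a < 5 → s4.R a = s'.R a := fun a ha => by
      rw [f2 a (by omega), dR, cR a ha]
    generalize hs5 : List.foldl (fun s i => Instr.run i s) s4 _ = s5
    have g18 : s5.w 18 = 0 := by simp [← hs5, Instr.run]
    have g19 : s5.w 19 = 0 := by simp [← hs5, Instr.run]
    have g20 : s5.w 20 = c := by simp [← hs5, Instr.run, f4', h1, h7]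
    have gW : s5.W = s.W := by simp [← hs5, Instr.run, f1]
    have gR : s5.R = s4.R := by simp [← hs5, Instr.run]
    have gw : ∀ i, i < 8 → s5.w i = s'.w i := by
      intro i hi
      have i1 : i ≠ 18 := by omega
      have i2 : i ≠ 19 := by omega
      have i3 : i ≠ 20 := by omega
      simp [← hs5, Instr.run, i1, i2, i3, f4' i hi]
    have g1 : s5.w 1 = s.w 1 := by rw [gw 1 (by norm_num), h4 1 (by norm_num)]
    have g3 : s5.w 3 = s.w 3 := by rw [gw 3 (by norm_num), h4 3 (by norm_num)]
    have g4 : s5.w 4 = s.w 4 := by rw [gw 4 (by norm_num), h4 4 (by norm_num)]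
    have hrun := runs_outputLoop s5 (by rw [gw 6 (by norm_num), h6]) g18 g19 (by rw [g1]; exact hd)
    rw [g3, g4, g20, g1, gW, gR] at hrun
    refine hrun.mono le_rfl ?_
    rintro s6 ⟨k1, k2, k3, k4, k5⟩
    refine Runs.instr ⟨?_, ?_, ?_, ?_, ?_, ?_, ?_⟩
    · simp [Instr.run, k5, gw, h1, h6]
    · simp [Instr.run, k1]
    · intro a ha
      simp [Instr.run, k2 a (by omega), fR a (by omega), h3 a ha]
    · intro i hi
      have i1 : i ≠ 5 := by omega
      simp [Instr.run, i1, k5 i (by omega), gw i (by omega), h4 i hi]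
    · simp [Instr.run, k5, gw, h6]
    · simp [Instr.run, k5, gw, h7]
    · intro c' hc' a ha
      simp only [Instr.run]
      by_cases hcc : c' = c
      · subst hcc
        rw [k3 a ha, fR 3 (by norm_num), h3 3 (by norm_num)]
        refine Finset.sum_congr rfl fun b hb => ?_
        rw [f3' b (Finset.mem_range.1 hb)]
      · rw [k4, fR 4 (by norm_num)]
        · exact hout c' (by omega) a ha
        · intro a' _ h
          have := congrArg (· % s.w 1) h
          simp only [Nat.add_mul_mod_self_right] at this
          rw [Nat.mod_eq_of_lt (by omega), Nat.mod_eq_of_lt hc] at this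
          exact hcc this
  refine (Runs.block (k := ∑ c ∈ Finset.Ico 0 (s.w 1), (columnCost s c - 1 + 1) + 1)
    ((Runs.while J _ hJ hbody ?_).mono le_rfl ?_)).mono ?_ fun _ h => h
  · refine ⟨?_, ?_, ?_, ?_, ?_, ?_, ?_⟩
    · simp [Instr.run]
    · simp [Instr.run]
    · intro a _; simp [Instr.run]
    · intro i hi
      have i1 : i ≠ 5 := by omega
      have i2 : i ≠ 6 := by omega
      have i3 : i ≠ 7 := by omega
      simp [Instr.run, i1, i2, i3]
    · simp [Instr.run]
    · simp [Instr.run]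
    · intro c' hc'; omega
  · rintro s' ⟨-, -, -, -, -, -, h⟩
    rwa [max_eq_right (Nat.zero_le _)] at h
  · have hle : ∀ c, columnCost s c - 1 + 1 = columnCost s c := fun c => by
      rw [columnCost]; omega
    simp only [hle, List.length, Nat.Ico_zero_eq_range]
    omega

end Machine

/-! ### Correctness and cost on compressed sparse inputs -/

section Sparse

variable {N c : ℕ} {M : Matrix (Fin N) (Fin c) ℝ} {ptr idx : ℕ → ℕ} {val : ℕ → ℝ}

lemma IsSparse.sum_Ico {β : Type*} [AddCommMonoid β] (h : IsSparse M ptr idx val) (j : Fin c)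
    {F : ℕ → β} {G : Fin N → β}
    (hFG : ∀ (q : ℕ) (i : Fin N), q ∈ Set.Ico (ptr j) (ptr (j + 1)) → idx q = i → F q = G i) :
    ∑ q ∈ Finset.Ico (ptr j) (ptr (j + 1)), F q = ∑ i with M i j ≠ 0, G i := by
  have hb := h.rows j
  have hex : ∀ q ∈ Finset.Ico (ptr j) (ptr (j + 1)), ∃ i : Fin N, M i j ≠ 0 ∧ (i : ℕ) = idx q :=
    fun q hq => hb.mapsTo (by simpa using hq)
  choose i hi using hex
  refine Finset.sum_bij i ?_ ?_ ?_ ?_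
  · intro q hq
    simpa using (hi q hq).1
  · intro q hq q' hq' he
    refine hb.injOn (by simpa using hq) (by simpa using hq') ?_
    rw [← (hi q hq).2, ← (hi q' hq').2, he]
  · intro k hk
    obtain ⟨q, hq, hqk⟩ := hb.surjOn ⟨k, by simpa using hk, rfl⟩
    have hq' : q ∈ Finset.Ico (ptr j) (ptr (j + 1)) := by simpa using hq
    exact ⟨q, hq', Fin.ext (by rw [(hi q hq').2, hqk])⟩
  · intro q hq
    exact hFG q _ (by simpa using hq) (hi q hq).2.symm

lemma IsSparse.card_Ico (h : IsSparse M ptr idx val) (j : Fin c) :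
    ptr (j + 1) - ptr j = (Finset.univ.filter fun i => M i j ≠ 0).card := by
  have := h.sum_Ico j (F := fun _ => 1) (G := fun _ => 1) fun _ _ _ _ => rfl
  simpa using this

lemma IsSparse.sum_val_mul (h : IsSparse M ptr idx val) (j : Fin c) (f : ℕ → ℝ) :
    ∑ q ∈ Finset.Ico (ptr j) (ptr (j + 1)), val q * f (idx q) = ∑ i, M i j * f i := by
  rw [h.sum_Ico j (G := fun i => M i j * f i) fun q i hq hi => by rw [h.vals j q i hq hi, hi]]
  refine Finset.sum_filter_of_ne fun i _ hi => ?_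
  exact left_ne_zero_of_mul hi

variable {n d m₁ m₂ : ℕ} {A : Matrix (Fin n) (Fin d) ℝ} {D : Matrix (Fin N) (Fin n) ℝ}
  {C : Matrix (Fin m₁) (Fin N) ℝ} {G : Matrix (Fin m₂) (Fin m₁) ℝ} {s : Memory}

lemma IsInput.sampledEntry_eq (h : IsInput A D C G s) (j : Fin n) (b : Fin m₁) :
    sampledEntry s.W s.R j b = (C * D) b j := by
  have h2 : ∀ k : Fin N, ∑ q ∈ Finset.Ico (s.W 4 k) (s.W 4 (k + 1)),
      s.R 2 q * (if s.W 5 q = b then 1 else 0) = C b k := by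
    intro k
    rw [h.mat_C.sum_val_mul k fun i => if i = b then 1 else 0]
    simp [Fin.val_inj]
  have h1 := h.mat_D.sum_val_mul j fun k => ∑ q ∈ Finset.Ico (s.W 4 k) (s.W 4 (k + 1)),
      s.R 2 q * (if s.W 5 q = b then 1 else 0)
  simp_rw [h2] at h1
  rw [sampledEntry, Matrix.mul_apply]
  simp_rw [mul_comm (C b _), ← h1, Finset.mul_sum]
  simp

lemma IsInput.sampledCost_le (h : IsInput A D C G s)
    (hC : ∀ k, (Finset.univ.filter fun b => C b k ≠ 0).card ≤ 1) (j : Fin n) :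
    sampledCost s.W j ≤ 17 * (Finset.univ.filter fun k => D k j ≠ 0).card + 1 := by
  rw [sampledCost, h.mat_D.sum_Ico j (G := fun k : Fin N =>
    9 + 8 * (s.W 4 (k + 1) - s.W 4 k)) fun q i _ hi => by rw [hi]]
  refine Nat.succ_le_succ ((Finset.sum_le_card_nsmul _ _ 17 fun k _ => ?_).trans ?_)
  · rw [h.mat_C.card_Ico k]
    have := hC k
    omega
  · rw [smul_eq_mul, mul_comm]

/-- Number of steps for the part of the computation that does not depend on the sparsity of `A`. -/
def denseCost (d m₁ m₂ : ℕ) : ℕ := d * (3 * m₁ + m₂ * (7 * m₁ + 7) + 13) + 4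

/-- Every non-zero entry of `A` in row `j` costs a constant number of steps for each non-zero entry
in the column `j` of `D`, since the columns of `C` have one non-zero entry each. -/
lemma IsInput.runs_sketchProgram (h : IsInput A D C G s) (hd : 0 < d)
    (hC : ∀ k, (Finset.univ.filter fun b => C b k ≠ 0).card ≤ 1) :
    Runs sketchProgram s
      (∑ c, ∑ j with A j c ≠ 0, (8 + 17 * (Finset.univ.filter fun k => D k j ≠ 0).card) +
        denseCost d m₁ m₂)
      (IsOutput (G * C * D * A)) := by
  refine (SymSketch.runs_sketchProgram s (by rw [h.dim_d]; exact hd)).mono ?_ ?_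
  · rw [h.dim_d, Finset.sum_range, denseCost, ← add_assoc]
    refine Nat.add_le_add_right ?_ 4
    have hcol : ∀ c : Fin d, columnCost s c ≤
        ∑ j with A j c ≠ 0, (8 + 17 * (Finset.univ.filter fun k => D k j ≠ 0).card) +
          (3 * m₁ + m₂ * (7 * m₁ + 7) + 13) := by
      intro c
      rw [columnCost, h.dim_m₁, h.dim_m₂, h.mat_A.sum_Ico c (G := fun j : Fin n =>
        7 + sampledCost s.W j) fun q i _ hi => by rw [hi]]
      refine Nat.add_le_add_right (Finset.sum_le_sum fun j _ => ?_) _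
      have := h.sampledCost_le hC j
      omega
    refine (Finset.sum_le_sum fun c _ => hcol c).trans ?_
    rw [Finset.sum_add_distrib]
    simp
  · intro s' hs' a c
    rw [h.dim_d, h.dim_m₁, h.dim_m₂] at hs'
    rw [add_comm, hs' c c.2 a a.2, Finset.sum_range, Matrix.mul_assoc, Matrix.mul_assoc,
      Matrix.mul_apply]
    refine Finset.sum_congr rfl fun b _ => ?_
    rw [h.mat_G a b, ← Matrix.mul_assoc, Matrix.mul_apply,
      h.mat_A.sum_val_mul c fun j => sampledEntry s.W s.R j b]
    congr 1
    refine Finset.sum_congr rfl fun j _ => ?_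
    rw [h.sampledEntry_eq, mul_comm]

end Sparse

/-! ### The running time of the sketch -/

section Time

variable {n d t m₁ m₂ : ℕ}

/-- A bound for the number of steps, as a function of the sampling bits: it counts, for each
non-zero entry of `A`, the levels on which its row is sampled. -/
noncomputable def timeBound (A : Matrix (Fin n) (Fin d) ℝ) (m₁ m₂ : ℕ)
    (z : Fin (t + 1) × Fin n → Bool) : ℕ :=
  ∑ c, ∑ j with A j c ≠ 0, (8 + 17 * (Finset.univ.filter fun i => z (i, j) = true).card) +
    denseCost d m₁ m₂

lemma card_countSketch_column_le (ω : Seed n t m₁ m₂) (k : Fin ((t + 1) * n)) :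
    (Finset.univ.filter fun b => countSketch ω b k ≠ 0).card ≤ 1 := by
  have : (Finset.univ.filter fun b => countSketch ω b k ≠ 0) ⊆ {ω.h k} := by
    intro b hb
    simp only [countSketch, Matrix.mul_diagonal, Matrix.of_apply, Finset.mem_filter] at hb
    by_contra hne
    rw [Finset.mem_singleton] at hne
    exact hb.2 (by simp [Ne.symm hne])
  simpa using Finset.card_le_card this

lemma card_samplingMatrix_column_le (ℓ : Seminorm ℝ (Fin n → ℝ)) (ω : Seed n t m₁ m₂)
    (j : Fin n) :
    (Finset.univ.filter fun k => samplingMatrix ℓ ω k j ≠ 0).card ≤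
      (Finset.univ.filter fun i => ω.z (i, j) = true).card := by
  have hcol : ∀ k, samplingMatrix ℓ ω k j ≠ 0 →
      (finProdFinEquiv.symm k).2 = j ∧ ω.z ((finProdFinEquiv.symm k).1, j) = true := by
    intro k hk
    have h1 := right_ne_zero_of_mul hk
    have h2 : (finProdFinEquiv.symm k).2 = j := by
      by_contra hne
      exact h1 (Matrix.diagonal_apply_ne _ hne)
    refine ⟨h2, ?_⟩
    rw [h2, Matrix.diagonal_apply_eq] at h1
    by_contra hz
    exact h1 (if_neg hz)
  refine Finset.card_le_card_of_injOn (fun k => (finProdFinEquiv.symm k).1) ?_ ?_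
  · intro k hk
    simpa using (hcol k (by simpa using hk)).2
  · intro k hk k' hk' he
    refine finProdFinEquiv.symm.injective (Prod.ext he ?_)
    rw [(hcol k (by simpa using hk)).1, (hcol k' (by simpa using hk')).1]

lemma runs_sketchProgram_timeBound {ℓ : Seminorm ℝ (Fin n → ℝ)} {A : Matrix (Fin n) (Fin d) ℝ}
    (hd : 0 < d) {ω : Seed n t m₁ m₂} {s : Memory}
    (h : IsInput A (samplingMatrix ℓ ω) (countSketch ω) (gaussianEmbedding ω) s) :
    Runs sketchProgram s (timeBound A m₁ m₂ ω.z) (IsOutput (sketch ℓ ω * A)) := by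
  refine (h.runs_sketchProgram hd (card_countSketch_column_le ω)).mono ?_ fun s' hs' => hs'
  refine Nat.add_le_add_right (Finset.sum_le_sum fun c _ => Finset.sum_le_sum fun j _ => ?_) _
  have := card_samplingMatrix_column_le ℓ ω j
  omega

lemma sum_card_column_eq_nnz (A : Matrix (Fin n) (Fin d) ℝ) :
    ∑ c, (Finset.univ.filter fun j => A j c ≠ 0).card = nnz A := by
  classical
  rw [nnz, Set.ncard_eq_toFinset_card', ← Finset.card_sigma]
  refine Finset.card_bij (fun p _ => (p.2, p.1)) ?_ ?_ ?_
  · rintro ⟨c, j⟩ h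
    simpa using h
  · rintro ⟨c, j⟩ - ⟨c', j'⟩ - h
    simp only [Prod.mk.injEq] at h
    rw [h.1, h.2]
  · rintro ⟨j, c⟩ h
    exact ⟨⟨c, j⟩, by simpa using h, rfl⟩

lemma timeBound_le (A : Matrix (Fin n) (Fin d) ℝ) (m₁ m₂ : ℕ)
    (z : Fin (t + 1) × Fin n → Bool) :
    timeBound A m₁ m₂ z ≤ nnz A * (8 + 17 * (t + 1)) + denseCost d m₁ m₂ := by
  refine Nat.add_le_add_right ?_ _
  rw [← sum_card_column_eq_nnz, Finset.sum_mul]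
  refine Finset.sum_le_sum fun c _ => Finset.sum_le_card_nsmul _ _ _ fun j _ => ?_
  have : (Finset.univ.filter fun i => z (i, j) = true).card ≤ t + 1 :=
    (Finset.card_le_univ _).trans (by simp)
  omega

/-- A non-zero entry of `A` is sampled `∑ᵢ 2⁻ⁱ ≤ 2` times in expectation. -/
lemma integral_timeBound_le (A : Matrix (Fin n) (Fin d) ℝ) (m₁ m₂ : ℕ) :
    ∫ z, (timeBound A m₁ m₂ z : ℝ) ∂bitLaw n t ≤ nnz A * 42 + denseCost d m₁ m₂ := by
  have hcard : ∀ (z : Fin (t + 1) × Fin n → Bool) (j : Fin n),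
      ((Finset.univ.filter fun i => z (i, j) = true).card : ℝ) =
        ∑ i, if z (i, j) = true then (1 : ℝ) else 0 := fun z j => by
    simp
  have hj : ∀ j : Fin n, ∫ z, ((Finset.univ.filter fun i => z (i, j) = true).card : ℝ)
      ∂bitLaw n t ≤ 2 := by
    intro j
    simp_rw [hcard]
    rw [integral_finsetSum _ fun i _ => Integrable.of_finite]
    rw [Finset.sum_congr rfl fun i _ =>
      integral_bit (fun b : Bool => if b then (1 : ℝ) else 0) (i, j)]
    simp only [if_true, mul_one, Bool.false_eq_true, if_false, mul_zero, add_zero]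
    rw [Fin.sum_univ_eq_sum_range fun i => (1 / 2 : ℝ) ^ i]
    have h := geom_sum_eq (show (1 / 2 : ℝ) ≠ 1 by norm_num) (t + 1)
    have h0 : (0 : ℝ) < (1 / 2) ^ (t + 1) := by positivity
    rw [h, div_le_iff_of_neg (by norm_num)]
    linarith
  have hpush : ∀ z : Fin (t + 1) × Fin n → Bool, (timeBound A m₁ m₂ z : ℝ) =
      ∑ c, ∑ j with A j c ≠ 0,
        (8 + 17 * ((Finset.univ.filter fun i => z (i, j) = true).card : ℝ)) +
          denseCost d m₁ m₂ := fun z => by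
    rw [timeBound]
    push_cast
    rfl
  simp_rw [hpush]
  rw [integral_add Integrable.of_finite Integrable.of_finite,
    integral_finsetSum _ fun c _ => Integrable.of_finite]
  refine add_le_add ?_ (by simp)
  rw [← sum_card_column_eq_nnz, Nat.cast_sum, Finset.sum_mul]
  refine Finset.sum_le_sum fun c _ => ?_
  rw [integral_finsetSum _ fun c _ => Integrable.of_finite, ← nsmul_eq_mul]
  refine Finset.sum_le_card_nsmul _ _ _ fun j _ => ?_
  rw [integral_add Integrable.of_finite Integrable.of_finite, integral_const_mul]
  have := hj j
  simp
  linarith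

end Time

/-! ### The sketch as a composition of three random maps -/

section Embedding

variable {n d t m₁ m₂ : ℕ}

/-- Transport of the coordinates from pairs (block, row) to rows of the stacked matrix. -/
noncomputable abbrev stackCoords (n t : ℕ) :
    EuclideanSpace ℝ (Fin (t + 1) × Fin n) ≃ₗᵢ[ℝ] EuclideanSpace ℝ (Fin ((t + 1) * n)) :=
  LinearIsometryEquiv.piLpCongrLeft 2 ℝ ℝ finProdFinEquiv

lemma toLp_samplingMatrix_mulVec (ℓ : Seminorm ℝ (Fin n → ℝ)) (ω : Seed n t m₁ m₂)
    (y : Fin n → ℝ) :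
    WithLp.toLp 2 ((samplingMatrix ℓ ω).mulVec y) = stackCoords n t (sampleMap ℓ ω.z y) := by
  ext k
  have hdiag := Matrix.mulVec_diagonal
    (fun j => if ω.z ((finProdFinEquiv.symm k).1, j) then (1 : ℝ) else 0) y
    (finProdFinEquiv.symm k).2
  simp only [Matrix.mulVec, dotProduct] at hdiag
  simp only [Matrix.mulVec, dotProduct, samplingMatrix, Matrix.of_apply, mul_assoc]
  rw [← Finset.mul_sum, hdiag, ite_mul, one_mul, zero_mul]
  rfl

lemma toLp_countSketch_mulVec (ω : Seed n t m₁ m₂) (v : Fin ((t + 1) * n) → ℝ) :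
    WithLp.toLp 2 ((countSketch ω).mulVec v) =
      countSketchMap (ω.sgn, ω.h) (WithLp.toLp 2 v) := by
  ext b
  simp only [Matrix.mulVec, dotProduct, countSketch, Matrix.mul_diagonal, Matrix.of_apply]
  refine Finset.sum_congr rfl fun k _ => ?_
  simp only [bitSign]
  split_ifs <;> simp

lemma toLp_gaussianEmbedding_mulVec (ω : Seed n t m₁ m₂) (v : Fin m₁ → ℝ) :
    WithLp.toLp 2 ((gaussianEmbedding ω).mulVec v) = gaussMap ω.g (WithLp.toLp 2 v) := by
  ext a
  simp only [gaussianEmbedding, Matrix.smul_mulVec]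
  rfl

lemma norm2_sketch_mul_mulVec (ℓ : Seminorm ℝ (Fin n → ℝ)) (ω : Seed n t m₁ m₂)
    (A : Matrix (Fin n) (Fin d) ℝ) (x : Fin d → ℝ) :
    norm2 ((sketch ℓ ω * A).mulVec x) = ‖gaussMap ω.g (countSketchMap (ω.sgn, ω.h)
      (stackCoords n t (sampleMap ℓ ω.z (A.mulVec x))))‖ := by
  rw [norm2, sketch, ← Matrix.mulVec_mulVec, ← Matrix.mulVec_mulVec, ← Matrix.mulVec_mulVec,
    toLp_gaussianEmbedding_mulVec, toLp_countSketch_mulVec, toLp_samplingMatrix_mulVec]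

/-- The inverse of `Seed.toProd`. -/
def Seed.ofProd (p : (Fin (t + 1) × Fin n → Bool) × (Fin ((t + 1) * n) → Bool) ×
    (Fin ((t + 1) * n) → Fin m₁) × (Fin m₂ × Fin m₁ → ℝ)) : Seed n t m₁ m₂ :=
  ⟨p.1, p.2.1, p.2.2.1, p.2.2.2⟩

lemma Seed.measurable_ofProd : Measurable (Seed.ofProd (n := n) (t := t) (m₁ := m₁) (m₂ := m₂)) :=
  measurable_comap_iff.2 measurable_id

lemma Seed.measurable_z : Measurable (Seed.z (n := n) (t := t) (m₁ := m₁) (m₂ := m₂)) :=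
  measurable_fst.comp (comap_measurable Seed.toProd)

lemma seedLaw_eq_map_ofProd : seedLaw n t m₁ m₂ =
    ((bitLaw n t).prod ((signLaw (Fin ((t + 1) * n))).prod
      ((hashLaw (Fin ((t + 1) * n)) m₁).prod (gaussLaw m₁ m₂)))).map Seed.ofProd := rfl

instance [NeZero m₁] : IsProbabilityMeasure (seedLaw n t m₁ m₂) := by
  rw [seedLaw_eq_map_ofProd]
  exact Measure.isProbabilityMeasure_map Seed.measurable_ofProd.aemeasurable

lemma integral_seedLaw_z [NeZero m₁] (f : (Fin (t + 1) × Fin n → Bool) → ℝ) :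
    ∫ ω, f ω.z ∂seedLaw n t m₁ m₂ = ∫ z, f z ∂bitLaw n t := by
  have hf : Measurable fun ω : Seed n t m₁ m₂ => f ω.z :=
    Measurable.of_discrete.comp Seed.measurable_z
  rw [seedLaw_eq_map_ofProd, integral_map Seed.measurable_ofProd.aemeasurable
    hf.aestronglyMeasurable]
  simp only [Seed.ofProd]
  rw [integral_fun_fst]
  simp

/-- An event all of whose sections have small probability has small probability. No measurability
of the event is needed, since the first factor is discrete. -/
lemma prod_real_le_of_forall_slice {α β : Type*} [MeasurableSpace α] [MeasurableSpace β]
    [Countable α] [MeasurableSingletonClass α] (μ : Measure α) [IsProbabilityMeasure μ]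
    (ν : Measure β) [IsProbabilityMeasure ν] {E : Set (α × β)} {ε : ℝ} (hε : 0 ≤ ε)
    (h : ∀ a, ν.real {b | (a, b) ∈ E} ≤ ε) : (μ.prod ν).real E ≤ ε := by
  let F : Set (α × β) := ⋃ a, {a} ×ˢ toMeasurable ν {b | (a, b) ∈ E}
  have hEF : E ⊆ F := fun p hp =>
    Set.mem_iUnion.2 ⟨p.1, rfl, subset_toMeasurable ν {b | (p.1, b) ∈ E} hp⟩
  have hF : MeasurableSet F := MeasurableSet.iUnion fun a =>
    (measurableSet_singleton a).prod (measurableSet_toMeasurable _ _)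
  have hslice : ∀ a, Prod.mk a ⁻¹' F = toMeasurable ν {b | (a, b) ∈ E} := by
    intro a
    ext b
    simp [F]
  have hle : (μ.prod ν) E ≤ ENNReal.ofReal ε := by
    refine (measure_mono hEF).trans ?_
    rw [Measure.prod_apply hF]
    calc ∫⁻ a, ν (Prod.mk a ⁻¹' F) ∂μ ≤ ∫⁻ _, ENNReal.ofReal ε ∂μ := by
          refine lintegral_mono fun a => ?_
          rw [hslice, measure_toMeasurable]
          rw [← ofReal_measureReal]
          exact ENNReal.ofReal_le_ofReal (h a)
      _ = ENNReal.ofReal ε := by simp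
  exact ENNReal.toReal_le_of_le_ofReal hε hle

/-- Composed with CountSketch, the Gaussian embedding preserves Euclidean norms on a fixed subspace
up to a constant factor. -/
lemma prob_gaussMap_countSketchMap_distort {N : ℕ} [NeZero m₁]
    (W : Submodule ℝ (EuclideanSpace ℝ (Fin N))) (hd : 1 ≤ d) (hW : Module.finrank ℝ W ≤ d)
    (hm₁ : 800 * d ^ 2 ≤ m₁) (hm₂ : 800 * d ≤ m₂) :
    ((signLaw (Fin N)).prod ((hashLaw (Fin N) m₁).prod (gaussLaw m₁ m₂))).real
      {q | ∃ v ∈ W, ‖gaussMap q.2.2 (countSketchMap (q.1, q.2.1) v)‖ < 1 / 8 * ‖v‖ ∨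
        8 * ‖v‖ < ‖gaussMap q.2.2 (countSketchMap (q.1, q.2.1) v)‖} ≤ 2 / 100 := by
  let CS : Set ((Fin N → Bool) × (Fin N → Fin m₁)) := {p | ∃ v ∈ W,
    ‖countSketchMap p v‖ < 1 / 2 * ‖v‖ ∨ 2 * ‖v‖ < ‖countSketchMap p v‖}
  let B₁ : Set ((Fin N → Bool) × (Fin N → Fin m₁) × (Fin m₂ × Fin m₁ → ℝ)) :=
    {q | (q.1, q.2.1) ∈ CS}
  let B₂ : Set ((Fin N → Bool) × (Fin N → Fin m₁) × (Fin m₂ × Fin m₁ → ℝ)) :=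
    {q | ∃ v ∈ W.map (countSketchMap (q.1, q.2.1)),
      ‖gaussMap q.2.2 v‖ < 1 / 4 * ‖v‖ ∨ 4 * ‖v‖ < ‖gaussMap q.2.2 v‖}
  have h1 : ((signLaw (Fin N)).prod ((hashLaw (Fin N) m₁).prod (gaussLaw m₁ m₂))).real B₁ ≤
      1 / 100 := by
    have hcs : ((signLaw (Fin N)).prod (hashLaw (Fin N) m₁)).real CS ≤ 1 / 100 :=
      prob_countSketchMap_distort W
        ((Nat.mul_le_mul_left _ (Nat.pow_le_pow_left hW 2)).trans hm₁)
    have hpre : MeasurableEquiv.prodAssoc ⁻¹' B₁ =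
        (CS ×ˢ Set.univ : Set (_ × (Fin m₂ × Fin m₁ → ℝ))) := by
      ext q
      simp [B₁, MeasurableEquiv.prodAssoc]
    rw [← (measurePreserving_prodAssoc (signLaw (Fin N)) (hashLaw (Fin N) m₁)
      (gaussLaw m₁ m₂)).map_eq, measureReal_def, MeasurableEquiv.map_apply, hpre,
      Measure.prod_prod, measure_univ, mul_one]
    exact hcs
  have h2 : ((signLaw (Fin N)).prod ((hashLaw (Fin N) m₁).prod (gaussLaw m₁ m₂))).real B₂ ≤
      1 / 100 := by
    refine prod_real_le_of_forall_slice _ _ (by norm_num) fun s => ?_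
    refine prod_real_le_of_forall_slice _ _ (by norm_num) fun h => ?_
    exact prob_gaussMap_distort (W.map (countSketchMap (s, h))) hd
      ((Submodule.finrank_map_le _ _).trans hW) hm₂
  refine (measureReal_mono (s₂ := B₁ ∪ B₂) ?_).trans ((measureReal_union_le _ _).trans
    (by linarith))
  rintro q ⟨v, hv, hq⟩
  by_contra hnot
  rw [Set.mem_union, not_or] at hnot
  obtain ⟨hn1, hn2⟩ := hnot
  simp only [B₁, CS, B₂, Set.mem_ofPred_eq, not_exists, not_and, not_or, not_lt] at hn1 hn2
  obtain ⟨h3, h4⟩ := hn1 v hv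
  obtain ⟨h5, h6⟩ := hn2 _ (Submodule.mem_map_of_mem hv)
  rcases hq with hq | hq <;> linarith

/-- On a fixed subspace of dimension at most `d`, the Euclidean norm of the sampled vector is
comparable to the symmetric norm. -/
lemma IsSymmetricNorm.prob_norm_sampleMap_distort {ℓ : Seminorm ℝ (Fin n → ℝ)}
    (hℓ : IsSymmetricNorm ℓ) (hn : 2 ≤ n) (ht : 2 ^ t ≤ n) {a : ℕ} (ha : 8 ≤ a)
    (hat : n ≤ 2 ^ (a + t)) (V : Submodule ℝ (Fin n → ℝ)) (hV : Module.finrank ℝ V ≤ d) :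
    (bitLaw n t).real {z | ∃ y ∈ V,
      100 * d * ((t + 1) * (8 * mmc ℓ * (1 + Real.log (5 * n)))) * ℓ y < ‖sampleMap ℓ z y‖ ∨
      ‖sampleMap ℓ z y‖ < ℓ y /
        (4 * (Nat.log 2 n + 1 : ℕ) * √(2 ^ (a + 1) * d * (Nat.log 2 n + 1 : ℕ)))} ≤ 2 / 100 := by
  obtain ⟨u, hu, hspan, hcoord⟩ := hℓ.exists_auerbach (by omega) V
  rcases Nat.eq_zero_or_pos (Module.finrank ℝ V) with hr | hr
  · have hzero : ∀ y ∈ V, y = 0 := by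
      rw [Submodule.finrank_eq_zero] at hr
      simp [hr]
    refine le_of_eq_of_le ?_ (by norm_num : (0 : ℝ) ≤ 2 / 100)
    convert measureReal_empty
    ext z
    simp only [Set.mem_ofPred_eq, Set.mem_empty_iff_false, iff_false, not_exists, not_and]
    intro y hy
    rw [hzero y hy]
    simp
  · have hrd : (Module.finrank ℝ V : ℝ) ≤ d := by exact_mod_cast hV
    have hr0 : (0 : ℝ) < Module.finrank ℝ V := by exact_mod_cast hr
    have hrn : Module.finrank ℝ V ≤ n := by simpa using Submodule.finrank_le V
    have hgt := hℓ.prob_exists_norm_sampleMap_gt (t := t) (by omega) hu hcoord hr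
    have hlt := hℓ.prob_exists_norm_sampleMap_lt hn ht ha hat hr hrn hu hcoord
    refine (measureReal_mono ?_).trans ((measureReal_union_le _ _).trans
      ((add_le_add hgt hlt).trans (by norm_num)))
    rintro z ⟨y, hy, hz⟩
    obtain ⟨x, rfl⟩ := hspan y hy
    refine hz.imp (fun hz => ⟨x, lt_of_le_of_lt ?_ hz⟩) fun hz => ⟨x, lt_of_lt_of_le hz ?_⟩
    · have h1 := hℓ.mmc_nonneg (by omega)
      have h2 : 0 ≤ Real.log (5 * n) := Real.log_nonneg (by
        have : (2 : ℝ) ≤ n := by exact_mod_cast hn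
        linarith)
      have h3 : 0 ≤ ℓ (∑ k, x k • u k) := apply_nonneg ℓ _
      gcongr
    · have h3 : 0 ≤ ℓ (∑ k, x k • u k) := apply_nonneg ℓ _
      gcongr

/-- The sketch preserves the symmetric norm on the range of `A` with explicit distortion, except
with probability `2 / 100` for the sampling step and `2 / 100` for the Euclidean embeddings. -/
lemma IsSymmetricNorm.prob_norm2_sketch {ℓ : Seminorm ℝ (Fin n → ℝ)}
    (hℓ : IsSymmetricNorm ℓ) (hn : 2 ≤ n) (hd : 1 ≤ d) (ht : 2 ^ t ≤ n) {a : ℕ} (ha : 8 ≤ a)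
    (hat : n ≤ 2 ^ (a + t)) (hm₁ : 800 * d ^ 2 ≤ m₁) (hm₂ : 800 * d ≤ m₂)
    (A : Matrix (Fin n) (Fin d) ℝ) :
    9 / 10 ≤ (seedLaw n t m₁ m₂).real {ω | ∀ x : Fin d → ℝ,
      1 / 8 * (ℓ (A.mulVec x) /
        (4 * (Nat.log 2 n + 1 : ℕ) * √(2 ^ (a + 1) * d * (Nat.log 2 n + 1 : ℕ)))) ≤
          norm2 ((sketch ℓ ω * A).mulVec x) ∧
      norm2 ((sketch ℓ ω * A).mulVec x) ≤
        8 * (100 * d * ((t + 1) * (8 * mmc ℓ * (1 + Real.log (5 * n)))) * ℓ (A.mulVec x))} := by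
  have hm₁0 : m₁ ≠ 0 := by
    have : 0 < d ^ 2 := by positivity
    omega
  have : NeZero m₁ := ⟨hm₁0⟩
  set V : Submodule ℝ (Fin n → ℝ) := LinearMap.range A.mulVecLin
  have hV : Module.finrank ℝ V ≤ d := (LinearMap.finrank_range_le _).trans (by simp)
  let ν := (signLaw (Fin ((t + 1) * n))).prod
    ((hashLaw (Fin ((t + 1) * n)) m₁).prod (gaussLaw m₁ m₂))
  let law := (bitLaw n t).prod ν
  let Z : Set (Fin (t + 1) × Fin n → Bool) := {z | ∃ y ∈ V,
      100 * d * ((t + 1) * (8 * mmc ℓ * (1 + Real.log (5 * n)))) * ℓ y < ‖sampleMap ℓ z y‖ ∨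
      ‖sampleMap ℓ z y‖ < ℓ y /
        (4 * (Nat.log 2 n + 1 : ℕ) * √(2 ^ (a + 1) * d * (Nat.log 2 n + 1 : ℕ)))}
  let W : (Fin (t + 1) × Fin n → Bool) → Submodule ℝ (EuclideanSpace ℝ (Fin ((t + 1) * n))) :=
    fun z => V.map ((stackCoords n t).toLinearEquiv.toLinearMap ∘ₗ sampleMap ℓ z)
  let B : Set ((Fin (t + 1) × Fin n → Bool) × (Fin ((t + 1) * n) → Bool) ×
      (Fin ((t + 1) * n) → Fin m₁) × (Fin m₂ × Fin m₁ → ℝ)) :=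
    {p | ∃ v ∈ W p.1, ‖gaussMap p.2.2.2 (countSketchMap (p.2.1, p.2.2.1) v)‖ < 1 / 8 * ‖v‖ ∨
        8 * ‖v‖ < ‖gaussMap p.2.2.2 (countSketchMap (p.2.1, p.2.2.1) v)‖}
  have hZ : law.real (Z ×ˢ Set.univ) ≤ 2 / 100 := by
    rw [measureReal_prod_prod, probReal_univ, mul_one]
    exact hℓ.prob_norm_sampleMap_distort hn ht ha hat V hV
  have hB : law.real B ≤ 2 / 100 := by
    refine prod_real_le_of_forall_slice _ _ (by norm_num) fun z => ?_
    exact prob_gaussMap_countSketchMap_distort (W z) hd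
      ((Submodule.finrank_map_le _ _).trans hV) hm₁ hm₂
  set S : Set (Seed n t m₁ m₂) := {ω | ∀ x : Fin d → ℝ, _}
  have hle : law.real (Seed.ofProd ⁻¹' S) ≤ (seedLaw n t m₁ m₂).real S :=
    ENNReal.toReal_mono (measure_ne_top _ _)
      (Measure.le_map_apply Seed.measurable_ofProd.aemeasurable _)
  refine le_trans ?_ hle
  have hcover : Set.univ ⊆ Seed.ofProd ⁻¹' S ∪ (Z ×ˢ Set.univ ∪ B) := ?_
  · have h0 := measureReal_mono (μ := law) hcover
    rw [probReal_univ] at h0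
    have h1 := measureReal_union_le (μ := law) (Seed.ofProd ⁻¹' S) (Z ×ˢ Set.univ ∪ B)
    have h2 := measureReal_union_le (μ := law) (Z ×ˢ Set.univ) B
    linarith
  · rintro p -
    by_contra hnot
    simp only [Set.mem_union, not_or] at hnot
    obtain ⟨hS, hnZ, hnB⟩ := hnot
    refine hS fun x => ?_
    rw [norm2_sketch_mul_mulVec]
    simp only [Seed.ofProd]
    have hxV : A.mulVec x ∈ V := ⟨x, rfl⟩
    have hnZ' : p.1 ∉ Z := fun h => hnZ ⟨h, trivial⟩
    simp only [Z, B, Set.mem_ofPred_eq, not_exists, not_and, not_or, not_lt] at hnZ' hnB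
    obtain ⟨h1, h2⟩ := hnZ' _ hxV
    obtain ⟨h3, h4⟩ := hnB _ (Submodule.mem_map_of_mem hxV)
    simp only [LinearMap.comp_apply, LinearEquiv.coe_coe, LinearIsometryEquiv.coe_toLinearEquiv,
      LinearIsometryEquiv.norm_map] at h3 h4
    constructor <;> linarith

end Embedding

/-! ### Comparison with powers of `log n` -/

section Constants

variable {n d t m₁ m₂ K : ℕ}

lemma half_le_log_natCast (hn : 2 ≤ n) : 1 / 2 ≤ Real.log n := by
  have h1 : Real.log 2 ≤ Real.log n := Real.log_le_log (by norm_num) (by exact_mod_cast hn)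
  have h2 := Real.log_two_gt_d9
  linarith

lemma natLog_succ_le (hn : 2 ≤ n) : ((Nat.log 2 n + 1 : ℕ) : ℝ) ≤ 4 * Real.log n := by
  have h1 : (Nat.log 2 n : ℝ) * Real.log 2 ≤ Real.log n := by
    rw [← Real.log_pow]
    exact Real.log_le_log (by positivity) (by exact_mod_cast Nat.pow_log_le_self 2 (by omega))
  have h2 := Real.log_two_gt_d9
  have h3 := half_le_log_natCast hn
  have h4 : (Nat.log 2 n : ℝ) * (1 / 2) ≤ Nat.log 2 n * Real.log 2 := by gcongr; linarith
  push_cast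
  linarith

lemma succ_le_log (hn : 2 ≤ n) (ht : 2 ^ t ≤ n) : (t : ℝ) + 1 ≤ 4 * Real.log n := by
  refine le_trans ?_ (natLog_succ_le hn)
  have : t ≤ Nat.log 2 n := Nat.le_log_of_pow_le (by norm_num) ht
  exact_mod_cast Nat.succ_le_succ this

lemma one_add_log_five_mul_le (hn : 2 ≤ n) : 1 + Real.log (5 * n) ≤ 7 * Real.log n := by
  have h3 := half_le_log_natCast hn
  have h5 : Real.log 5 ≤ 2 := by
    rw [Real.log_le_iff_le_exp (by norm_num), show (2 : ℝ) = 1 + 1 by norm_num, Real.exp_add]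
    have := Real.exp_one_gt_d9
    nlinarith
  rw [Real.log_mul (by norm_num) (by positivity)]
  linarith

lemma upper_constant_le (hn : 2 ≤ n) (hd : 1 ≤ d) (ht : 2 ^ t ≤ n) {μ C : ℝ} (hμ : 0 ≤ μ)
    (hC : 400000 ≤ C) :
    8 * (100 * d * ((t + 1) * (8 * μ * (1 + Real.log (5 * n))))) ≤
      C * (μ * (d : ℝ) ^ 2 * Real.log n ^ (5 / 2 : ℝ)) := by
  have h1 := half_le_log_natCast hn
  have h0 : 0 < Real.log n := by linarith
  have hd' : (d : ℝ) ≤ d ^ 2 := by exact_mod_cast Nat.le_self_pow (by norm_num) d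
  have hsq : Real.log n ^ 2 ≤ 2 * Real.log n ^ (5 / 2 : ℝ) := by
    rw [show (5 / 2 : ℝ) = 2 + 1 / 2 by norm_num, Real.rpow_add h0, Real.rpow_two,
      ← Real.sqrt_eq_rpow]
    have : 1 / 2 ≤ √(Real.log n) := Real.le_sqrt_of_sq_le (by linarith)
    nlinarith [sq_nonneg (Real.log n)]
  calc 8 * (100 * d * ((t + 1) * (8 * μ * (1 + Real.log (5 * n)))))
      ≤ 8 * (100 * d ^ 2 * (4 * Real.log n * (8 * μ * (7 * Real.log n)))) := by
        have := succ_le_log hn ht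
        have := one_add_log_five_mul_le hn
        have : 0 ≤ Real.log (5 * n) := Real.log_nonneg (by
          have : (2 : ℝ) ≤ n := by exact_mod_cast hn
          linarith)
        gcongr
    _ = 179200 * (μ * (d : ℝ) ^ 2) * Real.log n ^ 2 := by ring
    _ ≤ 179200 * (μ * (d : ℝ) ^ 2) * (2 * Real.log n ^ (5 / 2 : ℝ)) := by gcongr
    _ = 358400 * (μ * (d : ℝ) ^ 2 * Real.log n ^ (5 / 2 : ℝ)) := by ring
    _ ≤ C * (μ * (d : ℝ) ^ 2 * Real.log n ^ (5 / 2 : ℝ)) := by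
        gcongr
        linarith

lemma lower_constant_le (hn : 2 ≤ n) (hd : 1 ≤ d) (a : ℕ) {y : ℝ} (hy : 0 ≤ y) :
    1 / (1024 * √(2 ^ (a + 1))) * (1 / (√(d : ℝ) * Real.log n ^ 3)) * y ≤
      1 / 8 * (y / (4 * (Nat.log 2 n + 1 : ℕ) * √(2 ^ (a + 1) * d * (Nat.log 2 n + 1 : ℕ)))) := by
  have h1 := half_le_log_natCast hn
  have h0 : 0 < Real.log n := by linarith
  have hd0 : (0 : ℝ) < d := by exact_mod_cast hd
  set L : ℝ := ((Nat.log 2 n + 1 : ℕ) : ℝ)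
  have hL : L ≤ 4 * Real.log n := natLog_succ_le hn
  have hL1 : 1 ≤ L := by simp [L]
  have hsqrt : √L ≤ L := by
    rw [Real.sqrt_le_left (by linarith)]
    nlinarith
  have key : L * √L ≤ 32 * Real.log n ^ 3 :=
    calc L * √L ≤ (4 * Real.log n) * (4 * Real.log n) := by gcongr; linarith
      _ ≤ (4 * Real.log n) * (4 * Real.log n) * (2 * Real.log n) :=
        le_mul_of_one_le_right (by positivity) (by linarith)
      _ = 32 * Real.log n ^ 3 := by ring
  rw [Real.sqrt_mul (by positivity), Real.sqrt_mul (by positivity)]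
  calc 1 / (1024 * √(2 ^ (a + 1))) * (1 / (√(d : ℝ) * Real.log n ^ 3)) * y
      = y / (32 * √(2 ^ (a + 1)) * √d * (32 * Real.log n ^ 3)) := by
        field_simp
        ring
    _ ≤ y / (32 * √(2 ^ (a + 1)) * √d * (L * √L)) := by gcongr
    _ = 1 / 8 * (y / (4 * L * (√(2 ^ (a + 1)) * √d * √L))) := by
        field_simp
        ring

lemma denseCost_le (hd : 1 ≤ d) (hm₁ : m₁ ≤ K * d ^ 2) (hm₂ : m₂ ≤ K * d) :
    denseCost d m₁ m₂ ≤ (7 * K ^ 2 + 10 * K + 17) * d ^ 4 := by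
  have hp : ∀ i ≤ 4, d ^ i ≤ d ^ 4 := fun i hi => Nat.pow_le_pow_right hd hi
  have h0 := hp 0 (by norm_num)
  have h1 := hp 1 (by norm_num)
  have h2 := Nat.mul_le_mul_left (7 * K) (hp 2 (by norm_num))
  have h3 := Nat.mul_le_mul_left (3 * K) (hp 3 (by norm_num))
  calc denseCost d m₁ m₂ ≤ d * (3 * (K * d ^ 2) + K * d * (7 * (K * d ^ 2) + 7) + 13) + 4 := by
        rw [denseCost]
        gcongr
    _ = 3 * K * d ^ 3 + 7 * K ^ 2 * d ^ 4 + 7 * K * d ^ 2 + 13 * d ^ 1 + 4 * d ^ 0 := by ring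
    _ ≤ (7 * K ^ 2 + 10 * K + 17) * d ^ 4 := by linarith

end Constants

end SymSketch

open SymSketch MeasureTheory in
theorem theorem5 :
    -- `K₀`: how large the constants hidden in the dimensions of the sketch have to be;
    -- `p`: the exponent in `poly(d)`; `P`: one program for all inputs
    ∃ (K₀ p : ℕ) (P : Program),
    -- `K`: upper bound on the constants hidden in the dimensions of the sketch
    ∀ K : ℕ, K₀ ≤ K → ∃ c C : ℝ, 0 < c ∧ 0 < C ∧
    ∀ n d t m₁ m₂ : ℕ, 2 ≤ n → 1 ≤ d →
      2 ^ t ≤ n → n ≤ K * 2 ^ t →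
      K₀ * d ^ 2 ≤ m₁ → m₁ ≤ K * d ^ 2 →
      K₀ * d ≤ m₂ → m₂ ≤ K * d →
    ∀ ℓ : Seminorm ℝ (Fin n → ℝ), IsSymmetricNorm ℓ →
    ∀ A : Matrix (Fin n) (Fin d) ℝ,
      -- the embedding property
      9 / 10 ≤ (seedLaw n t m₁ m₂).real {ω | ∀ x : Fin d → ℝ,
          c * (1 / (√(d : ℝ) * Real.log n ^ 3)) * ℓ (A.mulVec x)
              ≤ norm2 ((sketch ℓ ω * A).mulVec x) ∧
            norm2 ((sketch ℓ ω * A).mulVec x)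
              ≤ C * (mmc ℓ * (d : ℝ) ^ 2 * Real.log n ^ (5 / 2 : ℝ)) * ℓ (A.mulVec x)} ∧
      -- the time for computing `S A`
      ∃ T : Seed n t m₁ m₂ → ℕ, Measurable T ∧
        (∀ (ω : Seed n t m₁ m₂) (s : Memory),
          IsInput A (samplingMatrix ℓ ω) (countSketch ω) (gaussianEmbedding ω) s →
          ∃ (k : ℕ) (s' : Memory), k ≤ T ω ∧ Exec P s k s' ∧ IsOutput (sketch ℓ ω * A) s') ∧
        (∀ ω, (T ω : ℝ) ≤ C * ((nnz A : ℝ) * Real.log n + (d : ℝ) ^ p)) ∧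
        ∫ ω, (T ω : ℝ) ∂(seedLaw n t m₁ m₂) ≤ C * ((nnz A : ℝ) + (d : ℝ) ^ p) := by
  -- `800` is what the two Euclidean embeddings need; `2 ^ (K + 8) ≥ 256 K` leaves room in the grid
  -- argument and makes `n ≤ 2 ^ (K + 8 + t)`
  refine ⟨800, 4, sketchProgram, fun K hK => ⟨1 / (1024 * √(2 ^ (K + 8 + 1))),
    400000 + (7 * K ^ 2 + 10 * K + 17), by positivity, by positivity, ?_⟩⟩
  intro n d t m₁ m₂ hn hd ht hnt hm₁ hm₁' hm₂ hm₂' ℓ hℓ A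
  have hlog := half_le_log_natCast hn
  have hm₁0 : m₁ ≠ 0 := by
    have : 0 < d ^ 2 := by positivity
    omega
  have : NeZero m₁ := ⟨hm₁0⟩
  have hdense : (denseCost d m₁ m₂ : ℝ) ≤ (7 * K ^ 2 + 10 * K + 17) * (d : ℝ) ^ 4 := by
    exact_mod_cast denseCost_le hd hm₁' hm₂'
  have hd4 : (0 : ℝ) ≤ (d : ℝ) ^ 4 := by positivity
  have hnnz : (0 : ℝ) ≤ nnz A := by positivity
  have hT : Measurable (timeBound A m₁ m₂ : (Fin (t + 1) × Fin n → Bool) → ℕ) :=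
    Measurable.of_discrete
  refine ⟨?_, fun ω => timeBound A m₁ m₂ ω.z, hT.comp Seed.measurable_z,
    fun ω s hs => runs_sketchProgram_timeBound hd hs, fun ω => ?_, ?_⟩
  · have hat : n ≤ 2 ^ (K + 8 + t) := by
      refine hnt.trans ?_
      rw [pow_add]
      refine Nat.mul_le_mul_right _ ((Nat.lt_two_pow_self (n := K)).le.trans ?_)
      exact Nat.pow_le_pow_right (by norm_num) (by omega)
    refine (hℓ.prob_norm2_sketch hn hd ht (a := K + 8) (by omega) hat hm₁ hm₂ A).trans
      (measureReal_mono fun ω hω x => ?_)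
    have hy : 0 ≤ ℓ (A.mulVec x) := apply_nonneg ℓ _
    refine ⟨(lower_constant_le hn hd (K + 8) hy).trans (hω x).1, (hω x).2.trans ?_⟩
    rw [← mul_assoc]
    refine mul_le_mul_of_nonneg_right (upper_constant_le hn hd ht (hℓ.mmc_nonneg (by omega)) ?_) hy
    have : (0 : ℝ) ≤ 7 * K ^ 2 + 10 * K + 17 := by positivity
    linarith
  · have h1 : (timeBound A m₁ m₂ ω.z : ℝ) ≤ nnz A * (8 + 17 * (t + 1)) + denseCost d m₁ m₂ := by
      exact_mod_cast timeBound_le A m₁ m₂ ω.z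
    have h2 : (nnz A : ℝ) * (8 + 17 * (t + 1)) ≤ nnz A * (84 * Real.log n) := by
      gcongr
      have := succ_le_log hn ht
      linarith
    have h3 : 0 ≤ (nnz A : ℝ) * Real.log n := by positivity
    have h4 : 0 ≤ (7 * (K : ℝ) ^ 2 + 10 * K + 17) * (nnz A * Real.log n) := by positivity
    linarith
  · rw [integral_seedLaw_z fun z => (timeBound A m₁ m₂ z : ℝ)]
    refine (integral_timeBound_le A m₁ m₂).trans ?_
    have h4 : 0 ≤ (7 * (K : ℝ) ^ 2 + 10 * K + 17) * nnz A := by positivity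
    linarith
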